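/- **Setting.** Let $G$ be a finite connected plane graph without loops or multiple edges, with a weight on each edge. Its planar dual $G^*$ has the bounded faces of $G$ as vertices, with an edge joining two distinct bounded faces for every edge of $G$ that they share. The dual refinement $H_G$ is the graph whose vertices are the vertices of $G$ (original vertices), the edges of $G$ (edge-vertices) and the bounded faces of $G$ (face-vertices), in which the edge-vertex of an edge $e$ is joined to the two endpoints of $e$ and to the bounded faces whose boundary contains $e$. An edge of $H_G$ joining the edge-vertex of $e$ to an endpoint of $e$ (a half-edge of $e$) has the weight of $e$; the edges of $H_G$ at face-vertices have weight $1$. The weight of a matching, or of a forest, is the product of the weights of its edges. Let $n\ge 0$ and let $v_1,v_2,\dots,v_{2n+1},v'_{2n+1},\dots,v'_2,v'_1$ be distinct vertices, in counterclockwise cyclic order on the boundary of the infinite face of $G$, such that $v'_1v'_2\cdots v'_{2n+1}$ is a path in $G$, and such that $v_2,v_4,\dots,v_{2n},v'_2,v'_4,\dots,v'_{2n}$ have degree $2$ and belong to distinct bounded faces $f_2,f_4,\dots,f_{2n},f'_2,f'_4,\dots,f'_{2n}$ of $G$, respectively. Let $\widehat H_G$ be obtained from $H_G$ by deleting the vertices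 $v_{2i},v'_{2i}$ $(1\le i\le n)$ together with the edge-vertices on the infinite face adjacent to them, and let $G_0=G\setminus\{v_2,\dots,v_{2n},v'_2,\dots,v'_{2n}\}$. A spanning forest $F$ of a plane graph is *banded* if there are vertices $u_1,\dots,u_k,u'_k,\dots,u'_1$, in counterclockwise order on the boundary of its infinite face, such that $F$ consists of $k$ different trees (*bands*), each containing one pair $(u_i,u'_i)$. A forest is *rooted* at a set of vertices if each of its trees contains exactly one of them (the root); its edges are then oriented towards the roots. For a spanning forest $F$ of $G_0$, let $F^*$ be the subgraph of $G^*$ consisting of all vertices of $G^*$ and of the edges of $G^*$ whose corresponding edge of $G$ is not in $F$. A *channel* of $F$ is a connected component of $F^*$ that contains exactly two vertices which are joined to the infinite face of $G$ across an edge of $G$ not in $F$. **Theorem 5.4.** (a) There is a natural weight-preserving bijection $\Phi$ between the set of perfect matchings of $\widehat H_G\setminus\{v'_1,f'_2,v'_3,f'_4,\dots,f'_{2n},v'_{2n+1}\}$ and the set of banded spanning forests $F$ of $G_0$ rooted at $v'_1,v'_3,\dots,v'_{2n+1}$, with $v_{2i-1}$ and $v'_{2i-1}$ in the same band for $1\le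 i\le n+1$, and $f_{2i}$ and $f'_{2i}$ in the same channel of $F$ for $1\le i\le n$. Here "natural" means that $\Phi$ does not depend on the weights and that, for every edge $\{x,y\}$ of $G$, the forest $\Phi(\mu)$ contains this edge oriented from $x$ to $y$ if and only if $\mu$ contains the half-edge of $\{x,y\}$ at $x$. (b) More generally, let $P_1,\dots,P_{2n+1}$ be pairwise disjoint paths on $H_G$ such that $P_{2i-1}$ is a path in $G$ from $v_{2i-1}$ to $v'_{2i-1}$ for $1\le i\le n+1$, and $P_{2i}$ is a path in $G^*$ from $f_{2i}$ to $f'_{2i}$ for $1\le i\le n$. Then, for every $I\subseteq\{1,\dots,2n+1\}$, the map $\Phi$ restricts to a (weight-preserving) bijection between 1. the set of perfect matchings of $\widehat H_G\setminus\{v'_1,f'_2,v'_3,\dots,v'_{2n+1}\}$ that contain, for each $i\in I$, all the edges of the unique perfect matching of the path obtained from $P_i$ by deleting its last vertex, and 2. the set of forests $F$ as in (a) such that $P_i$ is contained in $F$ for all odd $i\in I$, and $P_i$ is contained in a channel of $F$ for all even $i\in I$. -/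

import Mathlib

/-- A rotation system on a simple graph: for every vertex `x`, a cyclic ordering of all the darts
(oriented edges) leaving `x`.  `rot d` is the next dart after `d` in counterclockwise order around
the tail `d.fst` of `d`. -/
structure RotationSystem {V : Type*} (G : SimpleGraph V) where
  rot : Equiv.Perm G.Dart
  rot_fst : ∀ d, (rot d).fst = d.fst
  rot_sameCycle : ∀ d d' : G.Dart, d.fst = d'.fst → rot.SameCycle d d'

namespace RotationSystem

variable {V : Type*} {G : SimpleGraph V} (R : RotationSystem G)

/-- The successor of a dart along the boundary of the face lying to the left of it:
traverse `d`, and then leave its head along the next dart clockwise from the reversal of `d`. -/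
def facePerm : Equiv.Perm G.Dart where
  toFun d := R.rot.symm d.symm
  invFun d := (R.rot d).symm
  left_inv d := by simp
  right_inv d := by simp

/-- The faces of the embedding: the orbits of `facePerm` on the darts. -/
def Face : Type _ := Quotient (Equiv.Perm.SameCycle.setoid R.facePerm)

/-- The face lying to the left of a dart. -/
def faceOf (d : G.Dart) : R.Face := Quotient.mk _ d

end RotationSystem

/-- A (finite, connected, simple) plane graph with at least one edge, up to orientation preserving
homeomorphism of the plane: a connected graph with a rotation system of genus zero (that is, one
satisfying Euler's formula) and a distinguished face, the infinite (unbounded) one. -/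
structure PlaneEmbedding {V : Type*} (G : SimpleGraph V) extends RotationSystem G where
  connected : G.Connected
  euler : (Nat.card V : ℤ) - Nat.card G.edgeSet + Nat.card toRotationSystem.Face = 2
  outer : toRotationSystem.Face

namespace PlaneEmbedding

section

variable {V : Type*} {G : SimpleGraph V} (E : PlaneEmbedding G)

/-- The bounded faces, which are the vertices of the planar dual `G*`. -/
abbrev BoundedFace : Type _ := {φ : E.Face // φ ≠ E.outer}

/-- The vertex `x` lies on the boundary of the face `φ`. -/
def VertexOnFace (x : V) (φ : E.Face) : Prop := ∃ d : G.Dart, d.fst = x ∧ E.faceOf d = φ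

/-- The edge `e` lies on the boundary of the face `φ`. -/
def EdgeOnFace (e : Sym2 V) (φ : E.Face) : Prop := ∃ d : G.Dart, d.edge = e ∧ E.faceOf d = φ

/-! ### Boundary of the infinite face of a subgraph -/

/-- For a dart `d` of the subgraph `K`: the successor of `d` along the boundary of the face of `K`
to the left of `d`. It is the first dart of `K` met when turning clockwise around the head of `d`,
starting from the reversal of `d`. For `K = ⊤` this is `facePerm`. -/
noncomputable def nextIn (K : G.Subgraph) (d : G.Dart) : G.Dart :=
  (E.rot⁻¹ ^ sInf {k : ℕ | 0 < k ∧
    K.Adj ((E.rot⁻¹ ^ k) d.symm).fst ((E.rot⁻¹ ^ k) d.symm).snd}) d.symm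

/-- The face `φ` of `G` is part of the infinite face of the subgraph `K`: one can go from `φ` to
the infinite face of `G` by crossing only edges of `G` that are not in `K`. -/
def InInfiniteFace (K : G.Subgraph) (φ : E.Face) : Prop :=
  Relation.ReflTransGen
    (fun φ₁ φ₂ => ∃ d : G.Dart, E.faceOf d = φ₁ ∧ E.faceOf d.symm = φ₂ ∧ ¬ K.Adj d.fst d.snd)
    φ E.outer

/-- The vertices met on one full turn along the boundary of the face of `K` to the left of `d`,
starting at the tail of `d`. For the infinite face this is the clockwise order. -/
noncomputable def boundaryList (K : G.Subgraph) (d : G.Dart) : List V :=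
  (List.range (Function.minimalPeriod (E.nextIn K) d)).map fun k => ((E.nextIn K)^[k] d).fst

/-- The members of the list `L` are distinct vertices on the boundary of the infinite face of the
(connected) subgraph `K`, listed in counterclockwise cyclic order. -/
def InCCWOrder (K : G.Subgraph) (L : List V) : Prop :=
  L.Nodup ∧ ∃ d : G.Dart, K.Adj d.fst d.snd ∧ E.InInfiniteFace K (E.faceOf d) ∧
    L.Sublist (E.boundaryList K d).reverse

/-! ### The dual refinement -/

/-- Vertices of the dual refinement `H_G`: original vertices, edge-vertices, face-vertices. -/
inductive RefVertex : Type _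
  | orig (x : V) : RefVertex
  | mid (e : G.edgeSet) : RefVertex
  | face (φ : E.BoundedFace) : RefVertex

/-- The dual refinement `H_G`: each edge-vertex is joined to the two endpoints of the edge, and to
the bounded faces whose boundary contains the edge. -/
def dualRefinement : SimpleGraph E.RefVertex :=
  SimpleGraph.fromRel fun a b => match a, b with
    | .mid e, .orig x => x ∈ e.1
    | .mid e, .face φ => E.EdgeOnFace e.1 φ.1
    | _, _ => False

/-- The weight induced on the edges of `H_G` by a weight `w` on the edges of `G` (the edges of
`H_G` incident to a face-vertex have weight `1`). -/
def refWeight {R : Type*} [One R] (w : Sym2 V → R) : Sym2 E.RefVertex → R :=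
  Sym2.lift ⟨fun a b => match a, b with
    | .mid e, .orig _ => w e.1
    | .orig _, .mid e => w e.1
    | _, _ => 1, by
      intro a b
      cases a <;> cases b <;> rfl⟩

/-- The vertices that are removed from `H_G` when smashing in all the vertices in `S`: those
vertices, and the edge-vertices on the infinite face adjacent to them. -/
def smashedVerts (S : Set V) : Set E.RefVertex :=
  {a | ∃ x ∈ S, a = .orig x ∨ ∃ e : G.edgeSet, a = .mid e ∧ x ∈ e.1 ∧ E.EdgeOnFace e.1 E.outer}

/-- The graph obtained from `H_G` by smashing in the vertices in `S`. -/
def smashed (S : Set V) : E.dualRefinement.Subgraph :=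
  (⊤ : E.dualRefinement.Subgraph).deleteVerts (E.smashedVerts S)

/-! ### Dual forest and channels -/

/-- The dual `F*` of a subgraph `F`: all the vertices of `G*`, and the edges of `G*` for which
the corresponding edge of `G` is not in `F`. -/
def dualForest (F : G.Subgraph) : SimpleGraph E.BoundedFace where
  Adj φ ψ := φ ≠ ψ ∧
    ∃ d : G.Dart, E.faceOf d = φ.1 ∧ E.faceOf d.symm = ψ.1 ∧ d.edge ∉ F.edgeSet
  symm := ⟨fun φ ψ ⟨h, d, h₁, h₂, h₃⟩ =>
    ⟨h.symm, d.symm, h₂, by simpa using h₁, by simpa using h₃⟩⟩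
  loopless := ⟨fun _ h => h.1 rfl⟩

/-- The bounded face `φ` is joined to the infinite face across an edge of `G` not in `F`. -/
def JoinedToOuter (F : G.Subgraph) (φ : E.BoundedFace) : Prop :=
  ∃ d : G.Dart, E.faceOf d = φ.1 ∧ E.faceOf d.symm = E.outer ∧ d.edge ∉ F.edgeSet

/-- A connected component of `F*` is a channel of `F` if it contains exactly two vertices that are
joined to the infinite face (across edges not in `F`). -/
def IsChannel (F : G.Subgraph) (T : (E.dualForest F).ConnectedComponent) : Prop :=
  {φ | φ ∈ T.supp ∧ E.JoinedToOuter F φ}.ncard = 2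

/-- The two faces are in the same channel of `F`. -/
def SameChannel (F : G.Subgraph) (φ ψ : E.BoundedFace) : Prop :=
  ∃ T : (E.dualForest F).ConnectedComponent, E.IsChannel F T ∧ φ ∈ T.supp ∧ ψ ∈ T.supp

/-! ### Spanning forests -/

/-- The spanning forest `F` of the subgraph `K` is banded: there are distinguished points
`u₁, …, u_k, u'_k, …, u'₁`, in counterclockwise order on the boundary of the infinite face of `K`,
so that `F` consists of `k` different trees, each containing one pair `(u_i, u'_i)`. -/
def IsBanded (K F : G.Subgraph) : Prop :=
  ∃ (k : ℕ) (u u' : Fin k → V),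
    E.InCCWOrder K (List.ofFn u ++ (List.ofFn u').reverse) ∧
    (∀ i, u i ∈ F.verts ∧ u' i ∈ F.verts ∧ F.spanningCoe.Reachable (u i) (u' i)) ∧
    ∀ x ∈ F.verts, ∃! i, F.spanningCoe.Reachable x (u i)

end

end PlaneEmbedding

section

variable {V : Type*} {G : SimpleGraph V}

/-- `F` is a spanning forest of the subgraph `K`. -/
def IsSpanningForest (K F : G.Subgraph) : Prop :=
  F ≤ K ∧ F.verts = K.verts ∧ F.coe.IsAcyclic

/-- The forest `F` is rooted at the vertices `r i`: each connected component of `F` contains exactly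
one of them. -/
def IsRootedAt {ι : Type*} (F : G.Subgraph) (r : ι → V) : Prop :=
  (∀ i, r i ∈ F.verts) ∧ ∀ x ∈ F.verts, ∃! i, F.spanningCoe.Reachable x (r i)

/-- The forest `F`, rooted at the vertices `r i`, contains the edge `{x, y}`, oriented from `x` to
`y`; that is, the path of `F` from `x` to the root of its component starts with the step to `y`. -/
def HasOrientedEdge {ι : Type*} (F : G.Subgraph) (r : ι → V) (x y : V) : Prop :=
  ∃ (h : F.spanningCoe.Adj x y) (i : ι) (p : F.spanningCoe.Walk y (r i)),
    (SimpleGraph.Walk.cons h p).IsPath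

/-- The perfect matchings of the subgraph `K`. -/
def perfectMatchings (K : G.Subgraph) : Set G.Subgraph :=
  {μ | μ ≤ K ∧ μ.verts = K.verts ∧ μ.IsMatching}

/-- The weight of a subgraph: the product of the weights of its edges. -/
noncomputable def subgraphWeight {R : Type*} [CommMonoid R] (w : Sym2 V → R) (F : G.Subgraph) : R :=
  ∏ᶠ e ∈ F.edgeSet, w e

/-- `μ` contains all the edges of the perfect matching of the path obtained from the path `P` by
deleting its last vertex. -/
def ContainsMatchingOf {s t : V} (μ : G.Subgraph) (P : G.Walk s t) : Prop :=
  ∃ M ∈ perfectMatchings (P.toSubgraph.deleteVerts {t}), M.edgeSet ⊆ μ.edgeSet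

/-- Position (counting from `0`) of the `i`-th odd-numbered member of `v₁, v₂, …, v_{2n+1}`. -/
def oddIdx {n : ℕ} (i : Fin (n + 1)) : Fin (2 * n + 1) := ⟨2 * i, by omega⟩

/-- Position (counting from `0`) of the `i`-th even-numbered member of `v₁, v₂, …, v_{2n+1}`. -/
def evenIdx {n : ℕ} (i : Fin n) : Fin (2 * n + 1) := ⟨2 * i + 1, by omega⟩

/-- The vertices `v₂, v₄, …, v_{2n}, v'₂, v'₄, …, v'_{2n}`. -/
def evenVerts {n : ℕ} (v v' : Fin (2 * n + 1) → V) : Set V :=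
  Set.range (fun i => v (evenIdx i)) ∪ Set.range (fun i => v' (evenIdx i))

end

namespace PlaneEmbedding

section

variable {V : Type*} {G : SimpleGraph V} (E : PlaneEmbedding G) {n : ℕ}

/-- The sequence `v₁, f₂, v₃, f₄, …, f_{2n}, v_{2n+1}` of vertices of `H_G`. -/
def terminal (v : Fin (2 * n + 1) → V) (f : Fin n → E.BoundedFace) (j : Fin (2 * n + 1)) :
    E.RefVertex :=
  if h : j.val % 2 = 0 then .orig (v j) else .face (f ⟨j.val / 2, by omega⟩)

/-- The perfect matchings of `Ĥ_G ∖ {v'₁, f'₂, v'₃, …, v'_{2n+1}}`. -/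
def matchingSet (v v' : Fin (2 * n + 1) → V) (f' : Fin n → E.BoundedFace) :
    Set E.dualRefinement.Subgraph :=
  perfectMatchings ((E.smashed (evenVerts v v')).deleteVerts (Set.range (E.terminal v' f')))

/-- The banded spanning forests of `G ∖ {v₂, …, v_{2n}, v'₂, …, v'_{2n}}` rooted at
`v'₁, v'₃, …, v'_{2n+1}`, with `v_{2i-1}` and `v'_{2i-1}` in the same band, and `f_{2i}` and
`f'_{2i}` in the same channel, for all `i`. -/
def forestSet (v v' : Fin (2 * n + 1) → V) (f f' : Fin n → E.BoundedFace) : Set G.Subgraph :=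
  {F | IsSpanningForest ((⊤ : G.Subgraph).deleteVerts (evenVerts v v')) F ∧
    E.IsBanded ((⊤ : G.Subgraph).deleteVerts (evenVerts v v')) F ∧
    IsRootedAt F (fun i : Fin (n + 1) => v' (oddIdx i)) ∧
    (∀ i : Fin (n + 1), F.spanningCoe.Reachable (v (oddIdx i)) (v' (oddIdx i))) ∧
    ∀ i : Fin n, E.SameChannel F (f i) (f' i)}

/-- A path of `H_G` that is a path in `G`. -/
def IsFramePath {a b : E.RefVertex} (P : E.dualRefinement.Walk a b) : Prop :=
  P.IsPath ∧ ∀ φ, RefVertex.face φ ∉ P.support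

/-- A path of `H_G` that is a path in the planar dual `G*`. -/
def IsDualFramePath {a b : E.RefVertex} (P : E.dualRefinement.Walk a b) : Prop :=
  P.IsPath ∧ ∀ x, RefVertex.orig x ∉ P.support

/-- The path `P` in `G` is contained in `F`. -/
def ContainedInForest {a b : E.RefVertex} (P : E.dualRefinement.Walk a b) (F : G.Subgraph) : Prop :=
  (∀ x, RefVertex.orig x ∈ P.support → x ∈ F.verts) ∧
    ∀ e, RefVertex.mid e ∈ P.support → e.1 ∈ F.edgeSet

/-- The path `P` in `G*` is contained in a channel of `F`. -/
def ContainedInChannel {a b : E.RefVertex} (P : E.dualRefinement.Walk a b) (F : G.Subgraph) :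
    Prop :=
  ∃ T : (E.dualForest F).ConnectedComponent, E.IsChannel F T ∧
    (∀ φ, RefVertex.face φ ∈ P.support → φ ∈ T.supp) ∧
    ∀ e, RefVertex.mid e ∈ P.support → e.1 ∉ F.edgeSet

end

end PlaneEmbedding

/-!
A perfect matching pairs the vertices of `G` that are neither smashed nor roots with some of the
edges, and the bounded faces other than the `f'_{2i}` with all the others that are not smashed. Let
`F` be the set of the edges of the first kind. Following from each vertex or face the edge it is
paired with to the other side defines a *flow*, on the vertices along the edges in `F`, and on the
faces across the edges not in `F`. The bijection sends the matching to `F`; the flow on the vertices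
is the orientation of the forest towards its roots.

Everything rests on Euler's formula for arbitrary sets `A` of edges, `euler_of_subset`: the edges of
`A` and the components of `A` are counted against the vertices and the components of the dual of the
complement of `A`. In particular (`linked_fst_iff_not_linked_faceOf`), `A` links the ends of an edge
if and only if the dual of the complement of `A` needs this edge to link its two sides.

*A matching gives a forest.* Consider a set of faces that the flow does not leave, except to the
infinite face. Its edges cut off a part of the graph, and comparing the number of edges in this part
with the number of vertices and faces that they are paired with shows that the part contains fewer
smashed vertices than roots, faces `f'_{2i}` and infinite faces (`IsPairing.region_count`). With a
suitable choice of the set of faces, this proves in turn that the flow on the faces has no cycles, so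
that the dual of the complement of `F` is connected and `F` is a forest; that the flow from `f_{2i}`
ends in some `f'_{2j}`; and, by counting on both sides of it, that `j = i`. Hence `f_{2i}` and
`f'_{2i}` are in one channel. These channels separate the outer boundary into arcs, which forces the
flow from `v_{2i-1}` to end in `v'_{2i-1}`. The counterclockwise order required of the bands is
inherited by the graph without the smashed vertices, because the boundary of its infinite face only
makes detours along the faces `f_{2i}` and `f'_{2i}` (`IsFrame.inCCWOrder_odd`).

*A forest gives a matching.* In a forest as in the theorem, each vertex is linked to a root, and each
face to some `f'_{2i}` or to the infinite face. Pairing each vertex and face with the first edge of a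
shortest path to such a sink is injective, and by Euler's formula the numbers of edges are right
(`exists_isMatchingOn`, `exists_isPairing`). The matching is unique, because it is forced edge by
edge, going backwards along the flow from the sinks (`IsMatchingOn.unique`). The same backward
induction along a path that ends in a sink shows that its edges are in `F`, or not in `F`
respectively, exactly if the flow follows the path (`IsMatchingOn.of_chain`), which gives part (b),
and that the paths of `F` to the roots follow the flow (`IsMatchingOn.of_isPath`).
-/

/-! ### Components cut out by a set of edges -/

section Components

variable {V X : Type*} {G : SimpleGraph V}

instance finite_dart [Finite V] : Finite G.Dart :=
  Finite.of_injective _ (SimpleGraph.Dart.toProd_injective (G := G))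

/-- The sites `a` and `b` are the two ends of an edge of `A`, where the map `t` assigns to each dart
the site at its start. For `t = fun d => d.fst` the sites are the vertices, and for `t = E.faceOf`
they are the faces, so that this is adjacency in the dual. -/
def EdgeJoined (t : G.Dart → X) (A : Set (Sym2 V)) (a b : X) : Prop :=
  ∃ d : G.Dart, d.edge ∈ A ∧ t d = a ∧ t d.symm = b

/-- The sites `a` and `b` are in the same connected component of the edge set `A`. -/
def EdgeLinked (t : G.Dart → X) (A : Set (Sym2 V)) : X → X → Prop :=
  Relation.ReflTransGen (EdgeJoined t A)

/-- The number of connected components of the edge set `A`. -/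
noncomputable def numClasses (t : G.Dart → X) (A : Set (Sym2 V)) : ℕ :=
  Nat.card (Quot (EdgeJoined t A))

variable {t : G.Dart → X} {A B : Set (Sym2 V)} {a b c : X}

theorem EdgeJoined.symm (h : EdgeJoined t A a b) : EdgeJoined t A b a := by
  obtain ⟨d, hd, rfl, rfl⟩ := h
  exact ⟨d.symm, by simpa using hd, rfl, by simp⟩

theorem EdgeJoined.mono (hAB : A ⊆ B) (h : EdgeJoined t A a b) : EdgeJoined t B a b := by
  obtain ⟨d, hd, h⟩ := h
  exact ⟨d, hAB hd, h⟩

theorem EdgeLinked.refl (t : G.Dart → X) (A : Set (Sym2 V)) (a : X) : EdgeLinked t A a a :=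
  Relation.ReflTransGen.refl

theorem EdgeJoined.linked (h : EdgeJoined t A a b) : EdgeLinked t A a b :=
  Relation.ReflTransGen.single h

theorem EdgeLinked.trans (h : EdgeLinked t A a b) (h' : EdgeLinked t A b c) : EdgeLinked t A a c :=
  Relation.ReflTransGen.trans h h'

theorem EdgeLinked.symm (h : EdgeLinked t A a b) : EdgeLinked t A b a := by
  induction h with
  | refl => exact EdgeLinked.refl _ _ _
  | tail _ h ih => exact (EdgeJoined.linked h.symm).trans ih

theorem EdgeLinked.mono (hAB : A ⊆ B) (h : EdgeLinked t A a b) : EdgeLinked t B a b :=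
  Relation.ReflTransGen.mono (fun _ _ h => EdgeJoined.mono hAB h) _ _ h

theorem linked_dart (t : G.Dart → X) {d : G.Dart} (hd : d.edge ∈ A) :
    EdgeLinked t A (t d) (t d.symm) :=
  EdgeJoined.linked ⟨d, hd, rfl, rfl⟩

theorem quot_mk_joined_eq :
    Quot.mk (EdgeJoined t A) a = Quot.mk (EdgeJoined t A) b ↔ EdgeLinked t A a b := by
  rw [Quot.eq]
  constructor
  · intro h
    induction h with
    | rel x y h => exact h.linked
    | refl x => exact EdgeLinked.refl _ _ _
    | symm x y _ ih => exact ih.symm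
    | trans x y z _ _ ih ih' => exact ih.trans ih'
  · intro h
    induction h with
    | refl => exact Relation.EqvGen.refl _
    | tail _ h ih => exact ih.trans _ _ _ (Relation.EqvGen.rel _ _ h)

/-- A property of sites that is preserved along the edges of `A` is constant on components. -/
theorem EdgeLinked.invariant {p : X → Prop} (hp : ∀ d : G.Dart, d.edge ∈ A → p (t d) → p (t d.symm))
    (h : EdgeLinked t A a b) (ha : p a) : p b := by
  induction h with
  | refl => exact ha
  | tail _ h ih =>
    obtain ⟨d, hd, rfl, rfl⟩ := h
    exact hp d hd ih

theorem linked_insert {d : G.Dart} (h : EdgeLinked t (insert d.edge A) a b) :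
    EdgeLinked t A a b ∨ (EdgeLinked t A a (t d) ∧ EdgeLinked t A (t d.symm) b) ∨
      (EdgeLinked t A a (t d.symm) ∧ EdgeLinked t A (t d) b) := by
  induction h with
  | refl => exact Or.inl (EdgeLinked.refl _ _ _)
  | @tail x y _ h ih =>
    obtain ⟨d', hd', rfl, rfl⟩ := h
    rcases hd' with hd' | hd'
    · rcases (SimpleGraph.dart_edge_eq_iff _ _).1 hd' with rfl | rfl
      · rcases ih with h | ⟨h, _⟩ | ⟨h, _⟩
        · exact Or.inr (Or.inl ⟨h, EdgeLinked.refl _ _ _⟩)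
        · exact Or.inr (Or.inl ⟨h, EdgeLinked.refl _ _ _⟩)
        · exact Or.inl h
      · rw [SimpleGraph.Dart.symm_symm]
        rcases ih with h | ⟨h, _⟩ | ⟨h, _⟩
        · exact Or.inr (Or.inr ⟨h, EdgeLinked.refl _ _ _⟩)
        · exact Or.inl h
        · exact Or.inr (Or.inr ⟨h, EdgeLinked.refl _ _ _⟩)
    · have := linked_dart t hd'
      rcases ih with h | ⟨h, h'⟩ | ⟨h, h'⟩
      · exact Or.inl (h.trans this)
      · exact Or.inr (Or.inl ⟨h, h'.trans this⟩)
      · exact Or.inr (Or.inr ⟨h, h'.trans this⟩)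

theorem numClasses_empty : numClasses t ∅ = Nat.card X := by
  refine (Nat.card_eq_of_bijective (Quot.mk (EdgeJoined t ∅)) ⟨?_, Quot.mk_surjective⟩).symm
  intro x y h
  have := (quot_mk_joined_eq.1 h).invariant (p := fun y => y = x) (fun d hd => by simp at hd) rfl
  exact this.symm

theorem numClasses_eq_one [Nonempty X] (h : ∀ x y, EdgeLinked t A x y) : numClasses t A = 1 := by
  have : Subsingleton (Quot (EdgeJoined t A)) := ⟨by
    rintro ⟨x⟩ ⟨y⟩
    exact quot_mk_joined_eq.2 (h x y)⟩
  have : Nonempty (Quot (EdgeJoined t A)) := ⟨Quot.mk _ (Classical.arbitrary X)⟩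
  exact Nat.card_eq_one_iff_unique.2 ⟨inferInstance, inferInstance⟩

theorem numClasses_of_forall_notMem (t : G.Dart → X)
    (hA : ∀ e ∈ G.edgeSet, e ∉ A) : numClasses t A = Nat.card X := by
  rw [← numClasses_empty (t := t)]
  unfold numClasses
  congr 2
  ext a b
  constructor
  · rintro ⟨d, hd, -⟩
    exact absurd hd (hA _ d.edge_mem)
  · rintro ⟨d, hd, -⟩
    exact absurd hd (by simp)

variable [Finite X]

instance finite_quot_joined : Finite (Quot (EdgeJoined t A)) :=
  Finite.of_surjective _ Quot.mk_surjective

theorem numClasses_anti (hAB : A ⊆ B) : numClasses t B ≤ numClasses t A := by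
  refine Nat.card_le_card_of_surjective
    (Quot.map id fun _ _ h => EdgeJoined.mono hAB h) ?_
  rintro ⟨x⟩
  exact ⟨Quot.mk _ x, rfl⟩

theorem numClasses_insert_of_linked {d : G.Dart} (h : EdgeLinked t A (t d) (t d.symm)) :
    numClasses t (insert d.edge A) = numClasses t A := by
  refine le_antisymm (numClasses_anti (Set.subset_insert _ _)) ?_
  refine Nat.card_le_card_of_injective
    (Quot.map id fun _ _ h => EdgeJoined.mono (Set.subset_insert _ _) h) ?_
  rintro ⟨x⟩ ⟨y⟩ hxy
  have hxy := quot_mk_joined_eq.1 hxy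
  refine quot_mk_joined_eq.2 ?_
  rcases linked_insert hxy with h' | ⟨h₁, h₂⟩ | ⟨h₁, h₂⟩
  · exact h'
  · exact h₁.trans (h.trans h₂)
  · exact h₁.trans (h.symm.trans h₂)

theorem numClasses_le_insert_add_one (d : G.Dart) :
    numClasses t A ≤ numClasses t (insert d.edge A) + 1 := by
  classical
  let g : Quot (EdgeJoined t A) → Quot (EdgeJoined t (insert d.edge A)) :=
    Quot.map id fun _ _ h => EdgeJoined.mono (Set.subset_insert _ _) h
  let F : Quot (EdgeJoined t A) → Option (Quot (EdgeJoined t (insert d.edge A))) := fun q =>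
    if q = Quot.mk _ (t d) then none else some (g q)
  have hF : Function.Injective F := by
    rintro ⟨x⟩ ⟨y⟩ hxy
    by_cases hx : Quot.mk (EdgeJoined t A) x = Quot.mk _ (t d) <;>
      by_cases hy : Quot.mk (EdgeJoined t A) y = Quot.mk _ (t d) <;> simp only [F, hx, hy, if_true,
        if_false, Option.some.injEq, reduceCtorEq] at hxy
    · exact hx.trans hy.symm
    · have hxy := quot_mk_joined_eq.1 (show Quot.mk (EdgeJoined t (insert d.edge A)) x =
        Quot.mk _ y from hxy)
      rw [quot_mk_joined_eq] at hx hy ⊢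
      rcases linked_insert hxy with h' | ⟨h₁, h₂⟩ | ⟨h₁, h₂⟩
      · exact h'
      · exact absurd h₁ hx
      · exact absurd h₂.symm hy
  have := Nat.card_le_card_of_injective F hF
  rwa [Finite.card_option] at this

/-- A set of sites containing all the ends of the edges of `A` accounts for all but the isolated
sites, each of which is a component of its own. -/
theorem card_lt_numClasses_add_ncard {T : Set X} (hT : T.Nonempty)
    (hA : ∀ d : G.Dart, d.edge ∈ A → t d ∈ T) :
    Nat.card X < numClasses t A + T.ncard := by
  classical
  obtain ⟨x₀, hx₀⟩ := hT
  let g : Option ↥(Tᶜ) → Quot (EdgeJoined t A) := fun o =>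
    o.elim (Quot.mk _ x₀) fun x => Quot.mk _ x.1
  have key : ∀ x y, x ∉ T → EdgeLinked t A x y → y = x := by
    intro x y hx h
    refine h.invariant (p := fun y => y = x) ?_ rfl
    rintro d hd rfl
    exact absurd (hA d hd) hx
  have hg : Function.Injective g := by
    rintro (_ | ⟨x, hx⟩) (_ | ⟨y, hy⟩) h
    · rfl
    · have := key y x₀ hy (quot_mk_joined_eq.1 h).symm
      exact absurd (this ▸ hx₀) hy
    · have := key x x₀ hx (quot_mk_joined_eq.1 h)
      exact absurd (this ▸ hx₀) hx
    · have := key x y hx (quot_mk_joined_eq.1 h)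
      subst this
      rfl
  have h1 := Nat.card_le_card_of_injective g hg
  rw [Finite.card_option, Nat.card_coe_set_eq] at h1
  have h2 := Set.ncard_add_ncard_compl T
  unfold numClasses
  omega

end Components

/-! ### Planar duality for edge sets -/

namespace PlaneEmbedding

section Duality

variable {V : Type*} {G : SimpleGraph V} (E : PlaneEmbedding G)

@[simp] theorem facePerm_fst (d : G.Dart) : (E.facePerm d).fst = d.snd := by
  have := E.rot_fst (E.rot.symm d.symm)
  rw [Equiv.apply_symm_apply] at this
  exact this.symm

@[simp] theorem faceOf_facePerm (d : G.Dart) : E.faceOf (E.facePerm d) = E.faceOf d :=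
  Quotient.sound (show E.facePerm.SameCycle _ _ from
    (Equiv.Perm.sameCycle_apply_left).2 (Equiv.Perm.SameCycle.refl _ _))

theorem faceOf_eq_iff {d d' : G.Dart} : E.faceOf d = E.faceOf d' ↔ E.facePerm.SameCycle d d' :=
  ⟨fun h => Quotient.exact h, fun h => Quotient.sound h⟩

theorem faceOf_surjective : Function.Surjective E.faceOf := Quotient.mk_surjective

/-- The next dart clockwise has on its left the face to the right of the given dart. -/
theorem faceOf_rot_symm (d : G.Dart) : E.faceOf (E.rot.symm d) = E.faceOf d.symm := by
  have := E.faceOf_facePerm d.symm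
  rwa [show E.facePerm d.symm = E.rot.symm d from by
    simp [RotationSystem.facePerm]] at this

theorem linked_fst_edgeSet (E : PlaneEmbedding G) (x y : V) :
    EdgeLinked (fun d : G.Dart => d.fst) G.edgeSet x y := by
  obtain ⟨p⟩ := E.connected.preconnected x y
  induction p with
  | nil => exact EdgeLinked.refl _ _ _
  | cons h p ih =>
    exact (linked_dart (fun d : G.Dart => d.fst) (d := ⟨(_, _), h⟩) (by simpa using h)).trans ih

theorem numClasses_fst_edgeSet (E : PlaneEmbedding G) :
    numClasses (fun d : G.Dart => d.fst) G.edgeSet = 1 :=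
  have : Nonempty V := E.connected.nonempty
  numClasses_eq_one E.linked_fst_edgeSet

variable [Finite V]

instance finite_face : Finite E.Face := Finite.of_surjective _ E.faceOf_surjective

instance nonempty_face : Nonempty E.Face := ⟨E.outer⟩

theorem linked_faceOf_of_fst_eq {A : Set (Sym2 V)} {d d' : G.Dart} (h : d.fst = d'.fst)
    (hA : ∀ d₁ : G.Dart, d₁.fst = d.fst → d₁.edge ∈ A) :
    EdgeLinked E.faceOf A (E.faceOf d) (E.faceOf d') := by
  obtain ⟨k, rfl⟩ := (E.rot_sameCycle d d' h).exists_nat_pow_eq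
  clear h
  induction k with
  | zero => exact EdgeLinked.refl _ _ _
  | succ k ih =>
    refine ih.trans ?_
    set d₁ := (E.rot ^ k) d with hd₁
    have hfst : ∀ k, ((E.rot ^ k) d).fst = d.fst := by
      intro k
      induction k with
      | zero => rfl
      | succ k ih => rw [pow_succ', Equiv.Perm.mul_apply, E.rot_fst, ih]
    have h1 : (E.rot ^ (k + 1)) d = E.rot d₁ := by rw [pow_succ', Equiv.Perm.mul_apply]
    have h2 := E.faceOf_rot_symm (E.rot d₁)
    rw [Equiv.symm_apply_apply] at h2
    rw [h1, h2]
    exact (linked_dart E.faceOf (hA _ (h1 ▸ hfst (k + 1)))).symm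

theorem linked_fst_of_faceOf_eq {A : Set (Sym2 V)} {d d' : G.Dart} (h : E.faceOf d = E.faceOf d')
    (hA : ∀ d₁ : G.Dart, E.faceOf d₁ = E.faceOf d → d₁.edge ∈ A) :
    EdgeLinked (fun d : G.Dart => d.fst) A d.fst d'.fst := by
  obtain ⟨k, rfl⟩ := (E.faceOf_eq_iff.1 h).exists_nat_pow_eq
  clear h
  induction k with
  | zero => exact EdgeLinked.refl _ _ _
  | succ k ih =>
    refine ih.trans ?_
    have hface : ∀ k, E.faceOf ((E.facePerm ^ k) d) = E.faceOf d := by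
      intro k
      induction k with
      | zero => rfl
      | succ k ih => rw [pow_succ', Equiv.Perm.mul_apply, faceOf_facePerm, ih]
    rw [pow_succ', Equiv.Perm.mul_apply, facePerm_fst]
    exact linked_dart (fun d : G.Dart => d.fst) (hA _ (hface k))

theorem linked_faceOf_edgeSet (φ ψ : E.Face) : EdgeLinked E.faceOf G.edgeSet φ ψ := by
  obtain ⟨d, rfl⟩ := E.faceOf_surjective φ
  obtain ⟨d', rfl⟩ := E.faceOf_surjective ψ
  have h := E.linked_fst_edgeSet d.fst d'.fst
  refine h.invariant (p := fun x => ∀ d' : G.Dart, d'.fst = x →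
    EdgeLinked E.faceOf G.edgeSet (E.faceOf d) (E.faceOf d')) ?_ ?_ d' rfl
  · intro d₁ hd₁ h d₂ hd₂
    exact ((h d₁ rfl).trans (linked_dart E.faceOf hd₁)).trans
      (E.linked_faceOf_of_fst_eq hd₂.symm fun d _ => d.edge_mem)
  · intro d₂ hd₂
    exact E.linked_faceOf_of_fst_eq hd₂.symm fun d _ => d.edge_mem

/-- An edge `d` that joins two components of `A` does not separate faces. Otherwise let `S` be the
set of darts on the faces that are linked to the left side of `d`. It is a union of closed walks, so
that it contains as many darts entering the component of `d.fst` as darts leaving it; but `d` is the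
only dart in `S` that enters or leaves this component without its reversal being in `S`. -/
theorem linked_faceOf_of_not_linked_fst {A : Set (Sym2 V)} {d : G.Dart}
    (h : ¬ EdgeLinked (fun d : G.Dart => d.fst) A d.fst d.snd) :
    EdgeLinked E.faceOf (insert d.edge A)ᶜ (E.faceOf d) (E.faceOf d.symm) := by
  classical
  have := Fintype.ofFinite G.Dart
  by_contra hr
  let C : V → ℤ := fun z => if EdgeLinked (fun d : G.Dart => d.fst) A d.fst z then 1 else 0
  let S : Finset G.Dart := Finset.univ.filter fun d' =>
    EdgeLinked E.faceOf (insert d.edge A)ᶜ (E.faceOf d) (E.faceOf d')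
  have h1 : ∑ d' ∈ S, C d'.snd = ∑ d' ∈ S, C d'.fst := by
    refine Finset.sum_bij (fun d' _ => E.facePerm d') ?_ ?_ ?_ ?_
    · intro d' hd'
      simpa [S] using hd'
    · intro a _ b _ hab
      exact E.facePerm.injective hab
    · intro b hb
      refine ⟨E.facePerm.symm b, ?_, by simp⟩
      have := E.faceOf_facePerm (E.facePerm.symm b)
      rw [Equiv.apply_symm_apply] at this
      simpa [S, ← this] using hb
    · intro a _
      rw [facePerm_fst]
  -- Only the dart `d` contributes to the difference of the two sums.
  have hS : ∀ d' ∈ S, d' ≠ d → d'.symm ∉ S → C d'.fst - C d'.snd = 0 := by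
    intro d' hd' hne hs
    by_cases hA : d'.edge ∈ A
    · have hl : EdgeLinked (fun d : G.Dart => d.fst) A d'.fst d'.snd :=
        linked_dart (fun d : G.Dart => d.fst) hA
      have : EdgeLinked (fun d : G.Dart => d.fst) A d.fst d'.fst ↔
          EdgeLinked (fun d : G.Dart => d.fst) A d.fst d'.snd :=
        ⟨fun h => h.trans hl, fun h => h.trans hl.symm⟩
      simp only [C, this, sub_self]
    · exfalso
      have hd'' : EdgeLinked E.faceOf (insert d.edge A)ᶜ (E.faceOf d) (E.faceOf d') := by
        simpa [S] using hd'
      by_cases he : d'.edge = d.edge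
      · rcases (SimpleGraph.dart_edge_eq_iff _ _).1 he with rfl | rfl
        · exact hne rfl
        · exact hr hd''
      · refine hs ?_
        have := hd''.trans (linked_dart E.faceOf (A := (insert d.edge A)ᶜ) (d := d') (by
          simp [he, hA]))
        simpa [S] using this
  have hdS : d ∈ S := by simpa [S] using EdgeLinked.refl _ _ _
  have hdS' : d.symm ∉ S := by simpa [S] using hr
  have h2 : ∑ d' ∈ S.erase d, (C d'.fst - C d'.snd) = 0 := by
    rw [← Finset.sum_filter_add_sum_filter_not (S.erase d) (fun d' => d'.symm ∈ S)]
    have e1 : ∑ d' ∈ (S.erase d).filter (fun d' => ¬ d'.symm ∈ S), (C d'.fst - C d'.snd) = 0 := by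
      refine Finset.sum_eq_zero fun d' hd' => ?_
      simp only [Finset.mem_filter, Finset.mem_erase] at hd'
      exact hS d' hd'.1.2 hd'.1.1 hd'.2
    rw [e1, add_zero]
    refine Finset.sum_involution (fun d' _ => d'.symm) ?_ ?_ ?_ ?_
    · intro a _
      simp
    · intro a _ _ h
      exact SimpleGraph.Dart.symm_ne a h
    · intro a ha
      simp only [Finset.mem_filter, Finset.mem_erase, SimpleGraph.Dart.symm_symm] at ha ⊢
      refine ⟨⟨?_, ha.2⟩, ha.1.2⟩
      rintro rfl
      exact hdS' (by simpa using ha.1.2)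
    · intro a _
      simp
  have h3 : ∑ d' ∈ S, (C d'.fst - C d'.snd) = 0 := by
    rw [Finset.sum_sub_distrib, h1, sub_self]
  rw [← Finset.add_sum_erase S _ hdS, h2, add_zero] at h3
  have c1 : C d.fst = 1 := if_pos (EdgeLinked.refl _ _ _)
  have c2 : C d.snd = 0 := if_neg h
  omega

/-- The quantity `|V| - |A| + #faces - #components` does not increase when an edge is added to `A`,
because the edge cannot join two components and separate two faces at the same time. -/
theorem euler_step {A : Set (Sym2 V)} {d : G.Dart} (hd : d.edge ∉ A) :
    numClasses (fun d : G.Dart => d.fst) A + numClasses E.faceOf (insert d.edge A)ᶜ ≤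
      numClasses (fun d : G.Dart => d.fst) (insert d.edge A) + 1 + numClasses E.faceOf Aᶜ := by
  have hA : Aᶜ = insert d.edge (insert d.edge A)ᶜ := by
    ext e
    by_cases he : e = d.edge <;> simp [he, hd]
  have hle := numClasses_le_insert_add_one (t := E.faceOf) (A := (insert d.edge A)ᶜ) d
  have hle' := numClasses_le_insert_add_one (t := fun d : G.Dart => d.fst) (A := A) d
  by_cases h : EdgeLinked (fun d : G.Dart => d.fst) A d.fst d.snd
  · have := numClasses_insert_of_linked (t := fun d : G.Dart => d.fst) (d := d) h
    rw [← hA] at hle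
    omega
  · have := numClasses_insert_of_linked (E.linked_faceOf_of_not_linked_fst h)
    rw [← hA] at this
    omega

/-- The quantity `|V| - |A| + #faces - #components` decreases as `A` grows. -/
theorem euler_mono {A T : Set (Sym2 V)} (hT : T ⊆ G.edgeSet) (hAT : Disjoint A T) :
    Nat.card V + numClasses E.faceOf (A ∪ T)ᶜ + A.ncard + numClasses (fun d : G.Dart => d.fst) A ≤
    Nat.card V + numClasses E.faceOf Aᶜ + (A ∪ T).ncard +
      numClasses (fun d : G.Dart => d.fst) (A ∪ T) := by
  have : T.Finite := Set.toFinite T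
  induction T, this using Set.Finite.induction_on with
  | empty => simp
  | @insert e T heT _ ih =>
    have he : e ∈ G.edgeSet := hT (Set.mem_insert _ _)
    have ih := ih ((Set.subset_insert _ _).trans hT)
      (hAT.mono_right (Set.subset_insert _ _))
    have heA : e ∉ A := fun h => Set.disjoint_left.1 hAT h (Set.mem_insert _ _)
    induction e using Sym2.ind with
    | _ x y =>
    have hstep := E.euler_step (A := A ∪ T) (d := ⟨(x, y), he⟩) (by
      simp only [Set.mem_union, not_or]
      exact ⟨heA, heT⟩)
    have hun : A ∪ insert s(x, y) T = insert s(x, y) (A ∪ T) := Set.union_insert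
    have hc : (A ∪ insert s(x, y) T).ncard = (A ∪ T).ncard + 1 := by
      rw [hun, Set.ncard_insert_of_notMem (by simp [heA, heT])]
    rw [hc, hun]
    change _ + numClasses _ (insert s(x, y) (A ∪ T))ᶜ ≤
      numClasses _ (insert s(x, y) (A ∪ T)) + 1 + _ at hstep
    omega

/-- Euler's formula for a set `A` of edges: `|V| - |A| + #faces = 1 + #components`, where the faces
of `A` are the components of the dual of its complement. The difference of the two sides is
monotone in `A`, and it vanishes both for no edges and for all edges. -/
theorem euler_of_subset {A : Set (Sym2 V)} (hA : A ⊆ G.edgeSet) :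
    A.ncard + numClasses (fun d : G.Dart => d.fst) A + 1 =
      Nat.card V + numClasses E.faceOf Aᶜ := by
  have h1 := E.euler_mono hA (Set.empty_disjoint A)
  have h2 := E.euler_mono (A := A) (T := G.edgeSet \ A) Set.sdiff_subset Set.disjoint_sdiff_right
  rw [Set.union_sdiff_cancel hA] at h2
  have h3 : numClasses E.faceOf ((∅ : Set (Sym2 V))ᶜ) = 1 := numClasses_eq_one fun φ ψ =>
    (E.linked_faceOf_edgeSet φ ψ).mono (by simp)
  have h4 := E.numClasses_fst_edgeSet
  have h5 := numClasses_of_forall_notMem E.faceOf (A := G.edgeSetᶜ) (fun e he h => h he)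
  have h6 := E.euler
  rw [Set.empty_union, h3, numClasses_empty, Set.ncard_empty] at h1
  rw [h4, h5] at h2
  rw [Nat.card_coe_set_eq] at h6
  omega

/-- Planar duality: the ends of an edge are linked by `A` exactly if the edge is needed to link its
two sides in the dual of the complement of `A`. -/
theorem linked_fst_iff_not_linked_faceOf {A : Set (Sym2 V)} (hA : A ⊆ G.edgeSet) {d : G.Dart}
    (hd : d.edge ∉ A) :
    EdgeLinked (fun d : G.Dart => d.fst) A d.fst d.snd ↔
      ¬ EdgeLinked E.faceOf (insert d.edge A)ᶜ (E.faceOf d) (E.faceOf d.symm) := by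
  refine ⟨fun h h' => ?_, fun h => by_contra fun h' => h (E.linked_faceOf_of_not_linked_fst h')⟩
  have hAc : Aᶜ = insert d.edge (insert d.edge A)ᶜ := by
    ext e
    by_cases he : e = d.edge <;> simp [he, hd]
  have e1 := E.euler_of_subset hA
  have e2 := E.euler_of_subset (A := insert d.edge A) (Set.insert_subset d.edge_mem hA)
  rw [Set.ncard_insert_of_notMem hd,
    numClasses_insert_of_linked (t := fun d : G.Dart => d.fst) (d := d) h,
    ← numClasses_insert_of_linked h', ← hAc] at e2
  omega

end Duality

end PlaneEmbedding

/-! ### The outer boundary and the smashed vertices -/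

/-- The vertices `v₂, v₄, …, v_{2n}` (left summand) and `v'₂, v'₄, …, v'_{2n}` (right summand). -/
def evenVert {V : Type*} {n : ℕ} (v v' : Fin (2 * n + 1) → V) : Fin n ⊕ Fin n → V :=
  Sum.elim (fun i => v (evenIdx i)) (fun i => v' (evenIdx i))

/-- The edges of `G` at the vertices `v₂, v₄, …, v_{2n}, v'₂, v'₄, …, v'_{2n}`. -/
def evenEdges {V : Type*} (G : SimpleGraph V) {n : ℕ} (v v' : Fin (2 * n + 1) → V) :
    Set (Sym2 V) :=
  {e | e ∈ G.edgeSet ∧ ∃ s, evenVert v v' s ∈ e}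

namespace PlaneEmbedding

section

variable {V : Type*} {G : SimpleGraph V} (E : PlaneEmbedding G)

theorem nextIn_top (d : G.Dart) : E.nextIn ⊤ d = E.facePerm d := by
  have h : sInf {k : ℕ | 0 < k ∧ (⊤ : G.Subgraph).Adj ((E.rot⁻¹ ^ k) d.symm).fst
      ((E.rot⁻¹ ^ k) d.symm).snd} = 1 := by
    refine le_antisymm (Nat.sInf_le ⟨one_pos, ((E.rot⁻¹ ^ 1) d.symm).adj⟩) ?_
    exact le_csInf ⟨1, one_pos, ((E.rot⁻¹ ^ 1) d.symm).adj⟩ fun k hk => hk.1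
  unfold nextIn
  rw [h, pow_one]
  rfl

theorem inInfiniteFace_top {φ : E.Face} (h : E.InInfiniteFace ⊤ φ) : φ = E.outer := by
  rcases Relation.ReflTransGen.cases_head h with h | ⟨_, ⟨d, -, -, hd⟩, -⟩
  · exact h
  · exact absurd d.adj hd

theorem faceOf_iterate (d : G.Dart) (k : ℕ) : E.faceOf (E.facePerm^[k] d) = E.faceOf d := by
  induction k with
  | zero => rfl
  | succ k ih => rw [Function.iterate_succ_apply', faceOf_facePerm, ih]

/-- The vertices in a list are in counterclockwise order around the outer face of `G` if they are
passed in decreasing order on a clockwise walk around that face. -/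
theorem exists_position_of_inCCWOrder {L : List V} (h : E.InCCWOrder ⊤ L) :
    ∃ d : G.Dart, E.faceOf d = E.outer ∧ ∃ pos : Fin L.length → ℕ, StrictAnti pos ∧
      (∀ i, pos i < Function.minimalPeriod E.facePerm d) ∧
      ∀ i, L.get i = (E.facePerm^[pos i] d).fst := by
  obtain ⟨-, d, -, hd, hL⟩ := h
  have hn : E.nextIn ⊤ = E.facePerm := funext E.nextIn_top
  refine ⟨d, E.inInfiniteFace_top hd, ?_⟩
  obtain ⟨g, hg⟩ := List.sublist_iff_exists_fin_orderEmbedding_get_eq.1 hL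
  have hlen : (E.boundaryList ⊤ d).reverse.length = Function.minimalPeriod E.facePerm d := by
    simp [boundaryList, hn]
  refine ⟨fun i => Function.minimalPeriod E.facePerm d - 1 - g i, ?_, ?_, ?_⟩
  · intro i j hij
    have h1 : (g i : ℕ) < g j := g.strictMono hij
    have h2 := (g j).2
    dsimp only
    omega
  · intro i
    have h2 := (g i).2
    dsimp only
    omega
  · intro i
    rw [hg i]
    simp [boundaryList, hn]

end

/-- The hypotheses on the vertices `v_j`, `v'_j` and on the faces `f_{2i}`, `f'_{2i}`. -/
structure IsFrame {V : Type*} {G : SimpleGraph V} (E : PlaneEmbedding G) {n : ℕ}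
    (v v' : Fin (2 * n + 1) → V) (f f' : Fin n → E.BoundedFace) : Prop where
  path : ∀ j : Fin (2 * n), G.Adj (v' j.castSucc) (v' j.succ)
  cyc : E.InCCWOrder ⊤ (List.ofFn v ++ (List.ofFn v').reverse)
  deg : ∀ i : Fin n, (G.neighborSet (v (evenIdx i))).ncard = 2
  deg' : ∀ i : Fin n, (G.neighborSet (v' (evenIdx i))).ncard = 2
  onFace : ∀ i : Fin n, E.VertexOnFace (v (evenIdx i)) (f i).1
  onFace' : ∀ i : Fin n, E.VertexOnFace (v' (evenIdx i)) (f' i).1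
  distinct : Function.Injective (Sum.elim f f')

/-- The faces `f₂, f₄, …, f_{2n}` (left summand) and `f'₂, f'₄, …, f'_{2n}` (right summand). -/
def evenFace {V : Type*} {G : SimpleGraph V} (E : PlaneEmbedding G) {n : ℕ}
    (f f' : Fin n → E.BoundedFace) (s : Fin n ⊕ Fin n) : E.Face :=
  (Sum.elim f f' s).1

namespace IsFrame

variable {V : Type*} {G : SimpleGraph V} {E : PlaneEmbedding G} {n : ℕ}
  {v v' : Fin (2 * n + 1) → V} {f f' : Fin n → E.BoundedFace}

/-- Positions of the `v_j` and `v'_j` on a clockwise walk around the outer face. -/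
theorem exists_position (h : E.IsFrame v v' f f') :
    ∃ d : G.Dart, E.faceOf d = E.outer ∧ ∃ pos pos' : Fin (2 * n + 1) → ℕ,
      StrictAnti pos ∧ StrictMono pos' ∧ (∀ i j, pos' i < pos j) ∧
      (∀ i, pos i < Function.minimalPeriod E.facePerm d) ∧
      (∀ i, v i = (E.facePerm^[pos i] d).fst) ∧ ∀ i, v' i = (E.facePerm^[pos' i] d).fst := by
  obtain ⟨d, hd, pos, hanti, hlt, hget⟩ := E.exists_position_of_inCCWOrder h.cyc
  have hlen : (List.ofFn v ++ (List.ofFn v').reverse).length = (2 * n + 1) + (2 * n + 1) := by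
    rw [List.length_append, List.length_reverse, List.length_ofFn, List.length_ofFn]
  refine ⟨d, hd, fun i => pos ⟨i, by omega⟩, fun i => pos ⟨(2 * n + 1) + (2 * n - i), by omega⟩,
    ?_, ?_, ?_, fun i => hlt _, ?_, ?_⟩
  · intro i j hij
    exact hanti (by simpa using hij)
  · intro i j hij
    refine hanti ?_
    have : (i : ℕ) < j := hij
    simp only [Fin.mk_lt_mk]
    omega
  · intro i j
    refine hanti ?_
    simp only [Fin.mk_lt_mk]
    omega
  · intro i
    rw [← hget, List.get_eq_getElem, List.getElem_append_left (by
      rw [List.length_ofFn]; exact i.2), List.getElem_ofFn]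
  · intro i
    rw [← hget]
    simp only [List.get_eq_getElem]
    rw [List.getElem_append_right (by simp)]
    rw [List.getElem_reverse, List.getElem_ofFn]
    congr 1
    ext
    simp
    omega

theorem list_nodup (h : E.IsFrame v v' f f') :
    (List.ofFn v ++ (List.ofFn v').reverse).Nodup := h.cyc.1

theorem injective_left (h : E.IsFrame v v' f f') : Function.Injective v :=
  List.nodup_ofFn.1 (List.nodup_append.1 h.list_nodup).1

theorem injective_right (h : E.IsFrame v v' f f') : Function.Injective v' :=
  List.nodup_ofFn.1 (List.nodup_reverse.1 (List.nodup_append.1 h.list_nodup).2.1)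

theorem left_ne_right (h : E.IsFrame v v' f f') (i j : Fin (2 * n + 1)) : v i ≠ v' j :=
  (List.nodup_append.1 h.list_nodup).2.2 _ (List.mem_ofFn.2 ⟨i, rfl⟩) _
    (List.mem_reverse.2 (List.mem_ofFn.2 ⟨j, rfl⟩))

theorem evenIdx_injective : Function.Injective (evenIdx (n := n)) := by
  intro i j hij
  have := congrArg Fin.val hij
  simp only [evenIdx] at this
  ext
  omega

theorem oddIdx_injective : Function.Injective (oddIdx (n := n)) := by
  intro i j hij
  have := congrArg Fin.val hij
  simp only [oddIdx] at this
  ext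
  omega

theorem oddIdx_ne_evenIdx (i : Fin (n + 1)) (j : Fin n) : oddIdx i ≠ evenIdx j := by
  intro hij
  have := congrArg Fin.val hij
  simp only [oddIdx, evenIdx] at this
  omega

theorem evenVert_injective (h : E.IsFrame v v' f f') : Function.Injective (evenVert v v') := by
  rintro (i | i) (j | j) hij
  · exact congrArg Sum.inl (evenIdx_injective (h.injective_left hij))
  · exact absurd hij (h.left_ne_right _ _)
  · exact absurd hij.symm (h.left_ne_right _ _)
  · exact congrArg Sum.inr (evenIdx_injective (h.injective_right hij))

theorem odd_left_ne (h : E.IsFrame v v' f f') (i : Fin (n + 1)) (s) :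
    v (oddIdx i) ≠ evenVert v v' s := by
  rcases s with j | j
  · exact fun hij => oddIdx_ne_evenIdx i j (h.injective_left hij)
  · exact h.left_ne_right _ _

theorem odd_right_ne (h : E.IsFrame v v' f f') (i : Fin (n + 1)) (s) :
    v' (oddIdx i) ≠ evenVert v v' s := by
  rcases s with j | j
  · exact (h.left_ne_right _ _).symm
  · exact fun hij => oddIdx_ne_evenIdx i j (h.injective_right hij)

theorem evenFace_injective (h : E.IsFrame v v' f f') : Function.Injective (E.evenFace f f') :=
  fun _ _ hij => h.distinct (Subtype.ext hij)

theorem evenFace_ne_outer (s : Fin n ⊕ Fin n) : E.evenFace f f' s ≠ E.outer :=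
  (Sum.elim f f' s).2

theorem onFace_evenVert (h : E.IsFrame v v' f f') (s) :
    E.VertexOnFace (evenVert v v' s) (E.evenFace f f' s) := by
  rcases s with i | i
  · exact h.onFace i
  · exact h.onFace' i

theorem deg_evenVert (h : E.IsFrame v v' f f') (s) :
    (G.neighborSet (evenVert v v' s)).ncard = 2 := by
  rcases s with i | i
  · exact h.deg i
  · exact h.deg' i

theorem left_onFace_outer (h : E.IsFrame v v' f f') (i) : E.VertexOnFace (v i) E.outer := by
  obtain ⟨d, hd, pos, pos', -, -, -, -, h1, -⟩ := h.exists_position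
  exact ⟨_, (h1 i).symm, by rw [faceOf_iterate, hd]⟩

theorem right_onFace_outer (h : E.IsFrame v v' f f') (i) : E.VertexOnFace (v' i) E.outer := by
  obtain ⟨d, hd, pos, pos', -, -, -, -, -, h1⟩ := h.exists_position
  exact ⟨_, (h1 i).symm, by rw [faceOf_iterate, hd]⟩

theorem evenVert_onFace_outer (h : E.IsFrame v v' f f') (s) :
    E.VertexOnFace (evenVert v v' s) E.outer := by
  rcases s with i | i
  · exact h.left_onFace_outer _
  · exact h.right_onFace_outer _

/-- The vertices with even indices, at which the graph is smashed, have degree two. The two darts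
leaving such a vertex: one along the outer face, and one along the bounded
face; each has the other face on its right. -/
theorem exists_darts (h : E.IsFrame v v' f f') (s) : ∃ a b : G.Dart, a ≠ b ∧
    a.fst = evenVert v v' s ∧ b.fst = evenVert v v' s ∧
    E.faceOf a = E.outer ∧ E.faceOf a.symm = E.evenFace f f' s ∧
    E.faceOf b = E.evenFace f f' s ∧ E.faceOf b.symm = E.outer ∧
    ∀ d : G.Dart, d.fst = evenVert v v' s → d = a ∨ d = b := by
  obtain ⟨a, ha, ha'⟩ := h.evenVert_onFace_outer s
  obtain ⟨b, hb, hb'⟩ := h.onFace_evenVert s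
  have hab : a ≠ b := by
    rintro rfl
    exact evenFace_ne_outer s (hb'.symm.trans ha')
  have hall : ∀ d : G.Dart, d.fst = evenVert v v' s → d = a ∨ d = b := by
    intro d hd
    have key : ∀ d d' : G.Dart, d.fst = d'.fst → d.snd = d'.snd → d = d' := fun d d' h₁ h₂ =>
      SimpleGraph.Dart.ext _ _ (Prod.ext h₁ h₂)
    obtain ⟨x, y, -, hxy⟩ := Set.ncard_eq_two.1 (h.deg_evenVert s)
    have hmem : ∀ d : G.Dart, d.fst = evenVert v v' s → d.snd = x ∨ d.snd = y := by
      intro d hd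
      have : d.snd ∈ G.neighborSet (evenVert v v' s) := by
        rw [SimpleGraph.mem_neighborSet, ← hd]
        exact d.adj
      rw [hxy] at this
      simpa using this
    have h1 := hmem a ha
    have h2 := hmem b hb
    have h3 := hmem d hd
    have h4 : a.snd ≠ b.snd := fun h => hab (key a b (ha.trans hb.symm) h)
    rcases h3 with h3 | h3 <;> rcases h1 with h1 | h1 <;> rcases h2 with h2 | h2
    all_goals first
      | exact absurd (h1.trans h2.symm) h4
      | exact Or.inl (key d a (hd.trans ha.symm) (h3.trans h1.symm))
      | exact Or.inr (key d b (hd.trans hb.symm) (h3.trans h2.symm))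
  have hrot : ∀ d : G.Dart, d.fst = evenVert v v' s → (E.rot.symm d).fst = evenVert v v' s := by
    intro d hd
    have := E.rot_fst (E.rot.symm d)
    rw [Equiv.apply_symm_apply] at this
    exact this.symm.trans hd
  have hfix : ∀ d d' : G.Dart, d ≠ d' → d.fst = d'.fst → E.rot.symm d ≠ d := by
    intro d d' hne hdd' hfix
    refine hne (Equiv.Perm.SameCycle.eq_of_left (E.rot_sameCycle d d' hdd') ?_)
    exact ((Equiv.symm_apply_eq _).1 hfix).symm
  refine ⟨a, b, hab, ha, hb, ha', ?_, hb', ?_, hall⟩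
  · rw [← E.faceOf_rot_symm]
    rcases hall _ (hrot a ha) with h' | h'
    · exact absurd h' (hfix a b hab (ha.trans hb.symm))
    · rw [h', hb']
  · rw [← E.faceOf_rot_symm]
    rcases hall _ (hrot b hb) with h' | h'
    · rw [h', ha']
    · exact absurd h' (hfix b a hab.symm (hb.trans ha.symm))

theorem sides (h : E.IsFrame v v' f f') {s} {d : G.Dart} (hd : d.fst = evenVert v v' s) :
    (E.faceOf d = E.outer ∧ E.faceOf d.symm = E.evenFace f f' s) ∨
      (E.faceOf d = E.evenFace f f' s ∧ E.faceOf d.symm = E.outer) := by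
  obtain ⟨a, b, -, -, -, h1, h2, h3, h4, hall⟩ := h.exists_darts s
  rcases hall d hd with rfl | rfl
  · exact Or.inl ⟨h1, h2⟩
  · exact Or.inr ⟨h3, h4⟩

theorem dart_unique (h : E.IsFrame v v' f f') {s} {d d' : G.Dart} (hd : d.fst = evenVert v v' s)
    (hd' : d'.fst = evenVert v v' s) (hf : E.faceOf d = E.faceOf d') : d = d' := by
  obtain ⟨a, b, -, -, -, h1, h2, h3, h4, hall⟩ := h.exists_darts s
  have := evenFace_ne_outer (E := E) (f := f) (f' := f') s
  rcases hall d hd with rfl | rfl <;> rcases hall d' hd' with rfl | rfl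
  · rfl
  · exact absurd (h3.symm.trans (hf.symm.trans h1)) this
  · exact absurd (h3.symm.trans (hf.trans h1)) this
  · rfl

theorem mem_evenEdges_dart {d : G.Dart} :
    d.edge ∈ evenEdges G v v' ↔ ∃ s, d.fst = evenVert v v' s ∨ d.snd = evenVert v v' s := by
  have : ∀ x, x ∈ d.edge ↔ x = d.fst ∨ x = d.snd := fun x => Sym2.mem_iff
  simp only [evenEdges, Set.mem_ofPred_eq, d.edge_mem, true_and, this]
  exact exists_congr fun s => or_congr eq_comm eq_comm

/-- An edge at a smashed vertex separates its bounded face from the outer face. -/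
theorem sides_evenEdges (h : E.IsFrame v v' f f') {d : G.Dart}
    {s} (hd : d.fst = evenVert v v' s ∨ d.snd = evenVert v v' s) :
    (E.faceOf d = E.outer ∧ E.faceOf d.symm = E.evenFace f f' s) ∨
      (E.faceOf d = E.evenFace f f' s ∧ E.faceOf d.symm = E.outer) := by
  rcases hd with hd | hd
  · exact h.sides hd
  · have := h.sides (d := d.symm) hd
    rw [SimpleGraph.Dart.symm_symm] at this
    tauto

theorem evenVert_unique_of_edge (h : E.IsFrame v v' f f') {d : G.Dart} {s s'}
    (hs : d.fst = evenVert v v' s ∨ d.snd = evenVert v v' s)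
    (hs' : d.fst = evenVert v v' s' ∨ d.snd = evenVert v v' s') : s = s' := by
  have h1 := evenFace_ne_outer (E := E) (f := f) (f' := f') s
  have h2 := evenFace_ne_outer (E := E) (f := f) (f' := f') s'
  rcases h.sides_evenEdges hs with ⟨e1, e2⟩ | ⟨e1, e2⟩ <;>
    rcases h.sides_evenEdges hs' with ⟨e3, e4⟩ | ⟨e3, e4⟩
  · exact h.evenFace_injective (e2.symm.trans e4)
  · exact absurd (e3.symm.trans e1) h2
  · exact absurd (e1.symm.trans e3) h1
  · exact h.evenFace_injective (e1.symm.trans e3)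

/-- The smashed vertices are not adjacent, since their bounded faces are distinct. -/
theorem not_adj_evenVert (h : E.IsFrame v v' f f') (s s') :
    ¬ G.Adj (evenVert v v' s) (evenVert v v' s') := by
  intro hadj
  have := h.evenVert_unique_of_edge (d := ⟨(_, _), hadj⟩) (Or.inl rfl) (Or.inr rfl)
  subst this
  exact G.loopless.irrefl _ hadj

theorem snd_ne_evenVert (h : E.IsFrame v v' f f') {d : G.Dart} {s} (hd : d.fst = evenVert v v' s)
    (s') : d.snd ≠ evenVert v v' s' := by
  intro hd'
  have := d.adj
  rw [hd, hd'] at this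
  exact h.not_adj_evenVert _ _ this

/-- The edges at the smashed vertices, listed without repetitions: two for each of them. -/
theorem exists_evenEdges_embedding (h : E.IsFrame v v' f f') :
    ∃ g : (Fin n ⊕ Fin n) × Bool → Sym2 V, Function.Injective g ∧
      (∀ s b, g (s, b) ∈ G.edgeSet ∧ evenVert v v' s ∈ g (s, b)) ∧
      ∀ e ∈ evenEdges G v v', ∃ p, g p = e := by
  choose a b hab ha hb h1 h2 h3 h4 hall using h.exists_darts
  refine ⟨fun p => bif p.2 then (a p.1).edge else (b p.1).edge, ?_, ?_, ?_⟩
  · rintro ⟨s, x⟩ ⟨s', x'⟩ hxx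
    have hne : (a s).edge ≠ (b s).edge := by
      intro he
      rcases (SimpleGraph.dart_edge_eq_iff _ _).1 he with he | he
      · exact hab s he
      · have := h.snd_ne_evenVert (hb s) s
        rw [← ha s, he] at this
        exact this rfl
    have hs : s = s' := by
      have key : ∀ d d' : G.Dart, d.fst = evenVert v v' s → d'.fst = evenVert v v' s' →
          d.edge = d'.edge → s = s' := by
        intro d d' hd hd' he
        refine h.evenVert_unique_of_edge (d := d) (Or.inl hd) ?_
        rcases (SimpleGraph.dart_edge_eq_iff _ _).1 he with rfl | rfl
        · exact Or.inl hd'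
        · exact Or.inr hd'
      cases x <;> cases x' <;> exact key _ _ (by first | exact ha s | exact hb s)
        (by first | exact ha s' | exact hb s') hxx
    subst hs
    cases x <;> cases x'
    · rfl
    · exact absurd hxx.symm hne
    · exact absurd hxx hne
    · rfl
  · intro s x
    cases x
    · exact ⟨(b s).edge_mem, by rw [← hb s]; exact Sym2.mem_mk_left _ _⟩
    · exact ⟨(a s).edge_mem, by rw [← ha s]; exact Sym2.mem_mk_left _ _⟩
  · rintro e ⟨he, s, hs⟩
    obtain ⟨y, rfl⟩ := hs
    rcases hall s ⟨(_, y), he⟩ rfl with hd | hd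
    · exact ⟨(s, true), congrArg SimpleGraph.Dart.edge hd.symm⟩
    · exact ⟨(s, false), congrArg SimpleGraph.Dart.edge hd.symm⟩

end IsFrame

end PlaneEmbedding

/-! ### Pairings of vertices and faces with edges -/

section Flow

variable {V X : Type*} {G : SimpleGraph V}

/-- The relation `p` is a perfect matching between the sites in `U` and the edges in `A`, each site
being matched with an edge at it. -/
structure IsMatchingOn (t : G.Dart → X) (U : Set X) (A : Set (Sym2 V)) (p : X → Sym2 V → Prop) :
    Prop where
  incident : ∀ {x e}, p x e → ∃ d : G.Dart, d.edge = e ∧ t d = x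
  site_mem : ∀ {x e}, p x e → x ∈ U
  edge_mem : ∀ {x e}, p x e → e ∈ A
  exists_edge : ∀ {x}, x ∈ U → ∃ e, p x e
  edge_unique : ∀ {x e e'}, p x e → p x e' → e = e'
  exists_site : ∀ {e}, e ∈ A → ∃ x, p x e
  site_unique : ∀ {x y e}, p x e → p y e → x = y

/-- The site `y` is at the other end of the edge matched with `x`. -/
def Step (t : G.Dart → X) (p : X → Sym2 V → Prop) (x y : X) : Prop :=
  ∃ d : G.Dart, p x d.edge ∧ t d = x ∧ t d.symm = y

end Flow

namespace PlaneEmbedding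

variable {V : Type*} {G : SimpleGraph V} (E : PlaneEmbedding G) {n : ℕ}

/-- The vertices that are matched: those that are neither smashed nor roots. -/
def freeVerts (v v' : Fin (2 * n + 1) → V) : Set V :=
  {x | (∀ s, x ≠ evenVert v v' s) ∧ ∀ i : Fin (n + 1), x ≠ v' (oddIdx i)}

/-- The faces that are matched: the bounded faces other than the `f'_{2i}`. -/
def freeFaces (f' : Fin n → E.BoundedFace) : Set E.Face :=
  {φ | φ ≠ E.outer ∧ ∀ i, φ ≠ (f' i).1}

/-- A perfect matching of the graph in the theorem, split into the matching `pV` of vertices with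
the edges in `F` and the matching `pF` of faces with the other edges that are not smashed. -/
structure IsPairing (v v' : Fin (2 * n + 1) → V) (f' : Fin n → E.BoundedFace)
    (F : Set (Sym2 V)) (pV : V → Sym2 V → Prop) (pF : E.Face → Sym2 V → Prop) : Prop where
  subset : F ⊆ G.edgeSet
  disjoint : Disjoint F (evenEdges G v v')
  vert : IsMatchingOn (fun d : G.Dart => d.fst) (freeVerts v v') F pV
  face : IsMatchingOn E.faceOf (E.freeFaces f') (G.edgeSet \ (F ∪ evenEdges G v v')) pF

/-- The edges cut by a set `Q` of faces: the edges matched with the faces in `Q`, and the edges at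
the smashed vertices with indices in `Z`. -/
def cutEdges (v v' : Fin (2 * n + 1) → V) (pF : E.Face → Sym2 V → Prop) (Q : Set E.Face)
    (Z : Set (Fin n ⊕ Fin n)) : Set (Sym2 V) :=
  {e | (∃ φ ∈ Q, pF φ e) ∨ (e ∈ G.edgeSet ∧ ∃ s ∈ Z, evenVert v v' s ∈ e)}

/-- The vertices that the cut edges separate from the vertex `b`. -/
def cutOff (B : Set (Sym2 V)) (b : V) : Set V :=
  {x | ¬ EdgeLinked (fun d : G.Dart => d.fst) Bᶜ b x}

/-- The faces touched by an edge that is in `B` or has an end separated from `b` by `B`. -/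
def touched (B : Set (Sym2 V)) (b : V) : Set E.Face :=
  {φ | ∃ d : G.Dart, E.faceOf d = φ ∧
    (d.edge ∈ B ∨ d.fst ∈ cutOff (G := G) B b ∨ d.snd ∈ cutOff (G := G) B b)}

section

variable {E} {v v' : Fin (2 * n + 1) → V} {f f' : Fin n → E.BoundedFace} {F : Set (Sym2 V)}
  {pV : V → Sym2 V → Prop} {pF : E.Face → Sym2 V → Prop}

theorem mem_edge_iff {d : G.Dart} {x : V} : x ∈ d.edge ↔ x = d.fst ∨ x = d.snd := Sym2.mem_iff

theorem exists_dart_of_mem {e : Sym2 V} (he : e ∈ G.edgeSet) {x : V} (hx : x ∈ e) :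
    ∃ d : G.Dart, d.edge = e ∧ d.fst = x := by
  obtain ⟨y, rfl⟩ := hx
  exact ⟨⟨(x, y), he⟩, rfl, rfl⟩

theorem exists_dart_of_edge {e : Sym2 V} (he : e ∈ G.edgeSet) : ∃ d : G.Dart, d.edge = e := by
  induction e using Sym2.ind with
  | _ x y => exact ⟨⟨(x, y), he⟩, rfl⟩

theorem cutOff_of_dart {B : Set (Sym2 V)} {b : V} {d : G.Dart} (hd : d.edge ∉ B) :
    d.fst ∈ cutOff (G := G) B b ↔ d.snd ∈ cutOff (G := G) B b := by
  have hl : EdgeLinked (fun d : G.Dart => d.fst) Bᶜ d.fst d.snd :=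
    linked_dart (fun d : G.Dart => d.fst) (A := Bᶜ) hd
  exact not_congr ⟨fun h => h.trans hl, fun h => h.trans hl.symm⟩

theorem IsPairing.cutEdges_subset (hp : E.IsPairing v v' f' F pV pF) {Q : Set E.Face}
    {Z : Set (Fin n ⊕ Fin n)} : E.cutEdges v v' pF Q Z ⊆ G.edgeSet := by
  rintro e (⟨φ, -, he⟩ | ⟨he, -⟩)
  · exact (hp.face.edge_mem he).1
  · exact he

/-- The faces at a cut edge are in `Q` or the outer face. -/
theorem IsPairing.faceOf_mem_of_cutEdges (h : E.IsFrame v v' f f')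
    (hp : E.IsPairing v v' f' F pV pF)
    {Q : Set E.Face} (hQ : ∀ φ ∈ Q, ∀ ψ, Step E.faceOf pF φ ψ → ψ ∈ Q ∨ ψ = E.outer)
    {Z : Set (Fin n ⊕ Fin n)} (hZ : ∀ s ∈ Z, E.evenFace f f' s ∈ Q) {d : G.Dart}
    (hd : d.edge ∈ E.cutEdges v v' pF Q Z) : E.faceOf d ∈ Q ∨ E.faceOf d = E.outer := by
  rcases hd with ⟨φ, hφ, he⟩ | ⟨-, s, hs, hse⟩
  · obtain ⟨d', hd', rfl⟩ := hp.face.incident he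
    rcases (SimpleGraph.dart_edge_eq_iff _ _).1 hd' with rfl | rfl
    · exact Or.inl hφ
    · exact hQ _ hφ _ ⟨d.symm, by simpa using he, rfl, by simp⟩
  · rcases h.sides_evenEdges ((mem_edge_iff.1 hse).imp Eq.symm Eq.symm) with ⟨h1, -⟩ | ⟨h1, -⟩
    · exact Or.inr h1
    · exact Or.inl (h1 ▸ hZ s hs)

variable [Finite V]

/-- Euler's formula, applied to the region separated from `b` by `B`. -/
theorem card_region {B : Set (Sym2 V)} (hB : B ⊆ G.edgeSet) {b : V}
    (hne : (E.touched B b).Nonempty) :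
    (B ∪ {e | e ∈ G.edgeSet ∧ ∃ x ∈ cutOff (G := G) B b, x ∈ e}).ncard + 1 ≤
      (cutOff (G := G) B b).ncard + (E.touched B b).ncard := by
  set W := cutOff (G := G) B b with hW
  set A := B ∪ {e | e ∈ G.edgeSet ∧ ∃ x ∈ W, x ∈ e} with hAdef
  have hA : A ⊆ G.edgeSet := Set.union_subset hB fun e he => he.1
  have h1 := E.euler_of_subset (A := G.edgeSet \ A) Set.sdiff_subset
  have h2 := card_lt_numClasses_add_ncard (t := E.faceOf) (A := (G.edgeSet \ A)ᶜ) hne (by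
    intro d hd
    have hd : d.edge ∈ A := by
      by_contra h
      exact hd ⟨d.edge_mem, h⟩
    refine ⟨d, rfl, ?_⟩
    rcases hd with hd | ⟨-, x, hx, hxe⟩
    · exact Or.inl hd
    · rcases mem_edge_iff.1 hxe with rfl | rfl
      · exact Or.inr (Or.inl hx)
      · exact Or.inr (Or.inr hx))
  have h3 : numClasses (fun d : G.Dart => d.fst) (G.edgeSet \ A) ≤ W.ncard + 1 := by
    let g : Option W → Quot (EdgeJoined (fun d : G.Dart => d.fst) (G.edgeSet \ A)) :=
      fun o => o.elim (Quot.mk _ b) fun x => Quot.mk _ x.1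
    have hg : Function.Surjective g := by
      rintro ⟨x⟩
      by_cases hx : x ∈ W
      · exact ⟨some ⟨x, hx⟩, rfl⟩
      · refine ⟨none, quot_mk_joined_eq.2 ?_⟩
        have hx : EdgeLinked (fun d : G.Dart => d.fst) Bᶜ b x := not_not.1 hx
        induction hx with
        | refl => exact EdgeLinked.refl _ _ _
        | @tail y z hy hj ih =>
          refine EdgeLinked.trans (ih (not_not.2 hy)) (EdgeJoined.linked ?_)
          have hz : EdgeLinked (fun d : G.Dart => d.fst) Bᶜ b z :=
            EdgeLinked.trans hy (EdgeJoined.linked hj)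
          obtain ⟨d, hd, rfl, rfl⟩ := hj
          refine ⟨d, ⟨d.edge_mem, ?_⟩, rfl, rfl⟩
          rintro (h | ⟨-, x, hx, hxe⟩)
          · exact hd h
          · rcases mem_edge_iff.1 hxe with rfl | rfl
            · exact hx hy
            · exact hx hz
    have := Nat.card_le_card_of_surjective g hg
    rwa [Finite.card_option, Nat.card_coe_set_eq] at this
  have h4 := Set.ncard_sdiff_add_ncard_of_subset hA
  have h5 := E.euler
  rw [Nat.card_coe_set_eq] at h5
  omega

/-- A touched bounded face outside of `Q` lies inside the region that is cut off. -/
theorem IsPairing.fst_mem_cutOff (h : E.IsFrame v v' f f') (hp : E.IsPairing v v' f' F pV pF)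
    {Q : Set E.Face} (hQ : ∀ φ ∈ Q, ∀ ψ, Step E.faceOf pF φ ψ → ψ ∈ Q ∨ ψ = E.outer)
    {Z : Set (Fin n ⊕ Fin n)} (hZ : ∀ s ∈ Z, E.evenFace f f' s ∈ Q) {b : V} {φ : E.Face}
    (hφ : φ ∈ E.touched (E.cutEdges v v' pF Q Z) b) (hφQ : φ ∉ Q)
    (hout : φ = E.outer → ∀ d : G.Dart, E.faceOf d = E.outer →
      d.edge ∉ E.cutEdges v v' pF Q Z) {d : G.Dart}
    (hd : E.faceOf d = φ) : d.fst ∈ cutOff (G := G) (E.cutEdges v v' pF Q Z) b := by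
  have hno : ∀ d' : G.Dart, E.faceOf d' = φ → d'.edge ∉ E.cutEdges v v' pF Q Z := by
    intro d' hd' hmem
    rcases hp.faceOf_mem_of_cutEdges h hQ hZ hmem with h' | h'
    · exact hφQ (hd' ▸ h')
    · exact hout (hd'.symm.trans h') d' h' hmem
  obtain ⟨d', hd', hcase⟩ := hφ
  have hd'W : d'.fst ∈ cutOff (G := G) (E.cutEdges v v' pF Q Z) b := by
    rcases hcase with h' | h' | h'
    · exact absurd h' (hno d' hd')
    · exact h'
    · exact (cutOff_of_dart (hno d' hd')).2 h'
  have hl := E.linked_fst_of_faceOf_eq (d := d') (d' := d)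
    (A := (E.cutEdges v v' pF Q Z)ᶜ) (hd'.trans hd.symm)
    (fun d₁ hd₁ => hno d₁ (hd₁.trans hd'))
  exact fun hb => hd'W (hb.trans hl.symm)

/-- The count behind the argument. If a set `Q` of bounded faces is closed under the flow of the
matching, consider the region cut off from `b` by its edges. By Euler's formula, the region has
fewer edges than vertices and faces together. As the matched vertices and faces, and two edges for
each smashed vertex, account for different edges, the region has fewer smashed vertices than
unmatched ones: roots, faces `f'_{2i}`, and the outer face. -/
theorem IsPairing.region_count (h : E.IsFrame v v' f f') (hp : E.IsPairing v v' f' F pV pF)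
    {Q : Set E.Face} (hQ : ∀ φ ∈ Q, ∀ ψ, Step E.faceOf pF φ ψ → ψ ∈ Q ∨ ψ = E.outer)
    {Z : Set (Fin n ⊕ Fin n)} (hZ : ∀ s ∈ Z, E.evenFace f f' s ∈ Q) (b : V)
    (hne : (E.touched (E.cutEdges v v' pF Q Z) b).Nonempty) :
    {s | evenVert v v' s ∈ cutOff (G := G) (E.cutEdges v v' pF Q Z) b}.ncard + 1 ≤
      {i | v' (oddIdx i) ∈ cutOff (G := G) (E.cutEdges v v' pF Q Z) b}.ncard +
      {i | (f' i).1 ∈ E.touched (E.cutEdges v v' pF Q Z) b}.ncard +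
      ({E.outer} ∩ E.touched (E.cutEdges v v' pF Q Z) b).ncard := by
  have hcard := card_region (E := E) hp.cutEdges_subset hne
  have hfst := fun φ hφ hφQ hout d => hp.fst_mem_cutOff h hQ hZ (b := b) (φ := φ) hφ hφQ hout
    (d := d)
  set B := E.cutEdges v v' pF Q Z with hBdef
  set W := cutOff (G := G) B b with hW
  set Y := E.touched B b with hY
  set A := B ∪ {e | e ∈ G.edgeSet ∧ ∃ x ∈ W, x ∈ e} with hA
  have hWle : W.ncard ≤ (W ∩ freeVerts v v').ncard + {s | evenVert v v' s ∈ W}.ncard +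
      {i : Fin (n + 1) | v' (oddIdx i) ∈ W}.ncard := by
    have hsub : W ⊆ ((W ∩ freeVerts v v') ∪ evenVert v v' '' {s | evenVert v v' s ∈ W}) ∪
        (fun i : Fin (n + 1) => v' (oddIdx i)) '' {i | v' (oddIdx i) ∈ W} := by
      intro x hx
      by_cases h1 : ∃ s, x = evenVert v v' s
      · obtain ⟨s, rfl⟩ := h1
        exact Or.inl (Or.inr ⟨s, hx, rfl⟩)
      by_cases h2 : ∃ i : Fin (n + 1), x = v' (oddIdx i)
      · obtain ⟨i, rfl⟩ := h2
        exact Or.inr ⟨i, hx, rfl⟩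
      · exact Or.inl (Or.inl ⟨hx, not_exists.1 h1, not_exists.1 h2⟩)
    refine (Set.ncard_le_ncard hsub).trans ((Set.ncard_union_le _ _).trans ?_)
    refine add_le_add ((Set.ncard_union_le _ _).trans (add_le_add le_rfl ?_)) ?_ <;>
      exact Set.ncard_image_le
  have hYle : Y.ncard ≤ (Y ∩ E.freeFaces f').ncard + {i | (f' i).1 ∈ Y}.ncard +
      ({E.outer} ∩ Y).ncard := by
    have hsub : Y ⊆ ((Y ∩ E.freeFaces f') ∪ (fun i => (f' i).1) '' {i | (f' i).1 ∈ Y}) ∪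
        ({E.outer} ∩ Y) := by
      intro φ hφ
      by_cases h1 : φ = E.outer
      · exact Or.inr ⟨h1, hφ⟩
      by_cases h2 : ∃ i, φ = (f' i).1
      · obtain ⟨i, rfl⟩ := h2
        exact Or.inl (Or.inr ⟨i, hφ, rfl⟩)
      · exact Or.inl (Or.inl ⟨hφ, h1, not_exists.1 h2⟩)
    refine (Set.ncard_le_ncard hsub).trans ((Set.ncard_union_le _ _).trans ?_)
    refine add_le_add ((Set.ncard_union_le _ _).trans (add_le_add le_rfl ?_)) le_rfl
    exact Set.ncard_image_le
  -- The matched vertices and faces in the region, and the edges at the smashed vertices in it.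
  have hinj : (W ∩ freeVerts v v').ncard + (Y ∩ E.freeFaces f').ncard +
      {s | evenVert v v' s ∈ W}.ncard * 2 ≤ A.ncard := by
    obtain ⟨g, hg, hgs, -⟩ := h.exists_evenEdges_embedding
    choose eV heV using fun x : ↥(W ∩ freeVerts v v') => hp.vert.exists_edge x.2.2
    choose eF heF using fun φ : ↥(Y ∩ E.freeFaces f') => hp.face.exists_edge φ.2.2
    have mV : ∀ x, eV x ∈ A := by
      intro x
      obtain ⟨d, hd, hdx⟩ := hp.vert.incident (heV x)
      exact Or.inr ⟨hp.subset (hp.vert.edge_mem (heV x)), x, x.2.1,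
        hd ▸ mem_edge_iff.2 (Or.inl hdx.symm)⟩
    have mF : ∀ φ, eF φ ∈ A := by
      intro φ
      by_cases hφQ : φ.1 ∈ Q
      · exact Or.inl (Or.inl ⟨φ, hφQ, heF φ⟩)
      · obtain ⟨d, hd, hdx⟩ := hp.face.incident (heF φ)
        refine Or.inr ⟨(hp.face.edge_mem (heF φ)).1, d.fst, ?_, hd ▸ mem_edge_iff.2 (Or.inl rfl)⟩
        exact hfst φ φ.2.1 hφQ (fun h => absurd h φ.2.2.1) d hdx
    let T := (↥(W ∩ freeVerts v v') ⊕ ↥(Y ∩ E.freeFaces f')) ⊕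
      (↥{s | evenVert v v' s ∈ W} × Bool)
    let m : T → A := Sum.elim (Sum.elim (fun x => ⟨eV x, mV x⟩) fun φ => ⟨eF φ, mF φ⟩)
      fun q => ⟨g (q.1.1, q.2), Or.inr ⟨(hgs _ _).1, _, q.1.2, (hgs _ _).2⟩⟩
    have hD : ∀ s b, g (s, b) ∈ evenEdges G v v' := fun s b => ⟨(hgs s b).1, s, (hgs s b).2⟩
    have dVF : ∀ x φ, eV x ≠ eF φ := fun x φ he =>
      (hp.face.edge_mem (heF φ)).2 (Or.inl (he ▸ hp.vert.edge_mem (heV x)))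
    have dVD : ∀ x s b, eV x ≠ g (s, b) := fun x s b he =>
      Set.disjoint_left.1 hp.disjoint (hp.vert.edge_mem (heV x)) (he ▸ hD s b)
    have dFD : ∀ φ s b, eF φ ≠ g (s, b) := fun φ s b he =>
      (hp.face.edge_mem (heF φ)).2 (Or.inr (he ▸ hD s b))
    have hm : Function.Injective m := by
      rintro ((x | φ) | ⟨s, β⟩) ((y | ψ) | ⟨s', β'⟩) hxy <;> have hxy := congrArg Subtype.val hxy
      · have : x = y := Subtype.ext (hp.vert.site_unique (heV x) (by
          rw [show eV x = eV y from hxy]; exact heV y))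
        rw [this]
      · exact absurd hxy (dVF x ψ)
      · exact absurd hxy (dVD x _ _)
      · exact absurd hxy.symm (dVF y φ)
      · have : φ = ψ := Subtype.ext (hp.face.site_unique (heF φ) (by
          rw [show eF φ = eF ψ from hxy]; exact heF ψ))
        rw [this]
      · exact absurd hxy (dFD φ _ _)
      · exact absurd hxy.symm (dVD y _ _)
      · exact absurd hxy.symm (dFD ψ _ _)
      · have := hg hxy
        simp only [Prod.mk.injEq] at this
        obtain ⟨h1, rfl⟩ := this
        rw [Subtype.ext h1]
    have := Nat.card_le_card_of_injective m hm
    simp only [T, Nat.card_sum, Nat.card_prod, Nat.card_coe_set_eq] at this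
    simpa using this
  omega

end

end PlaneEmbedding

/-! ### The flow of a pairing -/

section Flow

variable {V X : Type*} {G : SimpleGraph V} {t : G.Dart → X} {U : Set X} {A : Set (Sym2 V)}
  {p : X → Sym2 V → Prop} {x y z : X}

/-- One can go from `x` to `y` along edges, always leaving a site by the edge matched with it. -/
def FlowsTo (t : G.Dart → X) (p : X → Sym2 V → Prop) : X → X → Prop :=
  Relation.ReflTransGen (Step t p)

theorem Step.joined (hm : IsMatchingOn t U A p) (h : Step t p x y) : EdgeJoined t A x y := by
  obtain ⟨d, hd, rfl, rfl⟩ := h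
  exact ⟨d, hm.edge_mem hd, rfl, rfl⟩

theorem FlowsTo.linked (hm : IsMatchingOn t U A p) (h : FlowsTo t p x y) : EdgeLinked t A x y :=
  Relation.ReflTransGen.mono (fun _ _ h => Step.joined hm h) _ _ h

theorem Step.mem (hm : IsMatchingOn t U A p) (h : Step t p x y) : x ∈ U := by
  obtain ⟨d, hd, -⟩ := h
  exact hm.site_mem hd

theorem IsMatchingOn.step_of_mem (hm : IsMatchingOn t U A p) {d : G.Dart} (hd : p x d.edge) :
    (t d = x ∧ Step t p x (t d.symm)) ∨ (t d.symm = x ∧ Step t p x (t d)) := by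
  obtain ⟨d', hd', rfl⟩ := hm.incident hd
  rcases (SimpleGraph.dart_edge_eq_iff _ _).1 hd' with rfl | rfl
  · exact Or.inl ⟨rfl, _, hd, rfl, rfl⟩
  · exact Or.inr ⟨rfl, d.symm, by simpa using hd, rfl, by simp⟩

theorem IsMatchingOn.step_unique (hm : IsMatchingOn t U A p) (h : Step t p x y)
    (h' : Step t p x z) : y = z := by
  obtain ⟨d, hd, hx, rfl⟩ := h
  obtain ⟨d', hd', hx', rfl⟩ := h'
  rcases (SimpleGraph.dart_edge_eq_iff _ _).1 (hm.edge_unique hd hd') with rfl | rfl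
  · rfl
  · rw [SimpleGraph.Dart.symm_symm, hx', hx]

theorem IsMatchingOn.eq_of_flowsTo (hm : IsMatchingOn t U A p) (hx : x ∉ U)
    (h : FlowsTo t p x y) : y = x := by
  rcases Relation.ReflTransGen.cases_head h with h | ⟨z, hz, -⟩
  · exact h.symm
  · exact absurd (hz.mem hm) hx

theorem IsMatchingOn.flowsTo_sink (hm : IsMatchingOn t U A p) (hz : z ∉ U) (h : FlowsTo t p x y)
    (h' : FlowsTo t p x z) : FlowsTo t p y z := by
  rcases Relation.ReflTransGen.total_of_right_unique (r := Step t p)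
    (fun _ _ _ h h' => hm.step_unique h h') h h' with h | h
  · exact h
  · rw [hm.eq_of_flowsTo hz h]
    exact Relation.ReflTransGen.refl

/-- Linked sites flow to the same sink. -/
theorem IsMatchingOn.flowsTo_of_linked (hm : IsMatchingOn t U A p) (hz : z ∉ U)
    (h : EdgeLinked t A x y) (hx : FlowsTo t p x z) : FlowsTo t p y z := by
  refine h.invariant (p := fun y => FlowsTo t p y z) ?_ hx
  intro d hd hdz
  obtain ⟨w, hw⟩ := hm.exists_site hd
  rcases hm.step_of_mem hw with ⟨rfl, hs⟩ | ⟨rfl, hs⟩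
  · exact hm.flowsTo_sink hz (Relation.ReflTransGen.single hs) hdz
  · exact Relation.ReflTransGen.head hs hdz

theorem not_linked_of_isolated {B : Set (Sym2 V)} {b x : V} (hb : b ≠ x)
    (hx : ∀ d : G.Dart, d.snd = x → d.edge ∈ B) :
    ¬ EdgeLinked (fun d : G.Dart => d.fst) Bᶜ b x := by
  intro h
  refine h.invariant (p := fun y => y ≠ x) ?_ hb rfl
  intro d hd _ hdx
  exact hd (hx d hdx)

end Flow

namespace PlaneEmbedding

variable {V : Type*} {G : SimpleGraph V} {E : PlaneEmbedding G} {n : ℕ}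
  {v v' : Fin (2 * n + 1) → V} {f f' : Fin n → E.BoundedFace} {F : Set (Sym2 V)}
  {pV : V → Sym2 V → Prop} {pF : E.Face → Sym2 V → Prop}

theorem outer_notMem_freeFaces : E.outer ∉ E.freeFaces f' := fun h => h.1 rfl

theorem notMem_freeFaces (i : Fin n) : (f' i).1 ∉ E.freeFaces f' := fun h => h.2 i rfl

theorem root_notMem_freeVerts (i : Fin (n + 1)) : v' (oddIdx i) ∉ freeVerts v v' :=
  fun h => h.2 i rfl

theorem IsFrame.evenEdges_link (h : E.IsFrame v v' f f') (s) {A : Set (Sym2 V)}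
    (hA : ∀ e ∈ evenEdges G v v', evenVert v v' s ∈ e → e ∈ A) :
    EdgeLinked E.faceOf A (E.evenFace f f' s) E.outer := by
  obtain ⟨a, b, -, -, hb, -, -, h3, h4, -⟩ := h.exists_darts s
  have : evenVert v v' s ∈ b.edge := mem_edge_iff.2 (Or.inl hb.symm)
  rw [← h3, ← h4]
  exact linked_dart _ (hA _ ⟨b.edge_mem, s, this⟩ this)

namespace IsPairing

theorem notMem_cutEdges_of_mem (hp : E.IsPairing v v' f' F pV pF) {Q : Set E.Face}
    {Z : Set (Fin n ⊕ Fin n)} {e : Sym2 V} (he : e ∈ F) : e ∉ E.cutEdges v v' pF Q Z := by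
  rintro (⟨φ, -, hφ⟩ | ⟨he', s, -, hs⟩)
  · exact (hp.face.edge_mem hφ).2 (Or.inl he)
  · exact Set.disjoint_left.1 hp.disjoint he ⟨he', s, hs⟩

theorem mem_cutEdges_evenEdges (h : E.IsFrame v v' f f') (hp : E.IsPairing v v' f' F pV pF)
    {Q : Set E.Face} {Z : Set (Fin n ⊕ Fin n)} {e : Sym2 V} {s} (he : e ∈ G.edgeSet)
    (hs : evenVert v v' s ∈ e) : e ∈ E.cutEdges v v' pF Q Z ↔ s ∈ Z := by
  constructor
  · rintro (⟨φ, -, hφ⟩ | ⟨he', s', hs', hse⟩)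
    · exact absurd (Or.inr ⟨he, s, hs⟩) (hp.face.edge_mem hφ).2
    · obtain ⟨d, rfl⟩ := exists_dart_of_edge he
      rwa [h.evenVert_unique_of_edge ((mem_edge_iff.1 hs).imp Eq.symm Eq.symm)
        ((mem_edge_iff.1 hse).imp Eq.symm Eq.symm)]
  · exact fun hZ => Or.inr ⟨he, s, hZ, hs⟩

theorem evenVert_mem_cutOff (h : E.IsFrame v v' f f') (hp : E.IsPairing v v' f' F pV pF)
    {Q : Set E.Face} {Z : Set (Fin n ⊕ Fin n)} {s} (hs : s ∈ Z) {b : V}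
    (hb : b ≠ evenVert v v' s) :
    evenVert v v' s ∈ cutOff (G := G) (E.cutEdges v v' pF Q Z) b :=
  not_linked_of_isolated hb fun d hd =>
    (hp.mem_cutEdges_evenEdges h d.edge_mem (mem_edge_iff.2 (Or.inr hd.symm))).2 hs

variable [Finite V]

/-- Every face flows to the outer face or to one of the `f'_{2i}`: otherwise the matching would
have to overfill the region enclosed by a cycle of the flow. -/
theorem exists_face_sink (h : E.IsFrame v v' f f') (hp : E.IsPairing v v' f' F pV pF)
    (φ : E.Face) : ∃ τ, τ ∉ E.freeFaces f' ∧ FlowsTo E.faceOf pF φ τ := by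
  by_contra hφ
  let Q : Set E.Face := {φ | ¬ ∃ τ, τ ∉ E.freeFaces f' ∧ FlowsTo E.faceOf pF φ τ}
  have hφQ : φ ∈ Q := hφ
  have hfree : ∀ ψ ∈ Q, ψ ∈ E.freeFaces f' := fun ψ hψ => by
    by_contra hψ'
    exact hψ ⟨ψ, hψ', Relation.ReflTransGen.refl⟩
  have hstep : ∀ ψ ∈ Q, ∀ χ, Step E.faceOf pF ψ χ → χ ∈ Q := by
    rintro ψ hψ χ hs ⟨τ, hτ, hfl⟩
    exact hψ ⟨τ, hτ, Relation.ReflTransGen.head hs hfl⟩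
  have hQ : ∀ ψ ∈ Q, ∀ χ, Step E.faceOf pF ψ χ → χ ∈ Q ∨ χ = E.outer := fun ψ hψ χ hs =>
    Or.inl (hstep ψ hψ χ hs)
  have hZ : ∀ s ∈ (∅ : Set (Fin n ⊕ Fin n)), E.evenFace f f' s ∈ Q := by simp
  have hout : ∀ d : G.Dart, E.faceOf d = E.outer → d.edge ∉ E.cutEdges v v' pF Q ∅ := by
    rintro d hd (⟨ψ, hψ, he⟩ | ⟨-, s, hs, -⟩)
    · rcases hp.face.step_of_mem he with ⟨rfl, -⟩ | ⟨rfl, hs⟩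
      · exact (hfree _ hψ).1 hd
      · exact (hfree _ (hstep _ hψ _ hs)).1 hd
    · exact hs
  obtain ⟨d₀, hd₀, hd₀'⟩ := h.right_onFace_outer (oddIdx 0)
  have hW : ∀ x, E.VertexOnFace x E.outer →
      x ∉ cutOff (G := G) (E.cutEdges v v' pF Q ∅) (v' (oddIdx 0)) := by
    rintro _ ⟨d, rfl, hd⟩ hx
    refine hx (hd₀ ▸ E.linked_fst_of_faceOf_eq (hd₀'.trans hd.symm) fun d₁ hd₁ => ?_)
    exact hout d₁ (hd₁.trans hd₀')
  obtain ⟨e, he⟩ := hp.face.exists_edge (hfree φ hφQ)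
  obtain ⟨d, rfl, hd⟩ := hp.face.incident he
  have hcount := hp.region_count h hQ hZ (v' (oddIdx 0)) ⟨φ, d, hd, Or.inl (Or.inl ⟨φ, hφQ, he⟩)⟩
  have e1 : {i | v' (oddIdx i) ∈ cutOff (G := G) (E.cutEdges v v' pF Q ∅) (v' (oddIdx 0))} = ∅ :=
    Set.eq_empty_iff_forall_notMem.2 fun i hi => hW _ (h.right_onFace_outer _) hi
  have e2 : {i | (f' i).1 ∈ E.touched (E.cutEdges v v' pF Q ∅) (v' (oddIdx 0))} = ∅ := by
    refine Set.eq_empty_iff_forall_notMem.2 fun i hi => ?_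
    obtain ⟨d, hd, hd'⟩ := h.onFace' i
    have := hp.fst_mem_cutOff h hQ hZ hi (fun h' => notMem_freeFaces i (hfree _ h'))
      (fun h' => absurd h' (f' i).2) hd'
    exact hW _ (hd ▸ h.right_onFace_outer _) this
  have e3 : {E.outer} ∩ E.touched (E.cutEdges v v' pF Q ∅) (v' (oddIdx 0)) = ∅ := by
    refine Set.eq_empty_iff_forall_notMem.2 ?_
    rintro _ ⟨rfl, hi⟩
    have := hp.fst_mem_cutOff h hQ hZ hi (fun h' => outer_notMem_freeFaces (hfree _ h'))
      (fun _ => hout) hd₀'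
    exact hW _ (hd₀ ▸ h.right_onFace_outer _) this
  rw [e1, e2, e3] at hcount
  simp at hcount

/-- The dual of the complement of `F` is connected. -/
theorem linked_outer (h : E.IsFrame v v' f f') (hp : E.IsPairing v v' f' F pV pF)
    (φ : E.Face) : EdgeLinked E.faceOf Fᶜ φ E.outer := by
  obtain ⟨τ, hτ, hfl⟩ := hp.exists_face_sink h φ
  have h1 : EdgeLinked E.faceOf Fᶜ φ τ := (hfl.linked hp.face).mono fun e he hF =>
    he.2 (Or.inl hF)
  refine h1.trans ?_
  by_cases h2 : τ = E.outer
  · rw [h2]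
    exact EdgeLinked.refl _ _ _
  by_cases h3 : ∃ i, τ = (f' i).1
  · obtain ⟨i, rfl⟩ := h3
    exact h.evenEdges_link (Sum.inr i) fun e he _ hF => Set.disjoint_left.1 hp.disjoint hF he
  · exact absurd ⟨h2, not_exists.1 h3⟩ hτ

theorem numClasses_compl (h : E.IsFrame v v' f f') (hp : E.IsPairing v v' f' F pV pF) :
    numClasses E.faceOf Fᶜ = 1 :=
  numClasses_eq_one fun φ ψ => (hp.linked_outer h φ).trans (hp.linked_outer h ψ).symm

/-- Every edge of `F` is a bridge, by duality. -/
theorem not_linked_erase (h : E.IsFrame v v' f f') (hp : E.IsPairing v v' f' F pV pF)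
    {d : G.Dart} (hd : d.edge ∈ F) :
    ¬ EdgeLinked (fun d : G.Dart => d.fst) (F \ {d.edge}) d.fst d.snd := by
  rw [E.linked_fst_iff_not_linked_faceOf (Set.sdiff_subset.trans hp.subset) (by simp),
    Set.insert_sdiff_singleton, Set.insert_eq_of_mem hd, not_not]
  exact (hp.linked_outer h _).trans (hp.linked_outer h _).symm

/-- Every vertex flows to a smashed vertex or a root: otherwise the matched edges would contain a
cycle. -/
theorem exists_vert_sink (h : E.IsFrame v v' f f') (hp : E.IsPairing v v' f' F pV pF) (x : V) :
    ∃ y, y ∉ freeVerts v v' ∧ FlowsTo (fun d : G.Dart => d.fst) pV x y := by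
  by_contra hx
  let Q : Set V := {x | ¬ ∃ y, y ∉ freeVerts v v' ∧ FlowsTo (fun d : G.Dart => d.fst) pV x y}
  have hxQ : x ∈ Q := hx
  have hfree : ∀ y ∈ Q, y ∈ freeVerts v v' := fun ψ hψ => by
    by_contra hψ'
    exact hψ ⟨ψ, hψ', Relation.ReflTransGen.refl⟩
  have hstep : ∀ ψ ∈ Q, ∀ χ, Step (fun d : G.Dart => d.fst) pV ψ χ → χ ∈ Q := by
    rintro ψ hψ χ hs ⟨τ, hτ, hfl⟩
    exact hψ ⟨τ, hτ, Relation.ReflTransGen.head hs hfl⟩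
  let A : Set (Sym2 V) := {e | ∃ y ∈ Q, pV y e}
  have hAF : A ⊆ F := by
    rintro e ⟨y, -, he⟩
    exact hp.vert.edge_mem he
  have h1 : numClasses E.faceOf Aᶜ ≤ 1 :=
    hp.numClasses_compl h ▸ numClasses_anti (Set.compl_subset_compl.2 hAF)
  have h2 := E.euler_of_subset (hAF.trans hp.subset)
  have h3 := card_lt_numClasses_add_ncard (t := fun d : G.Dart => d.fst) (A := A) (T := Q)
    ⟨x, hxQ⟩ (by
      rintro d ⟨y, hy, he⟩
      rcases hp.vert.step_of_mem he with ⟨rfl, -⟩ | ⟨rfl, hs⟩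
      · exact hy
      · exact hstep _ hy _ hs)
  have h4 : Q.ncard ≤ A.ncard := by
    choose e he using fun y : Q => hp.vert.exists_edge (hfree y.1 y.2)
    have := Nat.card_le_card_of_injective (fun y : Q => (⟨e y, y.1, y.2, he y⟩ : A)) (by
      intro y z hyz
      have : e y = e z := congrArg Subtype.val hyz
      exact Subtype.ext (hp.vert.site_unique (he y) (this ▸ he z)))
    simpa using this
  omega

/-- Every remaining vertex flows to a root. -/
theorem exists_root (h : E.IsFrame v v' f f') (hp : E.IsPairing v v' f' F pV pF) {x : V}
    (hx : ∀ s, x ≠ evenVert v v' s) :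
    ∃ i : Fin (n + 1), FlowsTo (fun d : G.Dart => d.fst) pV x (v' (oddIdx i)) := by
  obtain ⟨y, hy, hfl⟩ := hp.exists_vert_sink h x
  have hy' : ∀ s, y ≠ evenVert v v' s := by
    refine (hfl.linked hp.vert).invariant (p := fun y => ∀ s, y ≠ evenVert v v' s) ?_ hx
    intro d hd _ s hs
    exact Set.disjoint_left.1 hp.disjoint hd (IsFrame.mem_evenEdges_dart.2 ⟨s, Or.inr hs⟩)
  by_cases h' : ∃ i : Fin (n + 1), y = v' (oddIdx i)
  · obtain ⟨i, rfl⟩ := h'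
    exact ⟨i, hfl⟩
  · exact absurd ⟨hy', not_exists.1 h'⟩ hy

/-- Each `f_{2i}` flows to some `f'_{2j}`, and not to the outer face: otherwise the flow to the
outer face would cut off a region with a smashed vertex but no root and no `f'_{2j}`, as the path
`v'₁, v'₂, …, v'_{2n+1}` does not cross the cut. -/
theorem exists_flowsTo_right (h : E.IsFrame v v' f f') (hp : E.IsPairing v v' f' F pV pF)
    (i : Fin n) : ∃ j, FlowsTo E.faceOf pF (f i).1 (f' j).1 := by
  by_contra hi
  let Q : Set E.Face := {φ | φ ≠ E.outer ∧ ¬ ∃ j, FlowsTo E.faceOf pF φ (f' j).1}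
  let Z : Set (Fin n ⊕ Fin n) := {s | ∃ k, s = Sum.inl k ∧ (f k).1 ∈ Q}
  have hiQ : (f i).1 ∈ Q := ⟨(f i).2, hi⟩
  have hQ : ∀ ψ ∈ Q, ∀ χ, Step E.faceOf pF ψ χ → χ ∈ Q ∨ χ = E.outer := by
    intro ψ hψ χ hs
    by_cases hχ : χ = E.outer
    · exact Or.inr hχ
    · exact Or.inl ⟨hχ, fun ⟨j, hj⟩ => hψ.2 ⟨j, Relation.ReflTransGen.head hs hj⟩⟩
  have hZ : ∀ s ∈ Z, E.evenFace f f' s ∈ Q := by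
    rintro s ⟨k, rfl, hk⟩
    exact hk
  have hpath : ∀ k : ℕ, ∀ hk : k < 2 * n + 1,
      v' ⟨k, hk⟩ ∉ cutOff (G := G) (E.cutEdges v v' pF Q Z) (v' (oddIdx 0)) := by
    intro k
    induction k with
    | zero =>
      intro hk
      exact not_not.2 (EdgeLinked.refl _ _ _)
    | succ k ih =>
      intro hk hmem
      have hadj := h.path ⟨k, by omega⟩
      refine ih (by omega) ((cutOff_of_dart (d := ⟨(_, _), hadj⟩) ?_).2 hmem)
      have hmid : ∃ l : Fin n, evenVert v v' (Sum.inr l) ∈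
          s(v' (Fin.castSucc ⟨k, by omega⟩), v' (Fin.succ ⟨k, by omega⟩)) := by
        rcases Nat.even_or_odd' k with ⟨l, rfl | rfl⟩
        · exact ⟨⟨l, by omega⟩, Sym2.mem_mk_right _ _⟩
        · exact ⟨⟨l, by omega⟩, Sym2.mem_mk_left _ _⟩
      obtain ⟨l, hl⟩ := hmid
      intro hcut
      obtain ⟨k, hk, -⟩ := (hp.mem_cutEdges_evenEdges h hadj hl).1 hcut
      exact absurd hk (by simp)
  have hiW : evenVert v v' (Sum.inl i) ∈
      cutOff (G := G) (E.cutEdges v v' pF Q Z) (v' (oddIdx 0)) :=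
    hp.evenVert_mem_cutOff h (show Sum.inl i ∈ Z from ⟨i, rfl, hiQ⟩) (h.odd_right_ne 0 _)
  obtain ⟨d, hd, hd'⟩ := h.onFace i
  have hcount := hp.region_count h hQ hZ (v' (oddIdx 0)) ⟨(f i).1, d, hd',
    Or.inr (Or.inl (hd ▸ hiW))⟩
  have e1 : {i | v' (oddIdx i) ∈ cutOff (G := G) (E.cutEdges v v' pF Q Z) (v' (oddIdx 0))} = ∅ :=
    Set.eq_empty_iff_forall_notMem.2 fun i hi => hpath _ _ hi
  have e2 : {i | (f' i).1 ∈ E.touched (E.cutEdges v v' pF Q Z) (v' (oddIdx 0))} = ∅ := by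
    refine Set.eq_empty_iff_forall_notMem.2 fun i hi => ?_
    obtain ⟨d, hd, hd'⟩ := h.onFace' i
    have := hp.fst_mem_cutOff h hQ hZ hi
      (fun h' : (f' i).1 ∈ Q => h'.2 ⟨i, Relation.ReflTransGen.refl⟩)
      (fun h' => absurd h' (f' i).2) hd'
    exact hpath _ (evenIdx i).2 (hd ▸ this)
  have e3 : ({E.outer} ∩ E.touched (E.cutEdges v v' pF Q Z) (v' (oddIdx 0))).ncard ≤ 1 :=
    (Set.ncard_le_ncard Set.inter_subset_left).trans (Set.ncard_singleton _).le
  have e4 : 0 < {s | evenVert v v' s ∈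
      cutOff (G := G) (E.cutEdges v v' pF Q Z) (v' (oddIdx 0))}.ncard :=
    (Set.ncard_pos).2 ⟨_, hiW⟩
  rw [e1, e2, Set.ncard_empty, Set.ncard_empty] at hcount
  omega

end IsPairing

end PlaneEmbedding

/-! ### The flow from `f_{2i}` cuts the graph in two -/

namespace PlaneEmbedding

variable {V : Type*} {G : SimpleGraph V} {E : PlaneEmbedding G} {n : ℕ}
  {v v' : Fin (2 * n + 1) → V} {f f' : Fin n → E.BoundedFace} {F : Set (Sym2 V)}
  {pV : V → Sym2 V → Prop} {pF : E.Face → Sym2 V → Prop}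

variable (E) in
/-- The edges cut by the flow from the face `f_{2i}`, continued to the outer face across `v_{2i}`
at its beginning and across `v'_{2j}` at its end. -/
def flowCut (v v' : Fin (2 * n + 1) → V) (f : Fin n → E.BoundedFace)
    (pF : E.Face → Sym2 V → Prop) (i j : Fin n) : Set (Sym2 V) :=
  E.cutEdges v v' pF {ψ | FlowsTo E.faceOf pF (f i).1 ψ} {Sum.inl i, Sum.inr j}

theorem evenIdx_strictMono : StrictMono (evenIdx (n := n)) := fun i j hij => by
  have : (i : ℕ) < j := hij
  simp only [evenIdx, Fin.mk_lt_mk]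
  omega

namespace IsPairing

variable {i j : Fin n}

theorem flow_closed (ψ) (hψ : ψ ∈ {ψ | FlowsTo E.faceOf pF (f i).1 ψ}) (χ)
    (hs : Step E.faceOf pF ψ χ) :
    χ ∈ {ψ | FlowsTo E.faceOf pF (f i).1 ψ} ∨ χ = E.outer :=
  Or.inl (Relation.ReflTransGen.tail hψ hs)

theorem evenFace_mem_flow (hfl : FlowsTo E.faceOf pF (f i).1 (f' j).1) :
    ∀ s ∈ ({Sum.inl i, Sum.inr j} : Set (Fin n ⊕ Fin n)),
      E.evenFace f f' s ∈ {ψ | FlowsTo E.faceOf pF (f i).1 ψ} := by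
  rintro s (rfl | rfl)
  · exact Relation.ReflTransGen.refl
  · exact hfl

theorem flow_ne_outer (hp : E.IsPairing v v' f' F pV pF)
    (hfl : FlowsTo E.faceOf pF (f i).1 (f' j).1) {ψ} (hψ : FlowsTo E.faceOf pF (f i).1 ψ) :
    ψ ≠ E.outer := by
  rintro rfl
  have := hp.face.flowsTo_sink (notMem_freeFaces j) hψ hfl
  exact (f' j).2 (hp.face.eq_of_flowsTo outer_notMem_freeFaces this)

theorem flowCut_outer (hp : E.IsPairing v v' f' F pV pF)
    (hfl : FlowsTo E.faceOf pF (f i).1 (f' j).1) {d : G.Dart} (hd : E.faceOf d = E.outer)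
    (hB : d.edge ∈ E.flowCut v v' f pF i j) :
    ∃ s ∈ ({Sum.inl i, Sum.inr j} : Set (Fin n ⊕ Fin n)), evenVert v v' s ∈ d.edge := by
  rcases hB with ⟨ψ, hψ, he⟩ | ⟨-, hs⟩
  · rcases hp.face.step_of_mem he with ⟨rfl, -⟩ | ⟨rfl, hs⟩
    · exact absurd hd (hp.flow_ne_outer hfl hψ)
    · exact absurd hd (hp.flow_ne_outer hfl (Relation.ReflTransGen.tail hψ hs))
  · exact hs

/-- The edges of the flow from `f_{2i}` to `f'_{2j}`, together with those at `v'_{2j}`, link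
`f_{2i}` to the outer face. -/
theorem linked_flow_outer (h : E.IsFrame v v' f f') (hp : E.IsPairing v v' f' F pV pF)
    (hfl : FlowsTo E.faceOf pF (f i).1 (f' j).1) :
    EdgeLinked E.faceOf {e | e ∈ E.flowCut v v' f pF i j ∧ evenVert v v' (Sum.inl i) ∉ e}
      (f i).1 E.outer := by
  have h1 : ∀ ψ, FlowsTo E.faceOf pF (f i).1 ψ →
      EdgeLinked E.faceOf {e | e ∈ E.flowCut v v' f pF i j ∧ evenVert v v' (Sum.inl i) ∉ e}
        (f i).1 ψ := by
    intro ψ hψ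
    induction hψ with
    | refl => exact EdgeLinked.refl _ _ _
    | @tail y z hy hs ih =>
      obtain ⟨d, hd, rfl, rfl⟩ := hs
      refine ih.trans (linked_dart _ ⟨Or.inl ⟨_, hy, hd⟩, fun hmem => ?_⟩)
      exact (hp.face.edge_mem hd).2 (Or.inr ⟨d.edge_mem, _, hmem⟩)
  refine (h1 _ hfl).trans (h.evenEdges_link (Sum.inr j) fun e he hj => ⟨Or.inr ⟨he.1, _, Or.inr rfl,
    hj⟩, fun hi => ?_⟩)
  obtain ⟨d, rfl⟩ := exists_dart_of_edge he.1
  have := h.evenVert_unique_of_edge ((mem_edge_iff.1 hi).imp Eq.symm Eq.symm)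
    ((mem_edge_iff.1 hj).imp Eq.symm Eq.symm)
  simp at this

/-- The two arcs into which `v_{2i}` and `v'_{2j}` divide the outer boundary lie in different
components of the complement of the flow from `f_{2i}` to `f'_{2j}`. -/
theorem flowCut_arcs [Finite V] (h : E.IsFrame v v' f f') (hp : E.IsPairing v v' f' F pV pF)
    (hfl : FlowsTo E.faceOf pF (f i).1 (f' j).1) :
    (∀ k, evenIdx i < k →
      EdgeLinked (fun d : G.Dart => d.fst) (E.flowCut v v' f pF i j)ᶜ (v (Fin.last _)) (v k)) ∧
    (∀ k, evenIdx j < k →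
      EdgeLinked (fun d : G.Dart => d.fst) (E.flowCut v v' f pF i j)ᶜ (v (Fin.last _)) (v' k)) ∧
    (∀ k, k < evenIdx i →
      EdgeLinked (fun d : G.Dart => d.fst) (E.flowCut v v' f pF i j)ᶜ (v 0) (v k)) ∧
    (∀ k, k < evenIdx j →
      EdgeLinked (fun d : G.Dart => d.fst) (E.flowCut v v' f pF i j)ᶜ (v 0) (v' k)) ∧
    ¬ EdgeLinked (fun d : G.Dart => d.fst) (E.flowCut v v' f pF i j)ᶜ (v 0) (v (Fin.last _)) := by
  obtain ⟨d₀, hd₀, pos, pos', hanti, hmono, hlt, hm, hv, hv'⟩ := h.exists_position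
  set B := E.flowCut v v' f pF i j with hB
  set m := Function.minimalPeriod E.facePerm d₀ with hmdef
  set c : ℕ → G.Dart := fun k => E.facePerm^[k] d₀ with hc
  set s := pos (evenIdx i) with hs
  set s' := pos' (evenIdx j) with hs'
  have hsm : s < m := hm _
  have hss : s' < s := hlt _ _
  have hface : ∀ k, E.faceOf (c k) = E.outer := fun k => (E.faceOf_iterate d₀ k).trans hd₀
  have hsucc : ∀ k, (c k).snd = (c (k + 1)).fst := fun k => by
    simp only [hc, Function.iterate_succ_apply', facePerm_fst]
  have hper : ∀ k, c (k + m) = c k := fun k => by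
    simp only [hc, Function.iterate_add_apply, hmdef, Function.iterate_minimalPeriod]
  have hinj : ∀ k l, k < m → l < m → c k = c l → k = l := fun k l hk hl hkl =>
    Function.iterate_injOn_Iio_minimalPeriod hk hl hkl
  have hvi : (c s).fst = evenVert v v' (Sum.inl i) := (hv _).symm
  have hvj : (c s').fst = evenVert v v' (Sum.inr j) := (hv' _).symm
  have hav1 : ∀ t, t < m → t ≠ s → t ≠ s' →
      ∀ z ∈ ({Sum.inl i, Sum.inr j} : Set (Fin n ⊕ Fin n)), (c t).fst ≠ evenVert v v' z := by
    rintro t ht h1 h2 z (rfl | rfl) h3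
    · exact h1 (hinj _ _ ht hsm (h.dart_unique h3 hvi ((hface _).trans (hface _).symm)))
    · exact h2 (hinj _ _ ht (hss.trans hsm) (h.dart_unique h3 hvj ((hface _).trans (hface _).symm)))
  have hav2 : ∀ t, s < t → t < s' + m →
      ∀ z ∈ ({Sum.inl i, Sum.inr j} : Set (Fin n ⊕ Fin n)), (c t).fst ≠ evenVert v v' z := by
    intro t h1 h2
    by_cases h3 : t < m
    · exact hav1 t h3 (by omega) (by omega)
    · have := hper (t - m)
      rw [show t - m + m = t by omega] at this
      rw [this]
      exact hav1 _ (by omega) (by omega) (by omega)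
  have hlink : ∀ k l, k ≤ l → (∀ t, k ≤ t → t ≤ l →
      ∀ z ∈ ({Sum.inl i, Sum.inr j} : Set (Fin n ⊕ Fin n)), (c t).fst ≠ evenVert v v' z) →
      EdgeLinked (fun d : G.Dart => d.fst) Bᶜ (c k).fst (c l).fst := by
    intro k l hkl
    induction l, hkl using Nat.le_induction with
    | base => exact fun _ => EdgeLinked.refl _ _ _
    | succ l hkl ih =>
      intro hgood
      refine (ih fun t h1 h2 => hgood t h1 (by omega)).trans ?_
      rw [← hsucc]
      refine linked_dart (fun d : G.Dart => d.fst) (d := c l) fun hmem => ?_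
      obtain ⟨z, hz, hze⟩ := hp.flowCut_outer hfl (hface l) hmem
      rcases mem_edge_iff.1 hze with h1 | h1
      · exact hgood l hkl (by omega) z hz h1.symm
      · exact hgood (l + 1) (by omega) le_rfl z hz ((hsucc l).symm.trans h1.symm)
  -- The upper arc consists of the positions between `s'` and `s`, the lower one of the others.
  have hup : ∀ k l, s' < k → k < s → s' < l → l < s →
      EdgeLinked (fun d : G.Dart => d.fst) Bᶜ (c k).fst (c l).fst := by
    intro k l h1 h2 h3 h4
    rcases le_total k l with hkl | hkl
    · exact hlink k l hkl fun t h5 h6 => hav1 t (by omega) (by omega) (by omega)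
    · exact (hlink l k hkl fun t h5 h6 => hav1 t (by omega) (by omega) (by omega)).symm
  have hlow : ∀ k l, s < k → k < s' + m → s < l → l < s' + m →
      EdgeLinked (fun d : G.Dart => d.fst) Bᶜ (c k).fst (c l).fst := by
    intro k l h1 h2 h3 h4
    rcases le_total k l with hkl | hkl
    · exact hlink k l hkl fun t h5 h6 => hav2 t (by omega) (by omega)
    · exact (hlink l k hkl fun t h5 h6 => hav2 t (by omega) (by omega)).symm
  have h0 : s < pos 0 := hanti (show (0 : Fin (2 * n + 1)) < evenIdx i from by
    simp [Fin.lt_def, evenIdx])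
  have hlast : pos (Fin.last _) < s := hanti (show evenIdx i < Fin.last _ from by
    simp only [Fin.lt_def, evenIdx, Fin.val_last]
    omega)
  have h0' : 0 < s' := lt_of_le_of_lt (Nat.zero_le _) (hmono (show (0 : Fin (2 * n + 1)) < evenIdx j
    from by simp [Fin.lt_def, evenIdx]))
  have h0m : pos 0 < m := hm _
  have hlast' : s' < pos (Fin.last _) := hlt _ _
  refine ⟨?_, ?_, ?_, ?_, ?_⟩
  · intro k hk
    rw [hv, hv k]
    exact hup _ _ hlast' hlast (hlt _ _) (hanti hk)
  · intro k hk
    rw [hv, hv' k]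
    exact hup _ _ hlast' hlast (hmono hk) (hlt _ _)
  · intro k hk
    rw [hv, hv k]
    have := hm k
    exact hlow _ _ h0 (by omega) (hanti hk) (by omega)
  · intro k hk
    rw [hv, hv' k]
    have h1 := hmono hk
    have h2 := hper (pos' k)
    change EdgeLinked _ _ _ (c (pos' k)).fst
    rw [← h2]
    exact hlow _ _ h0 (by omega) (by omega) (by omega)
  · intro hl
    -- A link between the arcs would close up, across `v_{2i}`, to a cycle of `G` that separates the
    -- two sides of an edge at `v_{2i}`; but these are also linked along the flow.
    have hl' : EdgeLinked (fun d : G.Dart => d.fst) Bᶜ (c (s + 1)).fst (c (s - 1)).fst := by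
      refine (hlow (s + 1) (pos 0) (by omega) (by omega) h0 (by omega)).trans ?_
      have := hup (pos (Fin.last _)) (s - 1) hlast' hlast (by omega) (by omega)
      refine EdgeLinked.trans ?_ this
      have h1 := hl
      rw [hv, hv (Fin.last _)] at h1
      exact h1
    set a := c s with ha
    set b := c (s - 1) with hb
    have hbs : b.snd = a.fst := by
      rw [hsucc, ha, show s - 1 + 1 = s by omega]
    have hbB : b.edge ∈ B := Or.inr ⟨b.edge_mem, _, Or.inl rfl, mem_edge_iff.2 (Or.inr
      (hvi.symm.trans hbs.symm))⟩
    have haB : a.edge ∈ B := Or.inr ⟨a.edge_mem, _, Or.inl rfl, mem_edge_iff.2 (Or.inl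
      hvi.symm)⟩
    have hab : a.edge ≠ b.edge := by
      intro he
      rcases (SimpleGraph.dart_edge_eq_iff _ _).1 he with he | he
      · have := a.adj
        rw [← hbs, he] at this
        exact G.loopless.irrefl _ this
      · rcases h.sides (hvi : a.fst = _) with ⟨-, h2⟩ | ⟨h1, -⟩
        · have : E.faceOf a.symm = E.outer := by rw [he, SimpleGraph.Dart.symm_symm]; exact hface _
          exact IsFrame.evenFace_ne_outer _ (h2.symm.trans this)
        · exact IsFrame.evenFace_ne_outer _ (h1.symm.trans (hface _))
    set A := insert b.edge (G.edgeSet \ B) with hA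
    have haA : a.edge ∉ A := by
      rintro (h1 | h1)
      · exact hab h1
      · exact h1.2 haB
    have hAE : A ⊆ G.edgeSet := Set.insert_subset b.edge_mem Set.sdiff_subset
    have hlA : EdgeLinked (fun d : G.Dart => d.fst) A a.fst a.snd := by
      have h1 : EdgeLinked (fun d : G.Dart => d.fst) A a.fst b.fst := by
        rw [← hbs]
        exact (linked_dart (fun d : G.Dart => d.fst) (d := b) (Set.mem_insert _ _)).symm
      refine h1.trans (EdgeLinked.symm ?_)
      rw [show a.snd = (c (s + 1)).fst from hsucc s]
      refine Relation.ReflTransGen.mono ?_ _ _ hl'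
      rintro x y ⟨d, hd, hxy⟩
      exact ⟨d, Or.inr ⟨d.edge_mem, hd⟩, hxy⟩
    refine (E.linked_fst_iff_not_linked_faceOf hAE haA).1 hlA ?_
    have h1 : E.faceOf a = E.outer := hface _
    have h2 : E.faceOf a.symm = (f i).1 := by
      rcases h.sides (hvi : a.fst = _) with ⟨-, h2⟩ | ⟨h3, -⟩
      · exact h2
      · exact absurd (h3.symm.trans h1) (IsFrame.evenFace_ne_outer _)
    rw [h1, h2]
    refine EdgeLinked.symm ((hp.linked_flow_outer h hfl).mono ?_)
    rintro e ⟨he, hie⟩ (h3 | h3 | h3)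
    · exact hie (h3 ▸ mem_edge_iff.2 (Or.inl hvi.symm))
    · exact hie (h3 ▸ mem_edge_iff.2 (Or.inr (hvi.symm.trans hbs.symm)))
    · exact h3.2 he

/-- If the flow from `f_{2i}` ends in `f'_{2j}`, then `i = j`: the region counts on the two sides of
the flow give `i ≤ j` and `j ≤ i`. -/
theorem flowsTo_right_eq [Finite V] (h : E.IsFrame v v' f f') (hp : E.IsPairing v v' f' F pV pF)
    (hfl : FlowsTo E.faceOf pF (f i).1 (f' j).1) : i = j := by
  obtain ⟨hR, hR', hL, hL', hS⟩ := hp.flowCut_arcs h hfl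
  set B := E.flowCut v v' f pF i j with hB
  have hcount := fun b hne => hp.region_count h (flow_closed (pF := pF) (f := f) (i := i))
    (evenFace_mem_flow hfl) b hne
  have hZ := fun z hz b hb => hp.evenVert_mem_cutOff h
    (Q := {ψ | FlowsTo E.faceOf pF (f i).1 ψ}) (Z := {Sum.inl i, Sum.inr j}) (s := z) hz
    (b := b) hb
  have hfst := fun b k hk hkQ d hd => hp.fst_mem_cutOff h (flow_closed (pF := pF) (f := f) (i := i))
    (evenFace_mem_flow hfl) (b := b) (φ := (f' k).1) hk hkQ (fun h' => absurd h' (f' k).2) (d := d)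
    hd
  change ∀ b, (E.touched B b).Nonempty → {s | evenVert v v' s ∈ cutOff (G := G) B b}.ncard + 1 ≤
      {i | v' (oddIdx i) ∈ cutOff (G := G) B b}.ncard + {i | (f' i).1 ∈ E.touched B b}.ncard +
      ({E.outer} ∩ E.touched B b).ncard at hcount
  change ∀ z ∈ ({Sum.inl i, Sum.inr j} : Set (Fin n ⊕ Fin n)), ∀ b, b ≠ evenVert v v' z →
    evenVert v v' z ∈ cutOff (G := G) B b at hZ
  change ∀ b k, (f' k).1 ∈ E.touched B b → ¬ FlowsTo E.faceOf pF (f i).1 (f' k).1 →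
    ∀ d : G.Dart, E.faceOf d = (f' k).1 → d.fst ∈ cutOff (G := G) B b at hfst
  obtain ⟨a, -, -, ha, -, haf, -⟩ := h.exists_darts (Sum.inl i)
  have hne : ∀ b, (E.touched B b).Nonempty := fun b => ⟨_, a, rfl, Or.inl (Or.inr
    ⟨a.edge_mem, _, Or.inl rfl, mem_edge_iff.2 (Or.inl ha.symm)⟩)⟩
  have hone : ∀ b, ({E.outer} ∩ E.touched B b).ncard ≤ 1 := fun b =>
    (Set.ncard_le_ncard Set.inter_subset_left).trans (Set.ncard_singleton _).le
  have hf'k : ∀ b k, (f' k).1 ∈ E.touched B b →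
      k = j ∨ evenVert v v' (Sum.inr k) ∈ cutOff (G := G) B b := by
    intro b k hk
    by_cases hkQ : FlowsTo E.faceOf pF (f i).1 (f' k).1
    · have h1 := hp.face.flowsTo_sink (notMem_freeFaces j) hkQ hfl
      have h2 := hp.face.eq_of_flowsTo (notMem_freeFaces k) h1
      exact Or.inl (Sum.inr_injective
        (h.evenFace_injective (a₁ := Sum.inr j) (a₂ := Sum.inr k) h2)).symm
    · obtain ⟨d, hd, hd'⟩ := h.onFace' k
      have := hfst b k hk hkQ d hd'
      rw [hd] at this
      exact Or.inr this
  have cardSum : ∀ S T : Set (Fin n),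
      (Sum.inl '' S ∪ Sum.inr '' T : Set (Fin n ⊕ Fin n)).ncard = S.ncard + T.ncard := by
    intro S T
    rw [Set.ncard_union_eq, Set.ncard_image_of_injective _ Sum.inl_injective,
      Set.ncard_image_of_injective _ Sum.inr_injective]
    rw [Set.disjoint_left]
    rintro _ ⟨x, -, rfl⟩ ⟨y, -, hy⟩
    exact absurd hy (by simp)
  have cardIic : ∀ {m : ℕ} (k : Fin m), (Set.Iic k).ncard = k + 1 := fun k => by
    rw [← Finset.coe_Iic, Set.ncard_coe_finset, Fin.card_Iic]
  have cardIci : ∀ {m : ℕ} (k : Fin m), (Set.Ici k).ncard = m - k := fun k => by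
    rw [← Finset.coe_Ici, Set.ncard_coe_finset, Fin.card_Ici]
  have hij : (i : ℕ) ≤ j := by
    have hc := hcount (v (Fin.last _)) (hne _)
    have e0 := hone (v (Fin.last _))
    have e1 : (i : ℕ) + 1 + (j + 1) ≤
        {s | evenVert v v' s ∈ cutOff (G := G) B (v (Fin.last _))}.ncard := by
      rw [← cardIic i, ← cardIic j, ← cardSum]
      refine Set.ncard_le_ncard ?_
      rintro _ (⟨k, hk, rfl⟩ | ⟨k, hk, rfl⟩)
      · rcases (show k ≤ i from hk).eq_or_lt with rfl | hk
        · exact hZ _ (Or.inl rfl) _ (h.odd_left_ne (Fin.last n) _)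
        · intro hl
          exact hS ((hL (evenIdx k) (evenIdx_strictMono hk)).trans hl.symm)
      · rcases (show k ≤ j from hk).eq_or_lt with rfl | hk
        · exact hZ _ (Or.inr rfl) _ (h.odd_left_ne (Fin.last n) _)
        · intro hl
          exact hS ((hL' (evenIdx k) (evenIdx_strictMono hk)).trans hl.symm)
    have e2 : {k : Fin (n + 1) | v' (oddIdx k) ∈ cutOff (G := G) B (v (Fin.last _))}.ncard ≤
        j + 1 := by
      rw [← Fin.val_castSucc j, ← cardIic j.castSucc]
      refine Set.ncard_le_ncard fun k hk => ?_
      by_contra hkj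
      refine hk (hR' _ ?_)
      simp only [Set.mem_Iic, not_le, Fin.lt_def, Fin.val_castSucc] at hkj
      simp only [Fin.lt_def, evenIdx, oddIdx]
      omega
    have e3 : {k | (f' k).1 ∈ E.touched B (v (Fin.last _))}.ncard ≤ j + 1 := by
      rw [← cardIic j]
      refine Set.ncard_le_ncard fun k hk => ?_
      by_contra hkj
      rcases hf'k _ k hk with rfl | hk
      · exact hkj (Set.mem_Iic.2 le_rfl)
      · refine hk (hR' _ ?_)
        simp only [Set.mem_Iic, not_le, Fin.lt_def] at hkj
        simp only [Fin.lt_def, evenIdx]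
        omega
    omega
  have hji : (j : ℕ) ≤ i := by
    have hc := hcount (v 0) (hne _)
    have e0 := hone (v 0)
    have e1 : n - i + (n - j) ≤ {s | evenVert v v' s ∈ cutOff (G := G) B (v 0)}.ncard := by
      rw [← cardIci i, ← cardIci j, ← cardSum]
      refine Set.ncard_le_ncard ?_
      rintro _ (⟨k, hk, rfl⟩ | ⟨k, hk, rfl⟩)
      · rcases (show i ≤ k from hk).eq_or_lt with rfl | hk
        · exact hZ _ (Or.inl rfl) _ (h.odd_left_ne 0 _)
        · intro hl
          exact hS (EdgeLinked.trans hl (hR (evenIdx k) (evenIdx_strictMono hk)).symm)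
      · rcases (show j ≤ k from hk).eq_or_lt with rfl | hk
        · exact hZ _ (Or.inr rfl) _ (h.odd_left_ne 0 _)
        · intro hl
          exact hS (EdgeLinked.trans hl (hR' (evenIdx k) (evenIdx_strictMono hk)).symm)
    have e2 : {k : Fin (n + 1) | v' (oddIdx k) ∈ cutOff (G := G) B (v 0)}.ncard ≤ n - j := by
      rw [← Nat.add_sub_add_right n 1 j, ← Fin.val_succ j, ← cardIci j.succ]
      refine Set.ncard_le_ncard fun k hk => ?_
      by_contra hkj
      refine hk (hL' _ ?_)
      simp only [Set.mem_Ici, not_le, Fin.lt_def, Fin.val_succ] at hkj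
      simp only [Fin.lt_def, evenIdx, oddIdx]
      omega
    have e3 : {k | (f' k).1 ∈ E.touched B (v 0)}.ncard ≤ n - j := by
      rw [← cardIci j]
      refine Set.ncard_le_ncard fun k hk => ?_
      by_contra hkj
      rcases hf'k _ k hk with rfl | hk
      · exact hkj (Set.mem_Ici.2 le_rfl)
      · refine hk (hL' _ ?_)
        simp only [Set.mem_Ici, not_le, Fin.lt_def] at hkj
        simp only [Fin.lt_def, evenIdx]
        omega
    omega
  exact Fin.ext (le_antisymm hij hji)

theorem flowsTo_right [Finite V] (h : E.IsFrame v v' f f') (hp : E.IsPairing v v' f' F pV pF)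
    (i : Fin n) : FlowsTo E.faceOf pF (f i).1 (f' i).1 := by
  obtain ⟨j, hj⟩ := hp.exists_flowsTo_right h i
  have := hp.flowsTo_right_eq h hj
  exact this ▸ hj

/-- The flow from `v_{2k-1}` ends in `v'_{2k-1}`, since it does not cross the flows of faces. -/
theorem flowsTo_root [Finite V] (h : E.IsFrame v v' f f') (hp : E.IsPairing v v' f' F pV pF)
    (k : Fin (n + 1)) :
    FlowsTo (fun d : G.Dart => d.fst) pV (v (oddIdx k)) (v' (oddIdx k)) := by
  obtain ⟨l, hl⟩ := hp.exists_root h (h.odd_left_ne k)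
  have hlink : ∀ i, EdgeLinked (fun d : G.Dart => d.fst) (E.flowCut v v' f pF i i)ᶜ
      (v (oddIdx k)) (v' (oddIdx l)) := fun i =>
    (hl.linked hp.vert).mono fun e he => hp.notMem_cutEdges_of_mem he
  suffices k = l by
    subst this
    exact hl
  rcases lt_trichotomy (k : ℕ) l with hkl | hkl | hkl
  · obtain ⟨-, hR', hL, -, hS⟩ := hp.flowCut_arcs h (hp.flowsTo_right h ⟨k, by omega⟩)
    refine absurd (((hL (oddIdx k) ?_).trans (hlink _)).trans (hR' (oddIdx l) ?_).symm) hS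
    · simp [Fin.lt_def, evenIdx, oddIdx]
    · simp only [Fin.lt_def, evenIdx, oddIdx]
      omega
  · exact Fin.ext hkl
  · obtain ⟨hR, -, -, hL', hS⟩ := hp.flowCut_arcs h (hp.flowsTo_right h ⟨l, by omega⟩)
    refine absurd (((hL' (oddIdx l) ?_).trans (hlink _).symm).trans (hR (oddIdx k) ?_).symm) hS
    · simp [Fin.lt_def, evenIdx, oddIdx]
    · simp only [Fin.lt_def, evenIdx, oddIdx]
      omega

end IsPairing

end PlaneEmbedding

/-! ### Perfect matchings as pairings -/

namespace PlaneEmbedding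

variable {V : Type*} {G : SimpleGraph V} {E : PlaneEmbedding G} {n : ℕ}
  {v v' : Fin (2 * n + 1) → V} {f f' : Fin n → E.BoundedFace} {F : Set (Sym2 V)}
  {pV : V → Sym2 V → Prop} {pF : E.Face → Sym2 V → Prop}

theorem adj_orig_mid {x : V} {e : G.edgeSet} :
    E.dualRefinement.Adj (.orig x) (.mid e) ↔ x ∈ e.1 := by
  simp [dualRefinement]

theorem adj_face_mid {φ : E.BoundedFace} {e : G.edgeSet} :
    E.dualRefinement.Adj (.face φ) (.mid e) ↔ E.EdgeOnFace e.1 φ.1 := by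
  simp [dualRefinement]

theorem exists_mid_of_adj {a b : E.RefVertex} (h : E.dualRefinement.Adj a b) :
    (∃ e, a = .mid e) ∨ ∃ e, b = .mid e := by
  rcases a with x | e | φ <;> rcases b with y | e' | ψ <;> simp_all [dualRefinement]

theorem not_adj_mid_mid {e e' : G.edgeSet} :
    ¬ E.dualRefinement.Adj (.mid e) (.mid e') := by
  simp [dualRefinement]

variable (E) in
/-- The vertices that remain in the dual refinement after the deletions. -/
def remaining (v v' : Fin (2 * n + 1) → V) (f' : Fin n → E.BoundedFace) : Set E.RefVertex :=
  {a | match a with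
    | .orig x => x ∈ freeVerts v v'
    | .mid e => e.1 ∉ evenEdges G v v'
    | .face φ => φ.1 ∈ E.freeFaces f'}

theorem mem_evenVerts {x : V} : x ∈ evenVerts v v' ↔ ∃ s, x = evenVert v v' s := by
  simp only [evenVerts, Set.mem_union, Set.mem_range, Sum.exists, evenVert, Sum.elim_inl,
    Sum.elim_inr, eq_comm]

theorem terminal_oddIdx (i : Fin (n + 1)) : E.terminal v f (oddIdx i) = .orig (v (oddIdx i)) := by
  simp [terminal, oddIdx]

theorem terminal_evenIdx (i : Fin n) : E.terminal v f (evenIdx i) = .face (f i) := by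
  have : (2 * (i : ℕ) + 1) / 2 = i := by omega
  simp [terminal, evenIdx, this]

theorem exists_oddIdx_or_evenIdx (j : Fin (2 * n + 1)) :
    (∃ i, j = oddIdx i) ∨ ∃ i, j = evenIdx i := by
  rcases Nat.even_or_odd' j with ⟨k, hk | hk⟩
  · exact Or.inl ⟨⟨k, by omega⟩, Fin.ext hk⟩
  · exact Or.inr ⟨⟨k, by omega⟩, Fin.ext hk⟩

theorem verts_deleteVerts (h : E.IsFrame v v' f f') :
    ((E.smashed (evenVerts v v')).deleteVerts (Set.range (E.terminal v' f'))).verts =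
      E.remaining v v' f' := by
  ext a
  have hterm : a ∈ Set.range (E.terminal v' f') ↔
      (∃ i : Fin (n + 1), a = .orig (v' (oddIdx i))) ∨ ∃ i, a = .face (f' i) := by
    constructor
    · rintro ⟨j, rfl⟩
      rcases exists_oddIdx_or_evenIdx j with ⟨i, rfl⟩ | ⟨i, rfl⟩
      · exact Or.inl ⟨i, terminal_oddIdx i⟩
      · exact Or.inr ⟨i, terminal_evenIdx i⟩
    · rintro (⟨i, rfl⟩ | ⟨i, rfl⟩)
      · exact ⟨_, terminal_oddIdx i⟩
      · exact ⟨_, terminal_evenIdx i⟩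
  simp only [smashed, SimpleGraph.Subgraph.deleteVerts_verts, SimpleGraph.Subgraph.verts_top,
    Set.mem_sdiff, Set.mem_univ, true_and, hterm, smashedVerts, Set.mem_ofPred_eq, mem_evenVerts]
  rcases a with x | e | φ
  · simp [remaining, freeVerts]
  · simp only [reduceCtorEq, RefVertex.mid.injEq, false_or, exists_false, not_false_eq_true,
      and_true, remaining, Set.mem_ofPred_eq, evenEdges, e.2, true_and]
    refine not_congr ⟨?_, ?_⟩
    · rintro ⟨_, ⟨s, rfl⟩, e', rfl, he, -⟩
      exact ⟨s, he⟩
    · rintro ⟨s, hs⟩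
      refine ⟨_, ⟨s, rfl⟩, e, rfl, hs, ?_⟩
      obtain ⟨d, hd, hd'⟩ := exists_dart_of_mem e.2 hs
      rcases h.sides hd' with ⟨h1, -⟩ | ⟨-, h1⟩
      · exact ⟨d, hd, h1⟩
      · exact ⟨d.symm, by simpa using hd, h1⟩
  · simp [remaining, freeFaces, Subtype.ext_iff, φ.2]

theorem mem_matchingSet (h : E.IsFrame v v' f f') {μ : E.dualRefinement.Subgraph} :
    μ ∈ E.matchingSet v v' f' ↔ μ.verts = E.remaining v v' f' ∧ μ.IsMatching := by
  rw [← verts_deleteVerts h]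
  refine ⟨fun h => h.2, fun hμ => ⟨⟨hμ.1.le, fun a b hab => ?_⟩, hμ⟩⟩
  have ha := hμ.1 ▸ μ.edge_vert hab
  have hb := hμ.1 ▸ μ.edge_vert hab.symm
  have hadj := hab.adj_sub
  simp only [smashed, SimpleGraph.Subgraph.deleteVerts_verts, SimpleGraph.Subgraph.verts_top,
    Set.mem_sdiff, Set.mem_univ, true_and] at ha hb
  simp only [smashed, SimpleGraph.Subgraph.deleteVerts_adj, SimpleGraph.Subgraph.deleteVerts_verts,
    SimpleGraph.Subgraph.verts_top, SimpleGraph.Subgraph.top_adj, Set.mem_sdiff, Set.mem_univ,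
    true_and, hadj, ha, hb, not_false_eq_true]

/-- The vertex `x` is matched with the edge `e`. -/
def vertPairing (μ : E.dualRefinement.Subgraph) (x : V) (e : Sym2 V) : Prop :=
  ∃ he : e ∈ G.edgeSet, μ.Adj (.orig x) (.mid ⟨e, he⟩)

/-- The face `φ` is matched with the edge `e`. -/
def facePairing (μ : E.dualRefinement.Subgraph) (φ : E.Face) (e : Sym2 V) : Prop :=
  ∃ (hφ : φ ≠ E.outer) (he : e ∈ G.edgeSet), μ.Adj (.face ⟨φ, hφ⟩) (.mid ⟨e, he⟩)

/-- The edges matched with a vertex. -/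
def vertEdges (μ : E.dualRefinement.Subgraph) : Set (Sym2 V) :=
  {e | ∃ x, vertPairing μ x e}

theorem isPairing_of_mem (h : E.IsFrame v v' f f') {μ : E.dualRefinement.Subgraph}
    (hμ : μ ∈ E.matchingSet v v' f') :
    E.IsPairing v v' f' (vertEdges μ) (vertPairing μ) (facePairing μ) := by
  obtain ⟨hverts, hm⟩ := (mem_matchingSet h).1 hμ
  have hmem : ∀ {a b}, μ.Adj a b → a ∈ E.remaining v v' f' := fun hab => hverts ▸ μ.edge_vert hab
  have huniq : ∀ {a b c}, μ.Adj a b → μ.Adj a c → b = c := fun hab hac =>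
    (hm (μ.edge_vert hab)).unique hab hac
  have hnotEven : ∀ {x e}, vertPairing μ x e → e ∉ evenEdges G v v' := by
    rintro x e ⟨he, hadj⟩
    exact hmem hadj.symm
  refine ⟨?_, ?_, ⟨?_, ?_, ?_, ?_, ?_, ?_, ?_⟩, ⟨?_, ?_, ?_, ?_, ?_, ?_, ?_⟩⟩
  · rintro e ⟨x, he, -⟩
    exact he
  · rw [Set.disjoint_left]
    rintro e ⟨x, hx⟩
    exact hnotEven hx
  · rintro x e ⟨he, hadj⟩
    exact exists_dart_of_mem he (adj_orig_mid.1 hadj.adj_sub)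
  · rintro x e ⟨he, hadj⟩
    exact hmem hadj
  · intro x e hx
    exact ⟨x, hx⟩
  · intro x hx
    obtain ⟨b, hb, -⟩ := hm (show RefVertex.orig x ∈ μ.verts from hverts ▸ hx)
    rcases exists_mid_of_adj hb.adj_sub with ⟨e, he⟩ | ⟨e, rfl⟩
    · exact absurd he (by simp)
    · exact ⟨e.1, e.2, hb⟩
  · rintro x e e' ⟨he, hadj⟩ ⟨he', hadj'⟩
    simpa using huniq hadj hadj'
  · exact fun hx => hx
  · rintro x y e ⟨he, hadj⟩ ⟨he', hadj'⟩
    simpa using huniq hadj.symm hadj'.symm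
  · rintro x e ⟨hφ, he, hadj⟩
    exact adj_face_mid.1 hadj.adj_sub
  · rintro x e ⟨hφ, he, hadj⟩
    exact hmem hadj
  · rintro x e ⟨hφ, he, hadj⟩
    refine ⟨he, ?_⟩
    rintro (⟨y, he', hadj'⟩ | h')
    · simpa using huniq hadj.symm hadj'.symm
    · exact hmem hadj.symm h'
  · intro φ hφ
    obtain ⟨b, hb, -⟩ := hm (show RefVertex.face ⟨φ, hφ.1⟩ ∈ μ.verts from hverts ▸ hφ)
    rcases exists_mid_of_adj hb.adj_sub with ⟨e, he⟩ | ⟨e, rfl⟩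
    · exact absurd he (by simp)
    · exact ⟨e.1, hφ.1, e.2, hb⟩
  · rintro x e e' ⟨_, he, hadj⟩ ⟨_, he', hadj'⟩
    simpa using huniq hadj hadj'
  · rintro e ⟨he, hne⟩
    obtain ⟨b, hb, -⟩ := hm (show RefVertex.mid ⟨e, he⟩ ∈ μ.verts from
      hverts ▸ fun h' => hne (Or.inr h'))
    rcases b with x | e' | φ
    · exact absurd (Or.inl ⟨x, he, hb.symm⟩) hne
    · exact absurd hb.adj_sub not_adj_mid_mid
    · exact ⟨φ.1, φ.2, he, hb.symm⟩
  · rintro x y e ⟨_, he, hadj⟩ ⟨_, he', hadj'⟩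
    simpa using huniq hadj.symm hadj'.symm

/-- A matching is determined by the edges matched with the vertices and with the faces. -/
theorem eq_of_pairing_eq (h : E.IsFrame v v' f f') {μ μ' : E.dualRefinement.Subgraph}
    (hμ : μ ∈ E.matchingSet v v' f') (hμ' : μ' ∈ E.matchingSet v v' f')
    (hV : vertPairing μ = vertPairing μ') (hF : facePairing μ = facePairing μ') : μ = μ' := by
  have key : ∀ {μ μ' : E.dualRefinement.Subgraph}, vertPairing μ = vertPairing μ' →
      facePairing μ = facePairing μ' → ∀ a e, μ.Adj a (.mid e) → μ'.Adj a (.mid e) := by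
    intro μ μ' hV hF a e hadj
    rcases a with x | e' | φ
    · have : vertPairing μ x e.1 := ⟨e.2, hadj⟩
      rw [hV] at this
      exact this.2
    · exact absurd hadj.adj_sub not_adj_mid_mid
    · have : facePairing μ φ.1 e.1 := ⟨φ.2, e.2, hadj⟩
      rw [hF] at this
      exact this.2.2
  have key' : ∀ {μ μ' : E.dualRefinement.Subgraph}, vertPairing μ = vertPairing μ' →
      facePairing μ = facePairing μ' → ∀ a b, μ.Adj a b → μ'.Adj a b := by
    intro μ μ' hV hF a b hadj
    rcases exists_mid_of_adj hadj.adj_sub with ⟨e, rfl⟩ | ⟨e, rfl⟩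
    · exact (key hV hF _ _ hadj.symm).symm
    · exact key hV hF _ _ hadj
  refine SimpleGraph.Subgraph.ext ?_ ?_
  · rw [((mem_matchingSet h).1 hμ).1, ((mem_matchingSet h).1 hμ').1]
  · ext a b
    exact ⟨key' hV hF a b, key' hV.symm hF.symm a b⟩

/-- The subgraph of the dual refinement made up of the pairs of a pairing. -/
def matchingOfPairing (hp : E.IsPairing v v' f' F pV pF) : E.dualRefinement.Subgraph where
  verts := E.remaining v v' f'
  Adj a b := match a, b with
    | .orig x, .mid e => pV x e.1
    | .mid e, .orig x => pV x e.1
    | .face φ, .mid e => pF φ.1 e.1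
    | .mid e, .face φ => pF φ.1 e.1
    | _, _ => False
  adj_sub := by
    have h1 : ∀ {x} {e : G.edgeSet}, pV x e.1 → x ∈ e.1 := fun hx => by
      obtain ⟨d, hd, rfl⟩ := hp.vert.incident hx
      exact hd ▸ mem_edge_iff.2 (Or.inl rfl)
    intro a b hab
    rcases a with x | e | φ <;> rcases b with y | e' | ψ <;> try exact absurd hab id
    · exact adj_orig_mid.2 (h1 hab)
    · exact (adj_orig_mid.2 (h1 hab)).symm
    · exact (adj_face_mid.2 (hp.face.incident hab)).symm
    · exact adj_face_mid.2 (hp.face.incident hab)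
  edge_vert := by
    intro a b hab
    rcases a with x | e | φ <;> rcases b with y | e' | ψ <;> try exact absurd hab id
    · exact hp.vert.site_mem hab
    · exact Set.disjoint_left.1 hp.disjoint (hp.vert.edge_mem hab)
    · exact fun h' => (hp.face.edge_mem hab).2 (Or.inr h')
    · exact hp.face.site_mem hab
  symm := ⟨by
    intro a b hab
    rcases a with x | e | φ <;> rcases b with y | e' | ψ <;> exact hab⟩

theorem matchingOfPairing_mem (h : E.IsFrame v v' f f') (hp : E.IsPairing v v' f' F pV pF) :
    matchingOfPairing hp ∈ E.matchingSet v v' f' := by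
  refine (mem_matchingSet h).2 ⟨rfl, ?_⟩
  intro a ha
  rcases a with x | e | φ
  · obtain ⟨e, he⟩ := hp.vert.exists_edge ha
    refine ⟨.mid ⟨e, hp.subset (hp.vert.edge_mem he)⟩, he, ?_⟩
    rintro (y | e' | ψ) hb
    · exact absurd hb id
    · exact congrArg RefVertex.mid (Subtype.ext (hp.vert.edge_unique hb he))
    · exact absurd hb id
  · have ha : e.1 ∉ evenEdges G v v' := ha
    by_cases heF : e.1 ∈ F
    · obtain ⟨x, hx⟩ := hp.vert.exists_site heF
      refine ⟨.orig x, hx, ?_⟩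
      rintro (y | e' | ψ) hb
      · exact congrArg RefVertex.orig (hp.vert.site_unique hb hx)
      · exact absurd hb id
      · exact absurd (Or.inl heF) (hp.face.edge_mem hb).2
    · obtain ⟨φ, hφ⟩ := hp.face.exists_site ⟨e.2, fun h' => h'.elim heF ha⟩
      refine ⟨.face ⟨φ, (hp.face.site_mem hφ).1⟩, hφ, ?_⟩
      rintro (y | e' | ψ) hb
      · exact absurd (hp.vert.edge_mem hb) heF
      · exact absurd hb id
      · exact congrArg RefVertex.face (Subtype.ext (hp.face.site_unique hb hφ))
  · obtain ⟨e, he⟩ := hp.face.exists_edge ha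
    refine ⟨.mid ⟨e, (hp.face.edge_mem he).1⟩, he, ?_⟩
    rintro (y | e' | ψ) hb
    · exact absurd hb id
    · exact congrArg RefVertex.mid (Subtype.ext (hp.face.edge_unique hb he))
    · exact absurd hb id

theorem vertEdges_matchingOfPairing (hp : E.IsPairing v v' f' F pV pF) :
    vertEdges (matchingOfPairing hp) = F := by
  ext e
  constructor
  · rintro ⟨x, he, hx⟩
    exact hp.vert.edge_mem (show pV x e from hx)
  · intro he
    obtain ⟨x, hx⟩ := hp.vert.exists_site he
    exact ⟨x, hp.subset he, hx⟩

/-- The forest of a matching: all the vertices that are not smashed, and the edges that are matched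
with vertices. -/
def forestOf (v v' : Fin (2 * n + 1) → V) (μ : E.dualRefinement.Subgraph) : G.Subgraph where
  verts := {x | ∀ s, x ≠ evenVert v v' s}
  Adj x y := G.Adj x y ∧ s(x, y) ∈ vertEdges μ ∧ (∀ s, x ≠ evenVert v v' s) ∧
    ∀ s, y ≠ evenVert v v' s
  adj_sub h := h.1
  edge_vert h := h.2.2.1
  symm := ⟨fun x _ ⟨h₁, h₂, h₃, h₄⟩ => ⟨h₁.symm, Sym2.eq_swap (a := x) ▸ h₂, h₄, h₃⟩⟩

theorem forestOf_edgeSet (h : E.IsFrame v v' f f') {μ : E.dualRefinement.Subgraph}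
    (hμ : μ ∈ E.matchingSet v v' f') : (forestOf v v' μ).edgeSet = vertEdges μ := by
  have hp := isPairing_of_mem h hμ
  ext e
  induction e using Sym2.ind with
  | _ x y =>
    rw [SimpleGraph.Subgraph.mem_edgeSet]
    refine ⟨fun h => h.2.1, fun he => ⟨hp.subset he, he, ?_, ?_⟩⟩ <;> rintro s rfl <;>
      refine Set.disjoint_left.1 hp.disjoint he ⟨hp.subset he, s, ?_⟩
    · exact Sym2.mem_mk_left _ _
    · exact Sym2.mem_mk_right _ _

theorem deleteVerts_evenVerts_verts :
    ((⊤ : G.Subgraph).deleteVerts (evenVerts v v')).verts = {x | ∀ s, x ≠ evenVert v v' s} := by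
  ext x
  simp [mem_evenVerts]

end PlaneEmbedding

/-! ### The forest of a matching -/

section Reachable

variable {V : Type*} {G H : SimpleGraph V}

theorem reachable_iff_linked (hH : H ≤ G) {x y : V} :
    H.Reachable x y ↔ EdgeLinked (fun d : G.Dart => d.fst) H.edgeSet x y := by
  constructor
  · rintro ⟨p⟩
    induction p with
    | nil => exact EdgeLinked.refl _ _ _
    | cons h p ih =>
      exact (linked_dart (fun d : G.Dart => d.fst) (d := ⟨(_, _), hH h⟩)
        (by simpa using h)).trans ih
  · intro h
    refine h.invariant (p := fun y => H.Reachable x y) ?_ (SimpleGraph.Reachable.refl _)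
    intro d hd hx
    exact hx.trans (SimpleGraph.Adj.reachable (show H.Adj d.fst d.snd from hd))

theorem spanningCoe_reachable_iff {F : G.Subgraph} {x y : V} :
    F.spanningCoe.Reachable x y ↔ EdgeLinked (fun d : G.Dart => d.fst) F.edgeSet x y := by
  rw [reachable_iff_linked F.spanningCoe_le]
  rfl

/-- A subgraph is acyclic if each of its edges is a bridge. -/
theorem isAcyclic_of_not_linked {F : G.Subgraph} (h : ∀ d : G.Dart, d.edge ∈ F.edgeSet →
    ¬ EdgeLinked (fun d : G.Dart => d.fst) (F.edgeSet \ {d.edge}) d.fst d.snd) :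
    F.coe.IsAcyclic := by
  refine SimpleGraph.IsAcyclic.embedding F.coeEmbeddingSpanningCoe ?_
  rw [SimpleGraph.isAcyclic_iff_forall_isBridge]
  intro e he
  induction e using Sym2.ind with
  | _ x y =>
    rw [SimpleGraph.isBridge_iff,
      reachable_iff_linked ((SimpleGraph.deleteEdges_le _).trans F.spanningCoe_le),
      SimpleGraph.edgeSet_deleteEdges]
    exact h ⟨(x, y), F.adj_sub he⟩ he

theorem not_linked_of_isAcyclic {F : G.Subgraph} (h : F.coe.IsAcyclic) {d : G.Dart}
    (hd : d.edge ∈ F.edgeSet) :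
    ¬ EdgeLinked (fun d : G.Dart => d.fst) (F.edgeSet \ {d.edge}) d.fst d.snd := by
  intro hl
  have hadj : F.Adj d.fst d.snd := hd
  rw [SimpleGraph.isAcyclic_iff_forall_isBridge] at h
  have hb := h (e := s(⟨d.fst, F.edge_vert hadj⟩, ⟨d.snd, F.edge_vert hadj.symm⟩)) hadj
  rw [SimpleGraph.isBridge_iff] at hb
  have := hl.invariant (p := fun z => ∃ hz : z ∈ F.verts, (F.coe.deleteEdges
    {s(⟨d.fst, F.edge_vert hadj⟩, ⟨d.snd, F.edge_vert hadj.symm⟩)}).Reachable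
      ⟨d.fst, F.edge_vert hadj⟩ ⟨z, hz⟩) (by
    rintro d' ⟨hd', hne⟩ ⟨hz, hr⟩
    have hadj' : F.Adj d'.fst d'.snd := hd'
    refine ⟨F.edge_vert hadj'.symm, hr.trans (SimpleGraph.Adj.reachable ?_)⟩
    rw [SimpleGraph.deleteEdges_adj]
    refine ⟨hadj', fun he => hne ?_⟩
    have := congrArg (Sym2.map Subtype.val) he
    exact this) ⟨F.edge_vert hadj, SimpleGraph.Reachable.refl _⟩
  exact hb this.2

end Reachable

namespace PlaneEmbedding

variable {V : Type*} {G : SimpleGraph V} {E : PlaneEmbedding G} {n : ℕ}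
  {v v' : Fin (2 * n + 1) → V} {f f' : Fin n → E.BoundedFace}

theorem dualForest_adj_mem (h : E.IsFrame v v' f f') {F : G.Subgraph} {φ ψ : E.BoundedFace}
    {d : G.Dart} (h1 : E.faceOf d = φ.1) (h2 : E.faceOf d.symm = ψ.1) (h3 : d.edge ∉ F.edgeSet) :
    d.edge ∈ G.edgeSet \ (F.edgeSet ∪ evenEdges G v v') := by
  refine ⟨d.edge_mem, ?_⟩
  rintro (h4 | h4)
  · exact h3 h4
  · obtain ⟨s, hs⟩ := IsFrame.mem_evenEdges_dart.1 h4
    rcases h.sides_evenEdges hs with ⟨h5, -⟩ | ⟨-, h5⟩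
    · exact φ.2 (h1.symm.trans h5)
    · exact ψ.2 (h2.symm.trans h5)

theorem linked_of_dualForest_reachable (h : E.IsFrame v v' f f') {F : G.Subgraph}
    {φ ψ : E.BoundedFace} (hr : (E.dualForest F).Reachable φ ψ) :
    EdgeLinked E.faceOf (G.edgeSet \ (F.edgeSet ∪ evenEdges G v v')) φ.1 ψ.1 := by
  obtain ⟨p⟩ := hr
  induction p with
  | nil => exact EdgeLinked.refl _ _ _
  | cons hadj p ih =>
    obtain ⟨-, d, h1, h2, h3⟩ := hadj
    refine EdgeLinked.trans (EdgeJoined.linked ⟨d, ?_, h1, h2⟩) ih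
    exact dualForest_adj_mem h h1 h2 h3

theorem dualForest_reachable_of_dart {F : G.Subgraph} {φ ψ : E.BoundedFace}
    {d : G.Dart} (h1 : E.faceOf d = φ.1) (h2 : E.faceOf d.symm = ψ.1) (h3 : d.edge ∉ F.edgeSet) :
    (E.dualForest F).Reachable φ ψ := by
  by_cases hφψ : φ = ψ
  · rw [hφψ]
  · exact SimpleGraph.Adj.reachable ⟨hφψ, d, h1, h2, h3⟩

theorem reachable_of_flowsTo (h : E.IsFrame v v' f f') {μ : E.dualRefinement.Subgraph}
    (hμ : μ ∈ E.matchingSet v v' f') {x y : V}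
    (hxy : FlowsTo (fun d : G.Dart => d.fst) (vertPairing μ) x y) :
    (forestOf v v' μ).spanningCoe.Reachable x y := by
  rw [spanningCoe_reachable_iff, forestOf_edgeSet h hμ]
  exact hxy.linked (isPairing_of_mem h hμ).vert

variable [Finite V]

theorem isSpanningForest_forestOf (h : E.IsFrame v v' f f') {μ : E.dualRefinement.Subgraph}
    (hμ : μ ∈ E.matchingSet v v' f') :
    IsSpanningForest ((⊤ : G.Subgraph).deleteVerts (evenVerts v v')) (forestOf v v' μ) := by
  refine ⟨⟨deleteVerts_evenVerts_verts.ge, ?_⟩, deleteVerts_evenVerts_verts.symm, ?_⟩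
  · rintro x y ⟨hadj, -, hx, hy⟩
    simp only [SimpleGraph.Subgraph.deleteVerts_adj, SimpleGraph.Subgraph.verts_top, Set.mem_univ,
      true_and, SimpleGraph.Subgraph.top_adj, mem_evenVerts, not_exists]
    exact ⟨hx, hy, hadj⟩
  · refine isAcyclic_of_not_linked fun d hd => ?_
    rw [forestOf_edgeSet h hμ] at hd ⊢
    exact (isPairing_of_mem h hμ).not_linked_erase h hd

theorem isRootedAt_forestOf (h : E.IsFrame v v' f f') {μ : E.dualRefinement.Subgraph}
    (hμ : μ ∈ E.matchingSet v v' f') :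
    IsRootedAt (forestOf v v' μ) (fun i : Fin (n + 1) => v' (oddIdx i)) := by
  have hp := isPairing_of_mem h hμ
  refine ⟨fun i s => h.odd_right_ne i s, fun x hx => ?_⟩
  obtain ⟨i, hi⟩ := hp.exists_root h hx
  refine ⟨i, reachable_of_flowsTo h hμ hi, fun j hj => ?_⟩
  have hj := spanningCoe_reachable_iff.1 hj
  rw [forestOf_edgeSet h hμ] at hj
  have h1 := hp.vert.flowsTo_of_linked (root_notMem_freeVerts (v := v) i) hj hi
  have h2 := hp.vert.eq_of_flowsTo (root_notMem_freeVerts (v := v) j) h1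
  exact (IsFrame.oddIdx_injective (h.injective_right h2)).symm

theorem reachable_left_right (h : E.IsFrame v v' f f') {μ : E.dualRefinement.Subgraph}
    (hμ : μ ∈ E.matchingSet v v' f') (i : Fin (n + 1)) :
    (forestOf v v' μ).spanningCoe.Reachable (v (oddIdx i)) (v' (oddIdx i)) :=
  reachable_of_flowsTo h hμ ((isPairing_of_mem h hμ).flowsTo_root h i)

theorem isBanded_forestOf (h : E.IsFrame v v' f f')
    (hodd : E.InCCWOrder ((⊤ : G.Subgraph).deleteVerts (evenVerts v v'))
      (List.ofFn (fun i : Fin (n + 1) => v (oddIdx i)) ++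
        (List.ofFn (fun i : Fin (n + 1) => v' (oddIdx i))).reverse))
    {μ : E.dualRefinement.Subgraph} (hμ : μ ∈ E.matchingSet v v' f') :
    E.IsBanded ((⊤ : G.Subgraph).deleteVerts (evenVerts v v')) (forestOf v v' μ) := by
  refine ⟨n + 1, _, _, hodd, fun i => ⟨h.odd_left_ne i, h.odd_right_ne i,
    reachable_left_right h hμ i⟩, fun x hx => ?_⟩
  obtain ⟨i, hi, huniq⟩ := (isRootedAt_forestOf h hμ).2 x hx
  exact ⟨i, SimpleGraph.Reachable.trans hi (reachable_left_right h hμ i).symm, fun j hj =>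
    huniq j (SimpleGraph.Reachable.trans hj (reachable_left_right h hμ j))⟩

/-- The component of `f_{2i}` in the dual of the forest consists of faces that flow to `f'_{2i}`.
Its only edges to the outer face are those at `v_{2i}` and at `v'_{2i}`: any other one would be
matched, and so would carry the flow to the outer face. -/
theorem sameChannel_forestOf (h : E.IsFrame v v' f f') {μ : E.dualRefinement.Subgraph}
    (hμ : μ ∈ E.matchingSet v v' f') (i : Fin n) :
    E.SameChannel (forestOf v v' μ) (f i) (f' i) := by
  have hp := isPairing_of_mem h hμ
  have hF := forestOf_edgeSet h hμ
  have hne : ∀ {ψ}, FlowsTo E.faceOf (facePairing μ) (f i).1 ψ → ψ ≠ E.outer :=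
    hp.flow_ne_outer (hp.flowsTo_right h i)
  have hreach : ∀ ψ (hψ : ψ ≠ E.outer), FlowsTo E.faceOf (facePairing μ) (f i).1 ψ →
      (E.dualForest (forestOf v v' μ)).Reachable (f i) ⟨ψ, hψ⟩ := by
    intro ψ hψ hfl
    induction hfl with
    | refl => exact SimpleGraph.Reachable.refl _
    | @tail y z hy hs ih =>
      obtain ⟨d, hd, rfl, rfl⟩ := hs
      refine (ih (hne hy)).trans (dualForest_reachable_of_dart rfl rfl ?_)
      rw [hF]
      exact fun h' => (hp.face.edge_mem hd).2 (Or.inl h')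
  have hff' := hp.flowsTo_right h i
  refine ⟨(E.dualForest (forestOf v v' μ)).connectedComponentMk (f i), ?_, rfl, ?_⟩
  · have hset : {φ | φ ∈ ((E.dualForest (forestOf v v' μ)).connectedComponentMk (f i)).supp ∧
        E.JoinedToOuter (forestOf v v' μ) φ} = {f i, f' i} := by
      ext φ
      simp only [Set.mem_ofPred_eq, SimpleGraph.ConnectedComponent.mem_supp_iff,
        SimpleGraph.ConnectedComponent.eq, Set.mem_insert_iff, Set.mem_singleton_iff]
      constructor
      · rintro ⟨hr, d, h1, h2, h3⟩
        have hl := linked_of_dualForest_reachable h hr.symm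
        rw [hF] at hl h3
        have hφ := hp.face.flowsTo_of_linked (notMem_freeFaces i) hl hff'
        have hend : ∀ k, FlowsTo E.faceOf (facePairing μ) (f' k).1 (f' i).1 → k = i := by
          intro k hk
          have := hp.face.eq_of_flowsTo (notMem_freeFaces k) hk
          exact Sum.inr_injective (h.evenFace_injective (a₁ := Sum.inr k) (a₂ := Sum.inr i)
            this.symm)
        by_cases hD : d.edge ∈ evenEdges G v v'
        · obtain ⟨s, hs⟩ := IsFrame.mem_evenEdges_dart.1 hD
          have hφs : φ.1 = E.evenFace f f' s := by
            rcases h.sides_evenEdges hs with ⟨h5, -⟩ | ⟨h5, -⟩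
            · exact absurd (h1.symm.trans h5) φ.2
            · exact h1.symm.trans h5
          rcases s with k | k
          · have hφk : φ = f k := Subtype.ext hφs
            subst hφk
            have := hp.face.flowsTo_sink (notMem_freeFaces i) (hp.flowsTo_right h k) hφ
            exact Or.inl (congrArg f (hend k this))
          · have hφk : φ = f' k := Subtype.ext hφs
            subst hφk
            exact Or.inr (congrArg f' (hend k hφ))
        · obtain ⟨ψ, hψ⟩ := hp.face.exists_site ⟨d.edge_mem, fun h' => h'.elim h3 hD⟩
          exfalso
          rcases hp.face.step_of_mem hψ with ⟨h4, hs⟩ | ⟨h4, hs⟩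
          · rw [h2, ← h4, h1] at hs
            have := hp.face.flowsTo_sink (notMem_freeFaces i) (Relation.ReflTransGen.single hs) hφ
            exact (f' i).2 (hp.face.eq_of_flowsTo outer_notMem_freeFaces this)
          · rw [← h4, h2] at hs
            exact outer_notMem_freeFaces (hs.mem hp.face)
      · have hjoin : ∀ s, E.JoinedToOuter (forestOf v v' μ) (Sum.elim f f' s) := by
          intro s
          obtain ⟨a, b, -, -, hb, -, -, h1, h2, -⟩ := h.exists_darts s
          refine ⟨b, h1, h2, ?_⟩
          rw [hF]
          exact fun h' => Set.disjoint_left.1 hp.disjoint h'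
            (IsFrame.mem_evenEdges_dart.2 ⟨s, Or.inl hb⟩)
        rintro (rfl | rfl)
        · exact ⟨SimpleGraph.Reachable.refl _, hjoin (Sum.inl i)⟩
        · exact ⟨(hreach _ _ hff').symm, hjoin (Sum.inr i)⟩
    unfold IsChannel
    rw [hset]
    refine Set.ncard_pair fun h' => ?_
    exact absurd (h.distinct (a₁ := Sum.inl i) (a₂ := Sum.inr i) h') (by simp)
  · simp only [SimpleGraph.ConnectedComponent.mem_supp_iff, SimpleGraph.ConnectedComponent.eq]
    exact (hreach _ _ hff').symm

theorem forestOf_mem (h : E.IsFrame v v' f f')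
    (hodd : E.InCCWOrder ((⊤ : G.Subgraph).deleteVerts (evenVerts v v'))
      (List.ofFn (fun i : Fin (n + 1) => v (oddIdx i)) ++
        (List.ofFn (fun i : Fin (n + 1) => v' (oddIdx i))).reverse))
    {μ : E.dualRefinement.Subgraph} (hμ : μ ∈ E.matchingSet v v' f') :
    forestOf v v' μ ∈ E.forestSet v v' f f' :=
  ⟨isSpanningForest_forestOf h hμ, isBanded_forestOf h hodd hμ, isRootedAt_forestOf h hμ,
    reachable_left_right h hμ, sameChannel_forestOf h hμ⟩

end PlaneEmbedding

/-! ### The boundary of the infinite face after smashing -/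

theorem sublist_of_strictMono {α : Type*} {l l' : List α} (g : Fin l.length → ℕ)
    (hg : StrictMono g) (hlt : ∀ i, g i < l'.length) (h : ∀ i, l.get i = l'[g i]'(hlt i)) :
    l.Sublist l' :=
  List.sublist_iff_exists_fin_orderEmbedding_get_eq.2
    ⟨OrderEmbedding.ofStrictMono (fun i => ⟨g i, hlt i⟩) hg, h⟩

namespace PlaneEmbedding

section

variable {V : Type*} {G : SimpleGraph V} {E : PlaneEmbedding G}

/-- The successor of `d` in `K` is found by turning clockwise from the successor of `d` in `G`. -/
theorem nextIn_eq {K : G.Subgraph} {d : G.Dart} {k : ℕ}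
    (hk : K.Adj ((E.rot.symm)^[k] (E.facePerm d)).fst ((E.rot.symm)^[k] (E.facePerm d)).snd)
    (hl : ∀ l < k, ¬ K.Adj ((E.rot.symm)^[l] (E.facePerm d)).fst
      ((E.rot.symm)^[l] (E.facePerm d)).snd) :
    E.nextIn K d = (E.rot.symm)^[k] (E.facePerm d) := by
  have hpow : ∀ k, (E.rot⁻¹ ^ (k + 1)) d.symm = (E.rot.symm)^[k] (E.facePerm d) := by
    intro k
    rw [pow_succ, Equiv.Perm.mul_apply, Equiv.Perm.coe_pow]
    rfl
  have h : sInf {k : ℕ | 0 < k ∧ K.Adj ((E.rot⁻¹ ^ k) d.symm).fst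
      ((E.rot⁻¹ ^ k) d.symm).snd} = k + 1 := by
    refine le_antisymm (Nat.sInf_le ⟨k.succ_pos, by rwa [hpow]⟩) ?_
    refine le_csInf ⟨k + 1, k.succ_pos, by rwa [hpow]⟩ ?_
    rintro l ⟨hl0, hladj⟩
    obtain ⟨l, rfl⟩ := Nat.exists_eq_succ_of_ne_zero hl0.ne'
    by_contra hlk
    refine hl l (by omega) ?_
    rwa [← hpow]
  unfold nextIn
  rw [h, hpow]

theorem InCCWOrder.sublist {K : G.Subgraph} {L L' : List V} (h : E.InCCWOrder K L)
    (hL : L'.Sublist L) : E.InCCWOrder K L' :=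
  ⟨h.1.sublist hL, h.2.imp fun _ hd => ⟨hd.1, hd.2.1, hL.trans hd.2.2⟩⟩

theorem rot_symm_fst (d : G.Dart) : (E.rot.symm d).fst = d.fst := by
  have := E.rot_fst (E.rot.symm d)
  rw [Equiv.apply_symm_apply] at this
  exact this.symm

theorem facePerm_symm_eq (d : G.Dart) : E.facePerm d.symm = E.rot.symm d := by
  simp [RotationSystem.facePerm]

end

variable {V : Type*} {G : SimpleGraph V} {E : PlaneEmbedding G} {n : ℕ}
  {v v' : Fin (2 * n + 1) → V} {f f' : Fin n → E.BoundedFace}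

theorem deleteVerts_adj_iff {d : G.Dart} :
    ((⊤ : G.Subgraph).deleteVerts (evenVerts v v')).Adj d.fst d.snd ↔
      d.edge ∉ evenEdges G v v' := by
  rw [IsFrame.mem_evenEdges_dart]
  simp only [SimpleGraph.Subgraph.deleteVerts_adj, SimpleGraph.Subgraph.verts_top, Set.mem_univ,
    true_and, SimpleGraph.Subgraph.top_adj, mem_evenVerts, not_exists, not_or, d.adj, and_true]
  exact forall_and.symm

open Classical in
/-- For a dart `d` of the outer face whose tail is not smashed: the first dart whose ends are both
not smashed, when turning clockwise from `d`, starting with `d` itself. There are at most two darts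
to try, see `IsFrame.corner_notMem`. -/
noncomputable def corner (E : PlaneEmbedding G) (v v' : Fin (2 * n + 1) → V) (d : G.Dart) :
    G.Dart :=
  if d.edge ∈ evenEdges G v v' then E.rot.symm d else d

namespace IsFrame

theorem exists_snd_eq {d : G.Dart} (hd : ∀ s, d.fst ≠ evenVert v v' s)
    (he : d.edge ∈ evenEdges G v v') : ∃ s, d.snd = evenVert v v' s := by
  obtain ⟨s, hs | hs⟩ := mem_evenEdges_dart.1 he
  · exact absurd hs (hd s)
  · exact ⟨s, hs⟩

theorem faceOf_of_snd_eq (h : E.IsFrame v v' f f') {d : G.Dart} (ho : E.faceOf d = E.outer) {s}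
    (hs : d.snd = evenVert v v' s) : E.faceOf d.symm = E.evenFace f f' s := by
  rcases h.sides_evenEdges (Or.inr hs) with ⟨-, h1⟩ | ⟨h1, -⟩
  · exact h1
  · exact absurd (h1.symm.trans ho) (evenFace_ne_outer s)

theorem corner_notMem (h : E.IsFrame v v' f f') {d : G.Dart}
    (hd : ∀ s, d.fst ≠ evenVert v v' s) (ho : E.faceOf d = E.outer) :
    (E.corner v v' d).edge ∉ evenEdges G v v' := by
  unfold corner
  split_ifs with he
  · intro he'
    obtain ⟨s, hs⟩ := exists_snd_eq hd he
    have hd' : ∀ s, (E.rot.symm d).fst ≠ evenVert v v' s := fun s => by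
      rw [rot_symm_fst]
      exact hd s
    obtain ⟨s', hs'⟩ := exists_snd_eq hd' he'
    have h1 : E.faceOf (E.rot.symm d) = E.evenFace f f' s := by
      rw [faceOf_rot_symm, h.faceOf_of_snd_eq ho hs]
    rcases h.sides_evenEdges (Or.inr hs') with ⟨h2, -⟩ | ⟨h2, -⟩
    · exact evenFace_ne_outer s (h1.symm.trans h2)
    · have hss : s = s' := h.evenFace_injective (h1.symm.trans h2)
      subst hss
      have : E.rot.symm d = d := SimpleGraph.Dart.ext _ _ (Prod.ext (rot_symm_fst d)
        (hs'.trans hs.symm))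
      rw [this] at h1
      exact evenFace_ne_outer s (h1.symm.trans ho)
  · exact he

theorem corner_fst (d : G.Dart) : (E.corner v v' d).fst = d.fst := by
  unfold corner
  split_ifs
  · exact rot_symm_fst d
  · rfl

theorem faceOf_corner (h : E.IsFrame v v' f f') {d : G.Dart}
    (ho : E.faceOf d = E.outer) {s} (hs : d.snd = evenVert v v' s) :
    E.faceOf (E.corner v v' d) = E.evenFace f f' s := by
  rw [corner, if_pos (mem_evenEdges_dart.2 ⟨s, Or.inr hs⟩), faceOf_rot_symm,
    h.faceOf_of_snd_eq ho hs]

theorem corner_injective (h : E.IsFrame v v' f f') {d d' : G.Dart}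
    (hd : ∀ s, d.fst ≠ evenVert v v' s) (ho : E.faceOf d = E.outer)
    (hd' : ∀ s, d'.fst ≠ evenVert v v' s) (ho' : E.faceOf d' = E.outer)
    (hdd : E.corner v v' d = E.corner v v' d') : d = d' := by
  by_cases he : d.edge ∈ evenEdges G v v' <;> by_cases he' : d'.edge ∈ evenEdges G v v'
  · rw [corner, corner, if_pos he, if_pos he'] at hdd
    exact E.rot.symm.injective hdd
  · obtain ⟨s, hs⟩ := exists_snd_eq hd he
    have h1 := h.faceOf_corner ho hs
    rw [hdd, corner, if_neg he'] at h1
    exact absurd (h1.symm.trans ho') (evenFace_ne_outer s)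
  · obtain ⟨s, hs⟩ := exists_snd_eq hd' he'
    have h1 := h.faceOf_corner ho' hs
    rw [← hdd, corner, if_neg he] at h1
    exact absurd (h1.symm.trans ho) (evenFace_ne_outer s)
  · rwa [corner, corner, if_neg he, if_neg he'] at hdd

theorem nextIn_of_facePerm_eq (K : G.Subgraph)
    (hK : K = (⊤ : G.Subgraph).deleteVerts (evenVerts v v')) (h : E.IsFrame v v' f f')
    {e d : G.Dart}
    (hd : ∀ s, d.fst ≠ evenVert v v' s) (ho : E.faceOf d = E.outer) (he : E.facePerm e = d) :
    E.nextIn K e = E.corner v v' d := by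
  subst hK he
  have hc := h.corner_notMem hd ho
  unfold corner at hc ⊢
  split_ifs at hc ⊢ with hD
  · refine nextIn_eq (k := 1) (deleteVerts_adj_iff.2 hc) fun l hl => ?_
    obtain rfl : l = 0 := by omega
    exact fun h' => deleteVerts_adj_iff.1 h' hD
  · exact nextIn_eq (k := 0) (deleteVerts_adj_iff.2 hc) (by simp)

theorem nextIn_of_rot_symm_eq (K : G.Subgraph)
    (hK : K = (⊤ : G.Subgraph).deleteVerts (evenVerts v v')) (h : E.IsFrame v v' f f')
    {e d : G.Dart}
    (hd : ∀ s, d.fst ≠ evenVert v v' s) (ho : E.faceOf d = E.outer)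
    (he' : (E.facePerm e).edge ∈ evenEdges G v v') (he : E.rot.symm (E.facePerm e) = d) :
    E.nextIn K e = E.corner v v' d := by
  subst hK he
  have hc := h.corner_notMem hd ho
  unfold corner at hc ⊢
  split_ifs at hc ⊢ with hD
  · refine nextIn_eq (k := 2) (deleteVerts_adj_iff.2 hc) fun l hl => ?_
    obtain rfl | rfl : l = 0 ∨ l = 1 := by omega
    · exact fun h' => deleteVerts_adj_iff.1 h' he'
    · exact fun h' => deleteVerts_adj_iff.1 h' hD
  · refine nextIn_eq (k := 1) (deleteVerts_adj_iff.2 hc) fun l hl => ?_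
    obtain rfl : l = 0 := by omega
    exact fun h' => deleteVerts_adj_iff.1 h' he'

theorem nextIn_of_notMem (K : G.Subgraph)
    (hK : K = (⊤ : G.Subgraph).deleteVerts (evenVerts v v')) {e : G.Dart}
    (he : (E.facePerm e).edge ∉ evenEdges G v v') :
    E.nextIn K e = E.facePerm e := by
  subst hK
  exact nextIn_eq (k := 0) (deleteVerts_adj_iff.2 he) (by simp)

/-- A smashed vertex `z` is bypassed along the boundary of its bounded face. The corners visited on
the way are corners of that face other than the first one. -/
theorem bypass [Finite V] (K : G.Subgraph)
    (hK : K = (⊤ : G.Subgraph).deleteVerts (evenVerts v v')) (h : E.IsFrame v v' f f') {d : G.Dart}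
    (hd : ∀ s, d.fst ≠ evenVert v v' s)
    (ho : E.faceOf d = E.outer) {s} (hs : d.snd = evenVert v v' s) :
    ∃ δ > 0, (E.nextIn K)^[δ] (E.corner v v' d) =
        E.corner v v' (E.facePerm (E.facePerm d)) ∧
      ∀ l, 0 < l → l < δ → E.faceOf ((E.nextIn K)^[l] (E.corner v v' d)) = E.evenFace f f' s ∧
        (E.nextIn K)^[l] (E.corner v v' d) ≠ E.corner v v' d := by
  set g := d.symm with hg
  have hgf : E.faceOf g = E.evenFace f f' s := h.faceOf_of_snd_eq ho hs
  have hgs : g.fst = evenVert v v' s := hs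
  have hdD : d.edge ∈ evenEdges G v v' := mem_evenEdges_dart.2 ⟨s, Or.inr hs⟩
  have hcor : E.corner v v' d = E.facePerm g := by
    rw [corner, if_pos hdD, hg, facePerm_symm_eq]
  have hcK := h.corner_notMem hd ho
  rw [hcor] at hcK ⊢
  set N := Function.minimalPeriod E.facePerm g with hN
  have hNpos : 0 < N := by
    refine Function.minimalPeriod_pos_of_mem_periodicPts ?_
    exact E.facePerm.injective.mem_periodicPts g
  have hinj : ∀ k l, k < N → l < N → E.facePerm^[k] g = E.facePerm^[l] g → k = l :=
    fun k l hk hl hkl => Function.iterate_injOn_Iio_minimalPeriod hk hl hkl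
  have hgD : g.edge ∈ evenEdges G v v' := mem_evenEdges_dart.2 ⟨s, Or.inl hgs⟩
  -- The only smashed darts of this face are `g` and its predecessor.
  have hmem : ∀ l, (E.facePerm^[l] g).edge ∈ evenEdges G v v' →
      E.facePerm^[l] g = g ∨ E.facePerm^[l + 1] g = g := by
    intro l hl
    have hf : E.faceOf (E.facePerm^[l] g) = E.evenFace f f' s := by rw [faceOf_iterate, hgf]
    obtain ⟨s', hs'⟩ := mem_evenEdges_dart.1 hl
    have hss : s' = s := by
      rcases h.sides_evenEdges hs' with ⟨h1, -⟩ | ⟨h1, -⟩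
      · exact absurd (hf.symm.trans h1) (evenFace_ne_outer s)
      · exact h.evenFace_injective (h1.symm.trans hf)
    subst hss
    rcases hs' with hs' | hs'
    · exact Or.inl (h.dart_unique hs' hgs (hf.trans hgf.symm))
    · refine Or.inr (h.dart_unique ?_ hgs ?_)
      · rw [Function.iterate_succ_apply', facePerm_fst, hs']
      · rw [faceOf_iterate]
  have hback : E.facePerm^[N] g = g := Function.iterate_minimalPeriod
  have hN2 : 3 ≤ N := by
    by_contra hlt
    have : N = 1 ∨ N = 2 := by omega
    rcases this with h1 | h1 <;> rw [h1] at hback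
    · have hback : E.facePerm g = g := hback
      rw [hback] at hcK
      exact hcK hgD
    · have hsnd : (E.facePerm g).snd = g.fst := by
        rw [← facePerm_fst]
        exact congrArg (fun d : G.Dart => d.fst) hback
      exact hcK (mem_evenEdges_dart.2 ⟨s, Or.inr (hsnd.trans hgs)⟩)
  have hiter : ∀ l, l + 3 ≤ N → (E.nextIn K)^[l] (E.facePerm g) = E.facePerm^[l + 1] g := by
    intro l
    induction l with
    | zero => intro _; rfl
    | succ l ih =>
      intro hl
      rw [Function.iterate_succ_apply', ih (by omega), nextIn_of_notMem K hK,
        ← Function.iterate_succ_apply' (f := E.facePerm)]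
      rw [← Function.iterate_succ_apply' (f := E.facePerm)]
      intro hD
      rcases hmem _ hD with h1 | h1
      · exact absurd (hinj _ 0 (by omega) hNpos h1) (by omega)
      · exact absurd (hinj _ 0 (by omega) hNpos h1) (by omega)
  refine ⟨N - 2, by omega, ?_, ?_⟩
  · obtain ⟨M, hM⟩ : ∃ M, N = M + 3 := ⟨N - 3, by omega⟩
    have hlast : E.facePerm (E.facePerm^[M + 2] g) = g := by
      rw [← Function.iterate_succ_apply' (f := E.facePerm), show (M + 2).succ = N from hM.symm,
        hback]
    set w := E.facePerm^[M + 2] g with hw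
    have hwsnd : w.snd = evenVert v v' s := by
      rw [← E.facePerm_fst w, hlast, hgs]
    have hwD : w.edge ∈ evenEdges G v v' := mem_evenEdges_dart.2 ⟨s, Or.inr hwsnd⟩
    have hwf : E.faceOf w = E.evenFace f f' s := by rw [hw, faceOf_iterate, hgf]
    have hwsymm : w.symm = E.facePerm d := by
      refine h.dart_unique (s := s) hwsnd (by rw [facePerm_fst, hs]) ?_
      rw [faceOf_facePerm, ho]
      rcases h.sides_evenEdges (Or.inr hwsnd) with ⟨h1, -⟩ | ⟨-, h1⟩
      · exact absurd (hwf.symm.trans h1) (evenFace_ne_outer s)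
      · exact h1
    have hnext : E.rot.symm w = E.facePerm (E.facePerm d) := by
      rw [← facePerm_symm_eq, hwsymm]
    rw [show N - 2 = M + 1 by omega, Function.iterate_succ_apply', hiter M (by omega)]
    refine nextIn_of_rot_symm_eq K hK h ?_ ?_ ?_ ?_
    · intro s'
      rw [facePerm_fst]
      exact h.snd_ne_evenVert (s := s) (by rw [facePerm_fst, hs]) s'
    · rw [faceOf_facePerm, faceOf_facePerm, ho]
    · rw [← Function.iterate_succ_apply' (f := E.facePerm)]
      exact hwD
    · rw [← Function.iterate_succ_apply' (f := E.facePerm)]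
      exact hnext
  · intro l hl0 hl
    rw [hiter l (by omega)]
    refine ⟨by rw [faceOf_iterate, hgf], fun h1 => ?_⟩
    have := hinj (l + 1) 1 (by omega) (by omega) h1
    omega

/-- Between two corners at positions `a < b` of the outer boundary of `G`, the boundary of the
infinite face of `K` does not return to the corner at a position `t`, if `t ≤ a` and `b` is less
than a full turn after `t`. -/
theorem exists_iterate_nextIn [Finite V] (K : G.Subgraph)
    (hK : K = (⊤ : G.Subgraph).deleteVerts (evenVerts v v')) (h : E.IsFrame v v' f f')
    {d₀ : G.Dart} (ho : E.faceOf d₀ = E.outer) {t : ℕ}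
    (ht : ∀ s, (E.facePerm^[t] d₀).fst ≠ evenVert v v' s) {b : ℕ}
    (hb : ∀ s, (E.facePerm^[b] d₀).fst ≠ evenVert v v' s) {a : ℕ} (hta : t ≤ a) (hab : a < b)
    (ha : ∀ s, (E.facePerm^[a] d₀).fst ≠ evenVert v v' s) :
    ∃ δ > 0, (E.nextIn K)^[δ] (E.corner v v' (E.facePerm^[a] d₀)) =
        E.corner v v' (E.facePerm^[b] d₀) ∧
      (b < t + Function.minimalPeriod E.facePerm d₀ → ∀ l, 0 < l → l ≤ δ →
        (E.nextIn K)^[l] (E.corner v v' (E.facePerm^[a] d₀)) ≠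
          E.corner v v' (E.facePerm^[t] d₀)) := by
  set c : ℕ → G.Dart := fun k => E.facePerm^[k] d₀ with hc
  have hface : ∀ k, E.faceOf (c k) = E.outer := fun k => (E.faceOf_iterate d₀ k).trans ho
  have hsucc : ∀ k, E.facePerm (c k) = c (k + 1) := fun k => by
    simp only [hc, Function.iterate_succ_apply']
  -- One step along the boundary, skipping a smashed vertex.
  have hstep : ∀ a, (∀ s, (c a).fst ≠ evenVert v v' s) →
      ∃ a', (a' = a + 1 ∨ (a' = a + 2 ∧ ∃ s, (c (a + 1)).fst = evenVert v v' s)) ∧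
        (∀ s, (c a').fst ≠ evenVert v v' s) ∧
        ∃ δ > 0, (E.nextIn K)^[δ] (E.corner v v' (c a)) = E.corner v v' (c a') ∧
          ∀ l, 0 < l → l < δ →
            (E.nextIn K)^[l] (E.corner v v' (c a)) ≠ E.corner v v' (c t) := by
    intro a ha
    by_cases hD : (c a).edge ∈ evenEdges G v v'
    · obtain ⟨s, hs⟩ := exists_snd_eq ha hD
      obtain ⟨δ, hδ, h1, h2⟩ := h.bypass K hK ha (hface a) hs
      rw [hsucc, hsucc] at h1
      refine ⟨a + 2, Or.inr ⟨rfl, s, ?_⟩, ?_, δ, hδ, h1, fun l hl0 hl hret => ?_⟩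
      · rw [← hsucc, facePerm_fst, hs]
      · intro s'
        rw [← hsucc (a + 1), facePerm_fst]
        exact h.snd_ne_evenVert (s := s) (by rw [← hsucc, facePerm_fst, hs]) s'
      · obtain ⟨h3, h4⟩ := h2 l hl0 hl
        rw [hret] at h3 h4
        -- The corner at `t` would be in the face that is bypassed, so it is the first corner there.
        by_cases hDt : (c t).edge ∈ evenEdges G v v'
        · obtain ⟨s', hs'⟩ := exists_snd_eq ht hDt
          have hss : s' = s := h.evenFace_injective ((h.faceOf_corner (hface t) hs').symm.trans h3)
          subst hss
          refine h4 ?_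
          have : (c t).symm = (c a).symm := h.dart_unique (s := s') hs' hs
            ((h.faceOf_of_snd_eq (hface t) hs').trans (h.faceOf_of_snd_eq (hface a) hs).symm)
          rw [show c t = c a by simpa using congrArg SimpleGraph.Dart.symm this]
        · rw [corner, if_neg hDt] at h3
          exact evenFace_ne_outer s (h3.symm.trans (hface t))
    · have ha' : ∀ s, (c (a + 1)).fst ≠ evenVert v v' s := by
        intro s hs
        rw [← hsucc, facePerm_fst] at hs
        exact hD (mem_evenEdges_dart.2 ⟨s, Or.inr hs⟩)
      refine ⟨a + 1, Or.inl rfl, ha', 1, one_pos, ?_, fun l _ _ => by omega⟩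
      rw [corner, if_neg hD]
      exact h.nextIn_of_facePerm_eq K hK ha' (hface _) (hsucc a)
  have hcorner : ∀ k, t < k → k < t + Function.minimalPeriod E.facePerm d₀ →
      (∀ s, (c k).fst ≠ evenVert v v' s) → E.corner v v' (c k) ≠ E.corner v v' (c t) := by
    intro k htk hk hk' heq
    have h1 := h.corner_injective hk' (hface k) ht (hface t) heq
    have h2 : E.facePerm^[k - t] d₀ = d₀ := by
      refine (E.facePerm.injective.iterate t) ?_
      rw [← Function.iterate_add_apply, show t + (k - t) = k by omega]
      exact h1
    have h3 : Function.IsPeriodicPt E.facePerm (k - t) d₀ := h2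
    have := h3.minimalPeriod_le (by omega)
    omega
  induction hm : b - a using Nat.strong_induction_on generalizing a with
  | _ m ih =>
    obtain ⟨a', ha'1, ha'2, δ, hδ, hδ1, hδ2⟩ := hstep a ha
    have ha'b : a' ≤ b := by
      rcases ha'1 with rfl | ⟨rfl, s, hs⟩
      · omega
      · by_contra hlt
        obtain rfl : b = a + 1 := by omega
        exact hb s hs
    have haa' : a < a' := by rcases ha'1 with rfl | ⟨rfl, -⟩ <;> omega
    have hδ3 : b < t + Function.minimalPeriod E.facePerm d₀ → ∀ l, 0 < l → l ≤ δ →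
        (E.nextIn K)^[l] (E.corner v v' (c a)) ≠ E.corner v v' (c t) := by
      intro hbt l hl0 hl
      rcases hl.eq_or_lt with rfl | hl
      · rw [hδ1]
        exact hcorner a' (by omega) (by omega) ha'2
      · exact hδ2 l hl0 hl
    rcases ha'b.eq_or_lt with rfl | ha'b
    · exact ⟨δ, hδ, hδ1, hδ3⟩
    · obtain ⟨ε, hε, hε1, hε2⟩ := ih (b - a') (by omega) (a := a') (by omega) ha'b ha'2 rfl
      refine ⟨ε + δ, by omega, ?_, fun hbt l hl0 hl => ?_⟩
      · rw [Function.iterate_add_apply]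
        exact (congrArg _ hδ1).trans hε1
      · by_cases hlδ : l ≤ δ
        · exact hδ3 hbt l hl0 hlδ
        · have := hε2 hbt (l - δ) (by omega) (by omega)
          rw [← hδ1, ← Function.iterate_add_apply, show l - δ + δ = l by omega] at this
          exact this

/-- The order of the vertices with odd indices on the boundary of the infinite face is not changed
by the deletion of the smashed vertices: each of these is bypassed along its bounded face. -/
theorem inCCWOrder_odd [Finite V] (h : E.IsFrame v v' f f') :
    E.InCCWOrder ((⊤ : G.Subgraph).deleteVerts (evenVerts v v'))
      (List.ofFn (fun i : Fin (n + 1) => v (oddIdx i)) ++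
        (List.ofFn (fun i : Fin (n + 1) => v' (oddIdx i))).reverse) := by
  set K := (⊤ : G.Subgraph).deleteVerts (evenVerts v v') with hK
  have hofFn : ∀ u : Fin (2 * n + 1) → V,
      (List.ofFn fun i : Fin (n + 1) => u (oddIdx i)).Sublist (List.ofFn u) := by
    intro u
    refine sublist_of_strictMono (fun i => 2 * i) ?_ (fun i => ?_) fun i => ?_
    · intro i j hij
      have : (i : ℕ) < j := hij
      dsimp only
      omega
    · have h1 : (i : ℕ) < n + 1 := i.2.trans_eq List.length_ofFn
      have h2 : (List.ofFn u).length = 2 * n + 1 := List.length_ofFn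
      omega
    · rw [List.get_eq_getElem, List.getElem_ofFn, List.getElem_ofFn]
      rfl
  set L := List.ofFn (fun i : Fin (n + 1) => v (oddIdx i)) ++
    (List.ofFn (fun i : Fin (n + 1) => v' (oddIdx i))).reverse with hL
  have hord : E.InCCWOrder ⊤ L := h.cyc.sublist ((hofFn v).append (hofFn v').reverse)
  have hLmem : ∀ x ∈ L, ∀ s, x ≠ evenVert v v' s := by
    intro x hx s
    rw [hL, List.mem_append, List.mem_reverse, List.mem_ofFn, List.mem_ofFn] at hx
    rcases hx with ⟨i, rfl⟩ | ⟨i, rfl⟩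
    · exact h.odd_left_ne i s
    · exact h.odd_right_ne i s
  have hlen : 0 < L.length := by
    rw [hL, List.length_append, List.length_ofFn]
    omega
  obtain ⟨d₀, hd₀, pos, hanti, hlt, hget⟩ := E.exists_position_of_inCCWOrder hord
  have hodd : ∀ i s, (E.facePerm^[pos i] d₀).fst ≠ evenVert v v' s := fun i s => by
    rw [← hget]
    exact hLmem _ (List.get_mem _ _) s
  -- Start at the last vertex of the list, which has the smallest position.
  set t := pos ⟨L.length - 1, by omega⟩ with ht
  have htle : ∀ i, t ≤ pos i := fun i => hanti.antitone (by
    have := i.2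
    rw [Fin.le_def]
    dsimp only
    omega)
  set m := Function.minimalPeriod E.facePerm d₀ with hm
  have hodd_t : ∀ s, (E.facePerm^[t] d₀).fst ≠ evenVert v v' s := hodd _
  set y₀ := E.corner v v' (E.facePerm^[t] d₀) with hy₀
  have hmpos : 0 < m := lt_of_le_of_lt (Nat.zero_le _) (hlt ⟨L.length - 1, by omega⟩)
  have hper : E.facePerm^[t + m] d₀ = E.facePerm^[t] d₀ := by
    rw [Function.iterate_add_apply, hm, Function.iterate_minimalPeriod]
  have hperiodic : y₀ ∈ Function.periodicPts (E.nextIn K) := by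
    obtain ⟨δ, hδ, h1, -⟩ := h.exists_iterate_nextIn K hK hd₀ hodd_t (b := t + m)
      (by rw [hper]; exact hodd_t) le_rfl (by omega) hodd_t
    rw [hper] at h1
    exact ⟨δ, hδ, h1⟩
  set N := Function.minimalPeriod (E.nextIn K) y₀ with hN
  have hNpos : 0 < N := Function.minimalPeriod_pos_of_mem_periodicPts hperiodic
  have hNlt : ∀ δ, (∀ l, 0 < l → l ≤ δ → (E.nextIn K)^[l] y₀ ≠ y₀) → δ < N := by
    intro δ hδ
    by_contra hle
    exact hδ N hNpos (by omega) Function.iterate_minimalPeriod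
  have htime : ∀ i, ∃ T, T < N ∧ (E.nextIn K)^[T] y₀ = E.corner v v' (E.facePerm^[pos i] d₀) ∧
      ∀ l, 0 < l → l ≤ T → (E.nextIn K)^[l] y₀ ≠ y₀ := by
    intro i
    rcases (htle i).eq_or_lt with heq | hti
    · exact ⟨0, hNpos, by rw [← heq]; rfl, fun l _ _ => by omega⟩
    · obtain ⟨δ, -, h1, h2⟩ := h.exists_iterate_nextIn K hK hd₀ hodd_t (hodd i) le_rfl hti hodd_t
      have h3 := h2 (by have := hlt i; omega)
      exact ⟨δ, hNlt δ h3, h1, h3⟩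
  choose T hTN hT hTret using htime
  have hTanti : StrictAnti T := by
    intro i j hij
    obtain ⟨δ, hδ, h1, h2⟩ := h.exists_iterate_nextIn K hK hd₀ hodd_t (hodd i) (htle j)
      (hanti hij) (hodd j)
    have h2 := h2 (by have := hlt i; omega)
    have h3 : (E.nextIn K)^[δ + T j] y₀ = (E.nextIn K)^[T i] y₀ := by
      rw [Function.iterate_add_apply, hT, h1, hT]
    have h4 : δ + T j < N := hNlt _ fun l hl0 hl => by
      by_cases hlT : l ≤ T j
      · exact hTret j l hl0 hlT
      · have := h2 (l - T j) (by omega) (by omega)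
        rw [← hT, ← Function.iterate_add_apply, show l - T j + T j = l by omega] at this
        exact this
    have : δ + T j = T i := Function.iterate_injOn_Iio_minimalPeriod h4 (hTN i) h3
    omega
  refine ⟨hord.1, y₀, deleteVerts_adj_iff.2 (h.corner_notMem hodd_t
    ((E.faceOf_iterate d₀ t).trans hd₀)), ?_, ?_⟩
  · have hout : E.faceOf (E.facePerm^[t] d₀) = E.outer := (E.faceOf_iterate d₀ t).trans hd₀
    by_cases hD : (E.facePerm^[t] d₀).edge ∈ evenEdges G v v'
    · refine Relation.ReflTransGen.single ⟨(E.facePerm^[t] d₀).symm, ?_, ?_, ?_⟩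
      · rw [hy₀, corner, if_pos hD, faceOf_rot_symm]
      · rw [SimpleGraph.Dart.symm_symm, hout]
      · intro hadj
        exact deleteVerts_adj_iff.1 hadj (by simpa using hD)
    · rw [hy₀, corner, if_neg hD, hout]
      exact Relation.ReflTransGen.refl
  · have hblen : (E.boundaryList K y₀).reverse.length = N := by
      simp [boundaryList, hN]
    refine sublist_of_strictMono (fun i => N - 1 - T i) ?_ (fun i => ?_) fun i => ?_
    · intro i j hij
      have h1 := hTanti hij
      have h2 := hTN i
      dsimp only
      omega
    · rw [hblen]
      omega
    · have h2 := hTN i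
      simp only [List.getElem_reverse, boundaryList, List.getElem_map, List.getElem_range,
        List.length_map, List.length_range]
      rw [← hN, show N - 1 - (N - 1 - T i) = T i by omega, hT, corner_fst, ← hget i]

end IsFrame

end PlaneEmbedding

/-! ### The matching of a forest -/

section Flow

variable {V X : Type*} {G : SimpleGraph V} {t : G.Dart → X} {U : Set X} {A : Set (Sym2 V)}

/-- If every site is linked by `A` to a site outside `U`, then there is a height function for which
every site in `U` has a lower neighbour along an edge in `A`. -/
theorem exists_height (hlink : ∀ x, ∃ y ∉ U, EdgeLinked t A x y) :
    ∃ ρ : X → ℕ, ∀ x ∈ U, ∃ d : G.Dart, d.edge ∈ A ∧ t d = x ∧ ρ (t d.symm) < ρ x := by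
  let L : ℕ → Set X := fun k => Nat.rec Uᶜ
    (fun _ S => {x | ∃ d : G.Dart, d.edge ∈ A ∧ t d = x ∧ t d.symm ∈ S}) k
  have hL : ∀ x, ∃ k, x ∈ L k := by
    intro x
    obtain ⟨y, hy, hxy⟩ := hlink x
    induction hxy using Relation.ReflTransGen.head_induction_on with
    | refl => exact ⟨0, hy⟩
    | head h _ ih =>
      obtain ⟨k, hk⟩ := ih
      obtain ⟨d, hd, rfl, rfl⟩ := h
      exact ⟨k + 1, d, hd, rfl, hk⟩
  refine ⟨fun x => sInf {k | x ∈ L k}, fun x hx => ?_⟩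
  have hspec : x ∈ L (sInf {k | x ∈ L k}) := Nat.sInf_mem (hL x)
  rcases hk : sInf {k | x ∈ L k} with _ | k
  · rw [hk] at hspec
    exact absurd hx hspec
  · rw [hk] at hspec
    obtain ⟨d, hd, hdx, hk'⟩ := hspec
    exact ⟨d, hd, hdx, (Nat.lt_succ_of_le (Nat.sInf_le hk')).trans_eq hk.symm⟩

/-- If every site is linked by `A` to a site outside `U`, and there are at most as many edges in
`A` as sites in `U`, then there is a perfect matching: each site takes an edge leading down. -/
theorem exists_isMatchingOn [Finite V] (hlink : ∀ x, ∃ y ∉ U, EdgeLinked t A x y)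
    (hcard : A.ncard ≤ U.ncard) : ∃ p, IsMatchingOn t U A p := by
  obtain ⟨ρ, hρ⟩ := exists_height hlink
  choose d hdA hdt hdρ using hρ
  have hinj : Function.Injective (fun u : U => (⟨(d u.1 u.2).edge, hdA u.1 u.2⟩ : A)) := by
    rintro ⟨x, hx⟩ ⟨y, hy⟩ hxy
    have he : (d x hx).edge = (d y hy).edge := congrArg Subtype.val hxy
    rcases (SimpleGraph.dart_edge_eq_iff _ _).1 he with he | he
    · exact Subtype.ext ((hdt x hx).symm.trans ((congrArg t he).trans (hdt y hy)))
    · exfalso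
      have h1 := hdρ x hx
      have h2 := hdρ y hy
      rw [he, SimpleGraph.Dart.symm_symm, hdt] at h1
      rw [← he, hdt] at h2
      exact lt_asymm h1 h2
  have hsurj := (hinj.bijective_of_nat_card_le (by simpa using hcard)).2
  refine ⟨fun x e => ∃ hx : x ∈ U, (d x hx).edge = e, ?_, ?_, ?_, ?_, ?_, ?_, ?_⟩
  · rintro x _ ⟨hx, rfl⟩
    exact ⟨_, rfl, hdt x hx⟩
  · rintro x _ ⟨hx, -⟩
    exact hx
  · rintro x _ ⟨hx, rfl⟩
    exact hdA x hx
  · intro x hx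
    exact ⟨_, hx, rfl⟩
  · rintro x _ _ ⟨_, rfl⟩ ⟨_, rfl⟩
    rfl
  · intro e he
    obtain ⟨⟨x, hx⟩, hxe⟩ := hsurj ⟨e, he⟩
    exact ⟨x, hx, congrArg Subtype.val hxe⟩
  · rintro x y _ ⟨hx, rfl⟩ ⟨hy, hxy⟩
    exact (congrArg Subtype.val (hinj (a₁ := ⟨y, hy⟩) (a₂ := ⟨x, hx⟩) (Subtype.ext hxy))).symm

end Flow

namespace PlaneEmbedding

variable {V : Type*} {G : SimpleGraph V} {E : PlaneEmbedding G} {n : ℕ}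
  {v v' : Fin (2 * n + 1) → V} {f f' : Fin n → E.BoundedFace} {F : G.Subgraph}

theorem verts_of_mem_forestSet (hF : F ∈ E.forestSet v v' f f') :
    F.verts = {x | ∀ s, x ≠ evenVert v v' s} :=
  hF.1.2.1.trans deleteVerts_evenVerts_verts

theorem fst_ne_of_mem_forestSet (hF : F ∈ E.forestSet v v' f f') {d : G.Dart}
    (hd : d.edge ∈ F.edgeSet) (s) : d.fst ≠ evenVert v v' s := by
  have h1 : d.fst ∈ F.verts := F.edge_vert (w := d.snd) hd
  rw [verts_of_mem_forestSet hF] at h1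
  exact h1 s

theorem disjoint_of_mem_forestSet (hF : F ∈ E.forestSet v v' f f') :
    Disjoint F.edgeSet (evenEdges G v v') := by
  rw [Set.disjoint_left]
  intro e he he'
  obtain ⟨d, rfl⟩ := exists_dart_of_edge he'.1
  obtain ⟨s, hs | hs⟩ := IsFrame.mem_evenEdges_dart.1 he'
  · exact fst_ne_of_mem_forestSet hF he s hs
  · exact fst_ne_of_mem_forestSet hF (d := d.symm) (by simpa using he) s hs

theorem exists_root_of_mem_forestSet (hF : F ∈ E.forestSet v v' f f') {x : V}
    (hx : ∀ s, x ≠ evenVert v v' s) : ∃ i : Fin (n + 1),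
      EdgeLinked (fun d : G.Dart => d.fst) F.edgeSet x (v' (oddIdx i)) := by
  obtain ⟨i, hi, -⟩ := hF.2.2.1.2 x ((verts_of_mem_forestSet hF).symm ▸ hx)
  exact ⟨i, spanningCoe_reachable_iff.1 hi⟩

/-- The components of the forest: the smashed vertices, and one component for each root. -/
theorem numClasses_of_mem_forestSet (h : E.IsFrame v v' f f') (hF : F ∈ E.forestSet v v' f f') :
    numClasses (fun d : G.Dart => d.fst) F.edgeSet = 3 * n + 1 := by
  have heven : ∀ s y, EdgeLinked (fun d : G.Dart => d.fst) F.edgeSet (evenVert v v' s) y →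
      y = evenVert v v' s := by
    intro s y hl
    exact hl.invariant (p := fun y => y = evenVert v v' s)
      (fun d hd hs => absurd hs (fst_ne_of_mem_forestSet hF hd s)) rfl
  let k : Fin (n + 1) ⊕ (Fin n ⊕ Fin n) →
      Quot (EdgeJoined (fun d : G.Dart => d.fst) F.edgeSet) := fun a =>
    Quot.mk _ (Sum.elim (fun i => v' (oddIdx i)) (evenVert v v') a)
  have hk : Function.Bijective k := by
    constructor
    · rintro (i | s) (j | s') hij
      · have hl := spanningCoe_reachable_iff.2 (quot_mk_joined_eq.1 hij)
        have huniq := (hF.2.2.1.2 _ (hF.2.2.1.1 i)).unique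
          (SimpleGraph.Reachable.refl _) hl
        exact congrArg Sum.inl huniq
      · exact absurd (heven s' _ (quot_mk_joined_eq.1 hij).symm) (h.odd_right_ne i s')
      · exact absurd (heven s _ (quot_mk_joined_eq.1 hij)) (h.odd_right_ne j s)
      · exact congrArg Sum.inr (h.evenVert_injective (heven s _ (quot_mk_joined_eq.1 hij))).symm
    · rintro ⟨x⟩
      by_cases hx : ∃ s, x = evenVert v v' s
      · obtain ⟨s, rfl⟩ := hx
        exact ⟨Sum.inr s, rfl⟩
      · obtain ⟨i, hi⟩ := exists_root_of_mem_forestSet hF (not_exists.1 hx)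
        exact ⟨Sum.inl i, quot_mk_joined_eq.2 hi.symm⟩
  unfold numClasses
  rw [← Nat.card_eq_of_bijective k hk]
  simp only [Nat.card_eq_fintype_card, Fintype.card_sum, Fintype.card_fin]
  omega

variable [Finite V]

/-- The dual of the complement of the forest is connected, since the forest has no cycles. -/
theorem linked_compl_of_mem_forestSet (hF : F ∈ E.forestSet v v' f f') (φ ψ : E.Face) :
    EdgeLinked E.faceOf F.edgeSetᶜ φ ψ := by
  refine (E.linked_faceOf_edgeSet φ ψ).invariant
    (p := fun ψ => EdgeLinked E.faceOf F.edgeSetᶜ φ ψ) (fun d _ hφ => hφ.trans ?_)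
    (EdgeLinked.refl _ _ _)
  by_cases hd : d.edge ∈ F.edgeSet
  · have := not_linked_of_isAcyclic hF.1.2.2 hd
    rw [E.linked_fst_iff_not_linked_faceOf (Set.sdiff_subset.trans F.edgeSet_subset) (by simp),
      Set.insert_sdiff_singleton, Set.insert_eq_of_mem hd, not_not] at this
    exact this
  · exact linked_dart E.faceOf hd

/-- Every face is linked to the outer face or to one of the `f'_{2i}` without crossing the forest
and the edges at smashed vertices: a walk that would cross an edge at `v_{2i}` can be diverted
through the channel. -/
theorem exists_sink_of_mem_forestSet (h : E.IsFrame v v' f f') (hF : F ∈ E.forestSet v v' f f')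
    (φ : E.Face) : ∃ ψ ∉ E.freeFaces f',
      EdgeLinked E.faceOf (G.edgeSet \ (F.edgeSet ∪ evenEdges G v v')) φ ψ := by
  refine (linked_compl_of_mem_forestSet hF E.outer φ).invariant
    (p := fun φ => ∃ ψ ∉ E.freeFaces f',
      EdgeLinked E.faceOf (G.edgeSet \ (F.edgeSet ∪ evenEdges G v v')) φ ψ) ?_
    ⟨E.outer, outer_notMem_freeFaces, EdgeLinked.refl _ _ _⟩
  rintro d hd ⟨ψ, hψ, hl⟩
  by_cases hD : d.edge ∈ evenEdges G v v'
  · obtain ⟨s, hs⟩ := IsFrame.mem_evenEdges_dart.1 hD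
    rcases h.sides_evenEdges hs with ⟨-, h1⟩ | ⟨-, h1⟩
    · rw [h1]
      rcases s with i | i
      · obtain ⟨T, -, h2, h3⟩ := hF.2.2.2.2 i
        refine ⟨(f' i).1, notMem_freeFaces i, linked_of_dualForest_reachable h ?_⟩
        exact SimpleGraph.ConnectedComponent.exact (h2.trans h3.symm)
      · exact ⟨(f' i).1, notMem_freeFaces i, EdgeLinked.refl _ _ _⟩
    · exact ⟨E.outer, outer_notMem_freeFaces, h1 ▸ EdgeLinked.refl _ _ _⟩
  · exact ⟨ψ, hψ, (linked_dart E.faceOf (A := G.edgeSet \ (F.edgeSet ∪ evenEdges G v v'))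
      ⟨d.edge_mem, fun h' => h'.elim hd hD⟩).symm.trans hl⟩

theorem card_le_freeVerts_add (v v' : Fin (2 * n + 1) → V) :
    Nat.card V ≤ (freeVerts v v').ncard + (3 * n + 1) := by
  have h1 : (freeVerts v v')ᶜ ⊆
      Set.range (Sum.elim (fun i : Fin (n + 1) => v' (oddIdx i)) (evenVert v v')) := by
    intro x hx
    by_contra hx'
    refine hx ⟨fun s hs => hx' ⟨Sum.inr s, hs.symm⟩, fun i hi => hx' ⟨Sum.inl i, hi.symm⟩⟩
  have h2 := Set.ncard_le_ncard h1
  have h3 := Set.ncard_add_ncard_compl (freeVerts v v')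
  have h4 := Finite.card_range_le
    (Sum.elim (fun i : Fin (n + 1) => v' (oddIdx i)) (evenVert v v'))
  simp only [Nat.card_eq_fintype_card (α := _ ⊕ _), Fintype.card_sum, Fintype.card_fin,
    Nat.card_coe_set_eq] at h4
  omega

theorem card_le_freeFaces_add (f' : Fin n → E.BoundedFace) :
    Nat.card E.Face ≤ (E.freeFaces f').ncard + (n + 1) := by
  have h1 : (E.freeFaces f')ᶜ ⊆
      Set.range (fun o : Option (Fin n) => o.elim E.outer fun i => (f' i).1) := by
    intro x hx
    by_contra hx'
    refine hx ⟨fun hs => hx' ⟨none, hs.symm⟩, fun i hi => hx' ⟨some i, hi.symm⟩⟩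
  have h2 := Set.ncard_le_ncard h1
  have h3 := Set.ncard_add_ncard_compl (E.freeFaces f')
  have h4 := Finite.card_range_le (fun o : Option (Fin n) => o.elim E.outer fun i => (f' i).1)
  simp only [Nat.card_eq_fintype_card (α := Option _), Fintype.card_option, Fintype.card_fin,
    Nat.card_coe_set_eq] at h4
  omega

/-- The edges of a forest can be matched with vertices, and the other edges with faces: by Euler's
formula, the numbers agree. -/
theorem exists_isPairing (h : E.IsFrame v v' f f') (hF : F ∈ E.forestSet v v' f f') :
    ∃ pV pF, E.IsPairing v v' f' F.edgeSet pV pF := by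
  have hsub := F.edgeSet_subset
  have hdisj := disjoint_of_mem_forestSet hF
  have e1 := E.euler_of_subset hsub
  rw [numClasses_of_mem_forestSet h hF,
    numClasses_eq_one (linked_compl_of_mem_forestSet hF)] at e1
  have e2 := E.euler_of_subset (A := G.edgeSet) le_rfl
  rw [E.numClasses_fst_edgeSet,
    numClasses_of_forall_notMem E.faceOf (A := G.edgeSetᶜ) (fun e he he' => he' he)] at e2
  have e3 := card_le_freeVerts_add v v'
  have e4 := E.card_le_freeFaces_add f'
  have e5 : 4 * n ≤ (evenEdges G v v').ncard := by
    obtain ⟨g, hg, hg', -⟩ := h.exists_evenEdges_embedding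
    have := Nat.card_le_card_of_injective
      (fun p => (⟨g p, (hg' p.1 p.2).1, p.1, (hg' p.1 p.2).2⟩ : evenEdges G v v'))
      (fun p q hpq => hg (congrArg Subtype.val hpq))
    simp only [Nat.card_eq_fintype_card (α := _ × _), Fintype.card_prod, Fintype.card_sum,
      Fintype.card_fin, Fintype.card_bool, Nat.card_coe_set_eq] at this
    omega
  have e6 : (F.edgeSet ∪ evenEdges G v v').ncard = F.edgeSet.ncard + (evenEdges G v v').ncard :=
    Set.ncard_union_eq hdisj
  have e7 : (G.edgeSet \ (F.edgeSet ∪ evenEdges G v v')).ncard +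
      (F.edgeSet ∪ evenEdges G v v').ncard = G.edgeSet.ncard :=
    Set.ncard_sdiff_add_ncard_of_subset (Set.union_subset hsub fun e he => he.1)
  obtain ⟨pV, hpV⟩ := exists_isMatchingOn (t := fun d : G.Dart => d.fst) (U := freeVerts v v')
    (A := F.edgeSet) (by
      intro x
      by_cases hx : ∃ s, x = evenVert v v' s
      · obtain ⟨s, rfl⟩ := hx
        exact ⟨_, fun h' => h'.1 s rfl, EdgeLinked.refl _ _ _⟩
      · obtain ⟨i, hi⟩ := exists_root_of_mem_forestSet hF (not_exists.1 hx)
        exact ⟨_, root_notMem_freeVerts i, hi⟩) (by omega)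
  obtain ⟨pF, hpF⟩ := exists_isMatchingOn (t := E.faceOf) (U := E.freeFaces f')
    (A := G.edgeSet \ (F.edgeSet ∪ evenEdges G v v')) (exists_sink_of_mem_forestSet h hF)
    (by omega)
  exact ⟨pV, pF, hsub, hdisj, hpV, hpF⟩

theorem exists_forestOf_eq (h : E.IsFrame v v' f f') (hF : F ∈ E.forestSet v v' f f') :
    ∃ μ ∈ E.matchingSet v v' f', forestOf v v' μ = F := by
  obtain ⟨pV, pF, hp⟩ := exists_isPairing h hF
  have hμ := matchingOfPairing_mem h hp
  refine ⟨matchingOfPairing hp, hμ, ?_⟩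
  have hedge := forestOf_edgeSet h hμ
  rw [vertEdges_matchingOfPairing] at hedge
  refine SimpleGraph.Subgraph.ext (verts_of_mem_forestSet hF).symm ?_
  ext x y
  rw [← SimpleGraph.Subgraph.mem_edgeSet, hedge, SimpleGraph.Subgraph.mem_edgeSet]

end PlaneEmbedding

/-! ### The matching is determined by its forest -/

section Flow

variable {V X : Type*} {G : SimpleGraph V} {t : G.Dart → X} {U : Set X} {A : Set (Sym2 V)}
  {p p' : X → Sym2 V → Prop} {x y : X}

theorem IsMatchingOn.fst_or_snd_of_mem (hm : IsMatchingOn t U A p) {d : G.Dart}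
    (hd : d.edge ∈ A) : p (t d) d.edge ∨ p (t d.symm) d.edge := by
  obtain ⟨z, hz⟩ := hm.exists_site hd
  rcases hm.step_of_mem hz with ⟨rfl, -⟩ | ⟨rfl, -⟩
  · exact Or.inl hz
  · exact Or.inr hz

/-- A matching in which every site flows to a sink is the only one: going backwards along the flow,
the partner of each site is forced. -/
theorem IsMatchingOn.unique (hm : IsMatchingOn t U A p) (hm' : IsMatchingOn t U A p')
    (hsink : ∀ x, ∃ y ∉ U, FlowsTo t p x y) : p = p' := by
  have key : ∀ x e, p x e ↔ p' x e := by
    intro x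
    obtain ⟨y, hy, hxy⟩ := hsink x
    induction hxy using Relation.ReflTransGen.head_induction_on with
    | refl =>
      exact fun e =>
        ⟨fun h => absurd (hm.site_mem h) hy, fun h => absurd (hm'.site_mem h) hy⟩
    | head h _ ih =>
      obtain ⟨d, hd, rfl, rfl⟩ := h
      have hd' : p' (t d) d.edge := by
        rcases hm'.fst_or_snd_of_mem (hm.edge_mem hd) with h | h
        · exact h
        · rwa [hm.site_unique hd ((ih _).2 h)]
      intro e
      constructor
      · intro h
        rwa [hm.edge_unique h hd]
      · intro h
        rwa [hm'.edge_unique h hd']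
  ext x e
  exact key x e

/-- There is no way back along a flow that ends at a sink. -/
theorem IsMatchingOn.not_flowsTo_of_step (hm : IsMatchingOn t U A p) {z : X} (hz : z ∉ U)
    (h : FlowsTo t p y z) (hxy : Step t p x y) : ¬ FlowsTo t p y x := by
  induction h using Relation.ReflTransGen.head_induction_on generalizing x with
  | refl =>
    intro h
    rw [hm.eq_of_flowsTo hz h] at hxy
    exact hz (hxy.mem hm)
  | head h _ ih =>
    intro hyx
    refine ih h ?_
    rcases Relation.ReflTransGen.cases_head hyx with rfl | ⟨w, hw, hwx⟩
    · rw [hm.step_unique h hxy]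
      exact Relation.ReflTransGen.refl
    · rw [hm.step_unique h hw]
      exact Relation.ReflTransGen.tail hwx hxy

/-- If the edges joining the consecutive sites of a chain that ends at a sink all have partners,
then each is matched with the site before it. -/
theorem IsMatchingOn.of_chain (hm : IsMatchingOn t U A p) {m : ℕ} {σ : ℕ → X} {e : ℕ → Sym2 V}
    (hinc : ∀ l < m, ∃ d : G.Dart, d.edge = e l ∧ t d = σ l ∧ t d.symm = σ (l + 1))
    (hA : ∀ l < m, e l ∈ A) (hne : ∀ l, l + 1 < m → e l ≠ e (l + 1)) (hend : σ m ∉ U) :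
    ∀ l < m, p (σ l) (e l) := by
  suffices ∀ k l, l + k + 1 = m → p (σ l) (e l) from
    fun l hl => this (m - l - 1) l (by omega)
  intro k
  induction k with
  | zero =>
    rintro l rfl
    obtain ⟨d, hd, h1, h2⟩ := hinc l (by omega)
    have hdA : d.edge ∈ A := hd ▸ hA l (by omega)
    rcases hm.fst_or_snd_of_mem hdA with h | h
    · rwa [hd, h1] at h
    · rw [h2] at h
      exact absurd (hm.site_mem h) hend
  | succ k ih =>
    intro l hl
    obtain ⟨d, hd, h1, h2⟩ := hinc l (by omega)
    have hdA : d.edge ∈ A := hd ▸ hA l (by omega)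
    rcases hm.fst_or_snd_of_mem hdA with h | h
    · rwa [hd, h1] at h
    · rw [h2, hd] at h
      exact absurd (hm.edge_unique h (ih (l + 1) (by omega))) (hne l (by omega))

end Flow

section Orientation

variable {V : Type*} {G H : SimpleGraph V} {U : Set V} {p : V → Sym2 V → Prop} {x y z : V}

/-- Along a path that ends at a sink, every vertex is matched with the edge that follows it. -/
theorem IsMatchingOn.of_isPath (hH : H ≤ G)
    (hm : IsMatchingOn (fun d : G.Dart => d.fst) U H.edgeSet p) (hz : z ∉ U) (q : H.Walk y z)
    (hxy : H.Adj x y) (hq : (SimpleGraph.Walk.cons hxy q).IsPath) : p x s(x, y) := by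
  induction q generalizing x with
  | nil =>
    rcases hm.fst_or_snd_of_mem (d := ⟨(_, _), hH hxy⟩) hxy with h | h
    · exact h
    · exact absurd (hm.site_mem h) hz
  | @cons y w z h' q ih =>
    have hpath := (SimpleGraph.Walk.cons_isPath_iff _ _).1 hq
    have hyw := ih hz h' hpath.1
    rcases hm.fst_or_snd_of_mem (d := ⟨(_, _), hH hxy⟩) hxy with h | h
    · exact h
    · exfalso
      have he : s(x, y) = s(y, w) := hm.edge_unique h hyw
      have hxw : x = w := by
        rcases Sym2.eq_iff.1 he with ⟨h1, h2⟩ | ⟨h1, -⟩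
        · exact h1.trans h2
        · exact h1
      refine hpath.2 ?_
      rw [hxw, SimpleGraph.Walk.support_cons]
      exact List.mem_cons_of_mem _ (SimpleGraph.Walk.start_mem_support _)

theorem IsMatchingOn.adj_of_step (hm : IsMatchingOn (fun d : G.Dart => d.fst) U H.edgeSet p)
    (h : Step (fun d : G.Dart => d.fst) p x y) : H.Adj x y := by
  obtain ⟨d, hd, rfl, rfl⟩ := h
  exact hm.edge_mem hd

theorem IsMatchingOn.exists_isPath (hm : IsMatchingOn (fun d : G.Dart => d.fst) U H.edgeSet p)
    (hz : z ∉ U) (h : FlowsTo (fun d : G.Dart => d.fst) p y z) :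
    ∃ q : H.Walk y z, q.IsPath ∧
      ∀ w ∈ q.support, FlowsTo (fun d : G.Dart => d.fst) p y w := by
  induction h using Relation.ReflTransGen.head_induction_on with
  | refl => exact ⟨.nil, .nil, by simp [FlowsTo, Relation.ReflTransGen.refl]⟩
  | head h hfl ih =>
    obtain ⟨q, hq, hqs⟩ := ih
    refine ⟨.cons (hm.adj_of_step h) q, ?_, ?_⟩
    · rw [SimpleGraph.Walk.cons_isPath_iff]
      exact ⟨hq, fun h' => hm.not_flowsTo_of_step hz hfl h (hqs _ h')⟩
    · intro w hw
      rw [SimpleGraph.Walk.support_cons, List.mem_cons] at hw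
      rcases hw with rfl | hw
      · exact Relation.ReflTransGen.refl
      · exact Relation.ReflTransGen.head h (hqs w hw)

end Orientation

namespace PlaneEmbedding

variable {V : Type*} {G : SimpleGraph V} {E : PlaneEmbedding G} {n : ℕ}
  {v v' : Fin (2 * n + 1) → V} {f f' : Fin n → E.BoundedFace} {μ : E.dualRefinement.Subgraph}

theorem vertPairing_dart {d : G.Dart} :
    vertPairing μ d.fst d.edge ↔ μ.Adj (.orig d.fst) (.mid ⟨d.edge, d.edge_mem⟩) :=
  ⟨fun ⟨_, h⟩ => h, fun h => ⟨_, h⟩⟩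

/-- Only the half-edges in a matching contribute to its weight, one for each edge of the forest. -/
theorem subgraphWeight_forestOf {R : Type*} [CommMonoid R] (h : E.IsFrame v v' f f')
    (hμ : μ ∈ E.matchingSet v v' f') (w : Sym2 V → R) :
    subgraphWeight w (forestOf v v' μ) = subgraphWeight (E.refWeight w) μ := by
  have hp := isPairing_of_mem h hμ
  let T : Set (V × G.edgeSet) := {q | μ.Adj (.orig q.1) (.mid q.2)}
  have h1 : vertEdges μ = (fun q => q.2.1) '' T := by
    ext e
    constructor
    · rintro ⟨x, he, hx⟩
      exact ⟨(x, ⟨e, he⟩), hx, rfl⟩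
    · rintro ⟨⟨x, e⟩, hx, rfl⟩
      exact ⟨x, e.2, hx⟩
  have h1' : Set.InjOn (fun q : V × G.edgeSet => q.2.1) T := by
    rintro ⟨x, e⟩ hx ⟨y, e'⟩ hy hxy
    obtain rfl : e = e' := Subtype.ext hxy
    have : x = y := hp.vert.site_unique ⟨e.2, hx⟩ ⟨e.2, hy⟩
    rw [this]
  let g : V × G.edgeSet → Sym2 E.RefVertex := fun q => s(.orig q.1, .mid q.2)
  have h2 : Set.InjOn g T := by
    rintro ⟨x, e⟩ - ⟨y, e'⟩ - hxy
    simpa [g] using hxy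
  have h3 : μ.edgeSet ∩ Function.mulSupport (E.refWeight w) =
      g '' T ∩ Function.mulSupport (E.refWeight w) := by
    ext a
    refine and_congr_left fun ha => ?_
    constructor
    · intro hadj
      induction a using Sym2.ind with
      | _ a b =>
        rcases a with x | e | φ <;> rcases b with y | e' | ψ <;>
          try exact absurd rfl ha
        · exact ⟨(x, e'), hadj, rfl⟩
        · exact ⟨(y, e), SimpleGraph.Subgraph.Adj.symm hadj, Sym2.eq_swap⟩
    · rintro ⟨q, hq, rfl⟩
      exact hq
  unfold subgraphWeight
  rw [forestOf_edgeSet h hμ, h1, finprod_mem_image h1',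
    ← finprod_mem_inter_mulSupport (E.refWeight w), h3, finprod_mem_inter_mulSupport,
    finprod_mem_image h2]
  rfl

variable [Finite V]

theorem injOn_forestOf (h : E.IsFrame v v' f f') :
    Set.InjOn (forestOf v v') (E.matchingSet v v' f') := by
  intro μ hμ μ' hμ' heq
  have hp := isPairing_of_mem h hμ
  have hp' := isPairing_of_mem h hμ'
  have hF : vertEdges μ' = vertEdges μ := by
    rw [← forestOf_edgeSet h hμ, ← forestOf_edgeSet h hμ', heq]
  rw [hF] at hp'
  exact eq_of_pairing_eq h hμ hμ' (hp.vert.unique hp'.vert (hp.exists_vert_sink h))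
    (hp.face.unique hp'.face (hp.exists_face_sink h))

theorem hasOrientedEdge_iff (h : E.IsFrame v v' f f') (hμ : μ ∈ E.matchingSet v v' f')
    (d : G.Dart) : HasOrientedEdge (forestOf v v' μ) (fun i : Fin (n + 1) => v' (oddIdx i))
      d.fst d.snd ↔ μ.Adj (.orig d.fst) (.mid ⟨d.edge, d.edge_mem⟩) := by
  have hp := isPairing_of_mem h hμ
  have hm := hp.vert
  rw [← forestOf_edgeSet h hμ] at hm
  change IsMatchingOn _ _ (forestOf v v' μ).spanningCoe.edgeSet _ at hm
  rw [← vertPairing_dart]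
  constructor
  · rintro ⟨hadj, i, q, hq⟩
    exact hm.of_isPath (forestOf v v' μ).spanningCoe_le (root_notMem_freeVerts i) q hadj hq
  · intro hd
    have hs : Step (fun d : G.Dart => d.fst) (vertPairing μ) d.fst d.snd := ⟨d, hd, rfl, rfl⟩
    have hadj := hm.adj_of_step hs
    have hsnd : ∀ s, d.snd ≠ evenVert v v' s :=
      (forestOf v v' μ).edge_vert (SimpleGraph.Subgraph.Adj.symm hadj)
    obtain ⟨i, hi⟩ := hp.exists_root h hsnd
    obtain ⟨q, hq, hqs⟩ := hm.exists_isPath (root_notMem_freeVerts i) hi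
    refine ⟨hadj, i, q, (SimpleGraph.Walk.cons_isPath_iff _ _).2 ⟨hq, fun hx => ?_⟩⟩
    exact hm.not_flowsTo_of_step (root_notMem_freeVerts i) hi hs (hqs _ hx)

end PlaneEmbedding

/-! ### Matchings containing the alternate edges of a path -/

section Walk

variable {W : Type*} {H : SimpleGraph W} {s t : W} {P : H.Walk s t} {m : ℕ}

theorem getVert_inj (hP : P.IsPath) {i j : ℕ} (hi : i ≤ P.length) (hj : j ≤ P.length)
    (h : P.getVert i = P.getVert j) : i = j :=
  hP.getVert_injOn hi hj h

theorem getVert_ne_end (hP : P.IsPath) {i : ℕ} (hi : i < P.length) : P.getVert i ≠ t := fun h =>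
  hi.ne (getVert_inj hP hi.le le_rfl (h.trans P.getVert_length.symm))

/-- The first vertex of the path can only be matched with the second one, so the third with the
fourth, and so on. -/
theorem adj_of_containsMatchingOf {μ : H.Subgraph} (hP : P.IsPath) (hlen : P.length = 2 * m)
    (h : ContainsMatchingOf μ P) (l : ℕ) (hl : l < m) :
    μ.Adj (P.getVert (2 * l)) (P.getVert (2 * l + 1)) := by
  obtain ⟨M, ⟨hMle, hMverts, hM⟩, hsub⟩ := h
  suffices h : M.Adj (P.getVert (2 * l)) (P.getVert (2 * l + 1)) from
    SimpleGraph.Subgraph.mem_edgeSet.1 (hsub (SimpleGraph.Subgraph.mem_edgeSet.2 h))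
  induction l with
  | zero =>
    have hmem : P.getVert (2 * 0) ∈ M.verts := by
      rw [hMverts]
      refine ⟨(P.mem_verts_toSubgraph).2 (P.getVert_mem_support _), getVert_ne_end hP (by omega)⟩
    obtain ⟨w, hw, -⟩ := hM hmem
    obtain ⟨i, hi, hil⟩ :=
      P.toSubgraph_adj_iff.1 (SimpleGraph.Subgraph.deleteVerts_le.2 (hMle.2 hw))
    rcases Sym2.eq_iff.1 hi with ⟨h1, h2⟩ | ⟨-, h1⟩
    · obtain rfl := getVert_inj hP (by omega) (by omega) h1
      rwa [h2]
    · have := getVert_inj hP (by omega) (by omega) h1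
      omega
  | succ l ih =>
    have ih := ih (by omega)
    have hmem : P.getVert (2 * (l + 1)) ∈ M.verts := by
      rw [hMverts]
      refine ⟨(P.mem_verts_toSubgraph).2 (P.getVert_mem_support _), getVert_ne_end hP (by omega)⟩
    obtain ⟨w, hw, -⟩ := hM hmem
    obtain ⟨i, hi, hil⟩ :=
      P.toSubgraph_adj_iff.1 (SimpleGraph.Subgraph.deleteVerts_le.2 (hMle.2 hw))
    rcases Sym2.eq_iff.1 hi with ⟨h1, h2⟩ | ⟨h2, h1⟩
    · obtain rfl := getVert_inj hP (by omega) (by omega) h1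
      rwa [h2]
    · obtain rfl : i = 2 * l + 1 := by
        have := getVert_inj hP (by omega) (by omega) h1
        omega
      rw [← h2] at hw
      have := getVert_inj hP (by omega) (by omega)
        ((hM (M.edge_vert hw.symm)).unique hw.symm ih.symm)
      omega

/-- A subgraph contains the perfect matching of a path of even length without its last vertex if
and only if it contains every second edge, starting with the first. -/
theorem containsMatchingOf_iff {μ : H.Subgraph} (hP : P.IsPath) (hlen : P.length = 2 * m) :
    ContainsMatchingOf μ P ↔ ∀ l < m, μ.Adj (P.getVert (2 * l)) (P.getVert (2 * l + 1)) := by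
  refine ⟨adj_of_containsMatchingOf hP hlen, fun h => ?_⟩
  let M : H.Subgraph :=
    { verts := {x | ∃ i < 2 * m, P.getVert i = x}
      Adj := fun x y => ∃ l < m, s(P.getVert (2 * l), P.getVert (2 * l + 1)) = s(x, y)
      adj_sub := by
        rintro x y ⟨l, hl, he⟩
        have := P.adj_getVert_succ (i := 2 * l) (by omega)
        rwa [← SimpleGraph.mem_edgeSet, he] at this
      edge_vert := by
        rintro x y ⟨l, hl, he⟩
        rcases Sym2.eq_iff.1 he with ⟨h1, -⟩ | ⟨-, h1⟩
        · exact ⟨_, by omega, h1⟩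
        · exact ⟨2 * l + 1, by omega, h1⟩
      symm := ⟨fun x y ⟨l, hl, he⟩ => ⟨l, hl, he.trans Sym2.eq_swap⟩⟩ }
  have hverts : M.verts = (P.toSubgraph.deleteVerts {t}).verts := by
    ext x
    rw [SimpleGraph.Subgraph.deleteVerts_verts, Set.mem_sdiff, P.mem_verts_toSubgraph,
      SimpleGraph.Walk.mem_support_iff_exists_getVert, Set.mem_singleton_iff]
    constructor
    · rintro ⟨i, hi, rfl⟩
      exact ⟨⟨i, rfl, by omega⟩, getVert_ne_end hP (by omega)⟩
    · rintro ⟨⟨i, rfl, hi⟩, hne⟩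
      refine ⟨i, lt_of_le_of_ne (hlen ▸ hi) ?_, rfl⟩
      rintro rfl
      rw [← hlen] at hne
      exact hne P.getVert_length
  refine ⟨M, ⟨⟨hverts.le, ?_⟩, hverts, ?_⟩, ?_⟩
  · intro x y hxy
    have hx := hverts ▸ M.edge_vert hxy
    have hy := hverts ▸ M.edge_vert hxy.symm
    obtain ⟨l, hl, he⟩ := hxy
    exact SimpleGraph.Subgraph.deleteVerts_adj.2
      ⟨hx.1, hx.2, hy.1, hy.2, P.toSubgraph_adj_iff.2 ⟨_, he, by omega⟩⟩
  · rintro _ ⟨i, hi, rfl⟩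
    rcases Nat.even_or_odd' i with ⟨l, rfl | rfl⟩
    · refine ⟨P.getVert (2 * l + 1), ⟨l, by omega, rfl⟩, ?_⟩
      rintro y ⟨k, hk, he⟩
      rcases Sym2.eq_iff.1 he with ⟨h1, h2⟩ | ⟨-, h1⟩
      · have := getVert_inj hP (by omega) (by omega) h1
        rw [← h2, this]
      · have := getVert_inj hP (by omega) (by omega) h1
        omega
    · refine ⟨P.getVert (2 * l), ⟨l, by omega, Sym2.eq_swap⟩, ?_⟩
      rintro y ⟨k, hk, he⟩
      rcases Sym2.eq_iff.1 he with ⟨h1, -⟩ | ⟨h2, h1⟩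
      · have := getVert_inj hP (by omega) (by omega) h1
        omega
      · have := getVert_inj hP (by omega) (by omega) h1
        rw [← h2, show 2 * k = 2 * l by omega]
  · intro e he
    induction e using Sym2.ind with
    | _ x y =>
      obtain ⟨l, hl, he⟩ := SimpleGraph.Subgraph.mem_edgeSet.1 he
      rw [← he]
      exact h l hl

end Walk

namespace PlaneEmbedding

variable {V : Type*} {G : SimpleGraph V} {E : PlaneEmbedding G} {n : ℕ}
  {v v' : Fin (2 * n + 1) → V} {f f' : Fin n → E.BoundedFace} {μ : E.dualRefinement.Subgraph}
  {a b : E.RefVertex}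

theorem getVert_mid_iff (P : E.dualRefinement.Walk a b) (ha : ∀ e, a ≠ .mid e) {i : ℕ}
    (hi : i ≤ P.length) : (∃ e, P.getVert i = .mid e) ↔ i % 2 = 1 := by
  induction i with
  | zero => simpa using ha
  | succ i ih =>
    have ih := ih (by omega)
    have hadj := P.adj_getVert_succ (i := i) (by omega)
    constructor
    · rintro ⟨e, he⟩
      have : ¬ i % 2 = 1 := by
        rw [← ih]
        rintro ⟨e', he'⟩
        rw [he, he'] at hadj
        exact not_adj_mid_mid hadj
      omega
    · intro hodd
      rcases exists_mid_of_adj hadj with h | h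
      · have := ih.1 h
        omega
      · exact h

/-- A path of the dual refinement between two sites alternates between sites and edge-vertices. -/
theorem exists_alternating (P : E.dualRefinement.Walk a b) (ha : ∀ e, a ≠ .mid e)
    (hb : ∀ e, b ≠ .mid e) : ∃ m, P.length = 2 * m ∧ (∀ l e, P.getVert (2 * l) ≠ .mid e) ∧
      ∃ ε : ℕ → Sym2 V, ∀ l < m,
        ∃ he : ε l ∈ G.edgeSet, P.getVert (2 * l + 1) = .mid ⟨ε l, he⟩ := by
  have hlen : ¬ P.length % 2 = 1 := by
    rw [← getVert_mid_iff P ha le_rfl, P.getVert_length, not_exists]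
    exact hb
  refine ⟨P.length / 2, by omega, fun l e he => ?_, ?_⟩
  · by_cases hl : 2 * l ≤ P.length
    · have := (getVert_mid_iff P ha hl).1 ⟨e, he⟩
      omega
    · rw [P.getVert_of_length_le (by omega)] at he
      exact hb e he
  · have : ∀ l, ∃ ε : Sym2 V, l < P.length / 2 →
        ∃ he : ε ∈ G.edgeSet, P.getVert (2 * l + 1) = .mid ⟨ε, he⟩ := by
      intro l
      by_cases hl : l < P.length / 2
      · obtain ⟨e, he⟩ := (getVert_mid_iff P ha (i := 2 * l + 1) (by omega)).2 (by omega)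
        exact ⟨e.1, fun _ => ⟨e.2, he⟩⟩
      · obtain ⟨d, -⟩ := E.faceOf_surjective E.outer
        exact ⟨d.edge, fun h => absurd h hl⟩
    choose ε hε using this
    exact ⟨ε, hε⟩

/-- The chain of vertices and edges of a path in `G`. -/
theorem exists_frame_chain {P : E.dualRefinement.Walk a b} (hP : E.IsFramePath P)
    (ha : ∀ e, a ≠ .mid e) (hb : ∀ e, b ≠ .mid e) :
    ∃ (m : ℕ) (σ : ℕ → V) (ε : ℕ → Sym2 V), P.length = 2 * m ∧
      (∀ l, P.getVert (2 * l) = .orig (σ l)) ∧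
      (∀ l < m, ∃ he : ε l ∈ G.edgeSet, P.getVert (2 * l + 1) = .mid ⟨ε l, he⟩) ∧
      ∀ l < m, ∃ d : G.Dart, d.edge = ε l ∧ d.fst = σ l ∧ d.symm.fst = σ (l + 1) := by
  obtain ⟨m, hlen, hsite, ε, hε⟩ := exists_alternating P ha hb
  have : ∀ l, ∃ x, P.getVert (2 * l) = .orig x := by
    intro l
    rcases hl : P.getVert (2 * l) with x | e | φ
    · exact ⟨x, rfl⟩
    · exact absurd hl (hsite l e)
    · exact absurd (hl ▸ P.getVert_mem_support _) (hP.2 φ)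
  choose σ hσ using this
  refine ⟨m, σ, ε, hlen, hσ, hε, fun l hl => ?_⟩
  obtain ⟨he, hmid⟩ := hε l hl
  have h1 := P.adj_getVert_succ (i := 2 * l) (by omega)
  have h2 := P.adj_getVert_succ (i := 2 * l + 1) (by omega)
  rw [hmid, hσ, adj_orig_mid] at h1
  rw [hmid, show 2 * l + 1 + 1 = 2 * (l + 1) by ring, hσ, SimpleGraph.adj_comm,
    adj_orig_mid] at h2
  have hne : σ l ≠ σ (l + 1) := by
    intro h
    have := getVert_inj hP.1 (i := 2 * l) (j := 2 * (l + 1)) (by omega) (by omega)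
      (by rw [hσ, hσ, h])
    omega
  obtain ⟨d, hd, hd'⟩ := exists_dart_of_mem he h1
  refine ⟨d, hd, hd', ?_⟩
  change σ (l + 1) ∈ ε l at h2
  rw [← hd, mem_edge_iff, hd'] at h2
  exact (h2.resolve_left hne.symm).symm

/-- The chain of faces and edges of a path in `G*`. -/
theorem exists_dual_chain {P : E.dualRefinement.Walk a b} (hP : E.IsDualFramePath P)
    (ha : ∀ e, a ≠ .mid e) (hb : ∀ e, b ≠ .mid e) :
    ∃ (m : ℕ) (σ : ℕ → E.BoundedFace) (ε : ℕ → Sym2 V), P.length = 2 * m ∧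
      (∀ l, P.getVert (2 * l) = .face (σ l)) ∧
      (∀ l < m, ∃ he : ε l ∈ G.edgeSet, P.getVert (2 * l + 1) = .mid ⟨ε l, he⟩) ∧
      ∀ l < m, ∃ d : G.Dart, d.edge = ε l ∧ E.faceOf d = (σ l).1 ∧
        E.faceOf d.symm = (σ (l + 1)).1 := by
  obtain ⟨m, hlen, hsite, ε, hε⟩ := exists_alternating P ha hb
  have : ∀ l, ∃ φ, P.getVert (2 * l) = .face φ := by
    intro l
    rcases hl : P.getVert (2 * l) with x | e | φ
    · exact absurd (hl ▸ P.getVert_mem_support _) (hP.2 x)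
    · exact absurd hl (hsite l e)
    · exact ⟨φ, rfl⟩
  choose σ hσ using this
  refine ⟨m, σ, ε, hlen, hσ, hε, fun l hl => ?_⟩
  obtain ⟨he, hmid⟩ := hε l hl
  have h1 := P.adj_getVert_succ (i := 2 * l) (by omega)
  have h2 := P.adj_getVert_succ (i := 2 * l + 1) (by omega)
  rw [hmid, hσ, adj_face_mid] at h1
  rw [hmid, show 2 * l + 1 + 1 = 2 * (l + 1) by ring, hσ, SimpleGraph.adj_comm,
    adj_face_mid] at h2
  have hne : σ l ≠ σ (l + 1) := by
    intro h
    have := getVert_inj hP.1 (i := 2 * l) (j := 2 * (l + 1)) (by omega) (by omega)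
      (by rw [hσ, hσ, h])
    omega
  obtain ⟨d, hd, hd'⟩ := h1
  obtain ⟨d₂, hd₂, hd₂'⟩ := h2
  refine ⟨d, hd, hd', ?_⟩
  rcases (SimpleGraph.dart_edge_eq_iff _ _).1 (hd₂.trans hd.symm) with rfl | rfl
  · exact absurd (Subtype.ext (hd'.symm.trans hd₂')) hne
  · exact hd₂'

/-- The edges of a path are distinct. -/
theorem chain_edge_ne {P : E.dualRefinement.Walk a b} (hP : P.IsPath) {m : ℕ}
    (hlen : P.length = 2 * m) {ε : ℕ → Sym2 V}
    (hε : ∀ l < m, ∃ he : ε l ∈ G.edgeSet, P.getVert (2 * l + 1) = .mid ⟨ε l, he⟩) (l : ℕ)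
    (hl : l + 1 < m) : ε l ≠ ε (l + 1) := by
  intro h
  obtain ⟨he, h1⟩ := hε l (by omega)
  obtain ⟨he', h2⟩ := hε (l + 1) hl
  have := getVert_inj hP (i := 2 * l + 1) (j := 2 * (l + 1) + 1) (by omega)
    (by omega) (by simp [h1, h2, h])
  omega

theorem containsMatchingOf_iff_containedInForest (h : E.IsFrame v v' f f')
    (hμ : μ ∈ E.matchingSet v v' f') (i : Fin (n + 1))
    {P : E.dualRefinement.Walk a b} (ha : ∀ e, a ≠ .mid e) (hb : b = .orig (v' (oddIdx i)))
    (hP : E.IsFramePath P) :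
    ContainsMatchingOf μ P ↔ E.ContainedInForest P (forestOf v v' μ) := by
  have hp := isPairing_of_mem h hμ
  obtain ⟨m, σ, ε, hlen, hσ, hε, hinc⟩ := exists_frame_chain hP ha (by simp [hb])
  have hend : σ m = v' (oddIdx i) := by
    have h1 := hσ m
    rw [← hlen, P.getVert_length, hb] at h1
    simpa using h1.symm
  have key : ContainsMatchingOf μ P ↔ ∀ l < m, vertPairing μ (σ l) (ε l) := by
    rw [containsMatchingOf_iff hP.1 hlen]
    refine forall₂_congr fun l hl => ?_
    obtain ⟨he, h1⟩ := hε l hl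
    rw [hσ, h1]
    exact ⟨fun h => ⟨he, h⟩, fun ⟨_, h⟩ => h⟩
  rw [key, ContainedInForest, forestOf_edgeSet h hμ]
  simp only [SimpleGraph.Walk.mem_support_iff_exists_getVert]
  constructor
  · intro hm
    constructor
    · rintro x ⟨k, hk, hkl⟩
      obtain ⟨l, rfl | rfl⟩ := Nat.even_or_odd' k
      · rw [hσ, RefVertex.orig.injEq] at hk
        subst hk
        rcases lt_or_eq_of_le (show l ≤ m by omega) with hl | rfl
        · exact (hp.vert.site_mem (hm l hl)).1
        · rw [hend]
          exact h.odd_right_ne i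
      · obtain ⟨_, h1⟩ := hε l (by omega)
        simp [h1] at hk
    · rintro e ⟨k, hk, hkl⟩
      obtain ⟨l, rfl | rfl⟩ := Nat.even_or_odd' k
      · simp [hσ] at hk
      · obtain ⟨_, h1⟩ := hε l (by omega)
        rw [h1, RefVertex.mid.injEq] at hk
        subst hk
        exact ⟨_, hm l (by omega)⟩
  · rintro ⟨-, hedge⟩
    refine hp.vert.of_chain hinc (fun l hl => ?_) (chain_edge_ne hP.1 hlen hε) ?_
    · obtain ⟨he, h1⟩ := hε l hl
      exact hedge ⟨ε l, he⟩ ⟨_, h1, by omega⟩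
    · rw [hend]
      exact root_notMem_freeVerts i

variable [Finite V]

theorem containsMatchingOf_iff_containedInChannel (h : E.IsFrame v v' f f')
    (hμ : μ ∈ E.matchingSet v v' f') (i : Fin n)
    {P : E.dualRefinement.Walk a b} (ha : a = .face (f i)) (hb : b = .face (f' i))
    (hP : E.IsDualFramePath P) :
    ContainsMatchingOf μ P ↔ E.ContainedInChannel P (forestOf v v' μ) := by
  have hp := isPairing_of_mem h hμ
  obtain ⟨m, σ, ε, hlen, hσ, hε, hinc⟩ := exists_dual_chain hP (by simp [ha]) (by simp [hb])
  have hstart : σ 0 = f i := by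
    have h1 := hσ 0
    rw [mul_zero, P.getVert_zero, ha] at h1
    simpa using h1.symm
  have hend : σ m = f' i := by
    have h1 := hσ m
    rw [← hlen, P.getVert_length, hb] at h1
    simpa using h1.symm
  have key : ContainsMatchingOf μ P ↔ ∀ l < m, facePairing μ (σ l).1 (ε l) := by
    rw [containsMatchingOf_iff hP.1 hlen]
    refine forall₂_congr fun l hl => ?_
    obtain ⟨he, h1⟩ := hε l hl
    rw [hσ, h1]
    exact ⟨fun h => ⟨(σ l).2, he, h⟩, fun ⟨_, _, h⟩ => h⟩
  have hF := forestOf_edgeSet h hμ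
  rw [key, ContainedInChannel]
  simp only [SimpleGraph.Walk.mem_support_iff_exists_getVert]
  constructor
  · intro hm
    have hnot : ∀ l < m, ε l ∉ (forestOf v v' μ).edgeSet := fun l hl h' => by
      rw [hF] at h'
      exact (hp.face.edge_mem (hm l hl)).2 (Or.inl h')
    obtain ⟨T, hT, hf, -⟩ := sameChannel_forestOf h hμ i
    have hσT : ∀ l ≤ m, σ l ∈ T.supp := by
      intro l
      induction l with
      | zero => exact fun _ => hstart ▸ hf
      | succ l ih =>
        intro hl
        obtain ⟨d, hd, h1, h2⟩ := hinc l hl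
        have hr : (E.dualForest (forestOf v v' μ)).Reachable (σ l) (σ (l + 1)) :=
          dualForest_reachable_of_dart h1 h2 (hd ▸ hnot l hl)
        have hT' := ih (by omega)
        rw [SimpleGraph.ConnectedComponent.mem_supp_iff] at hT' ⊢
        rw [← hT']
        exact (SimpleGraph.ConnectedComponent.eq.2 hr).symm
    refine ⟨T, hT, ?_, ?_⟩
    · rintro φ ⟨k, hk, hkl⟩
      obtain ⟨l, rfl | rfl⟩ := Nat.even_or_odd' k
      · rw [hσ, RefVertex.face.injEq] at hk
        subst hk
        exact hσT l (by omega)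
      · obtain ⟨_, h1⟩ := hε l (by omega)
        simp [h1] at hk
    · rintro e ⟨k, hk, hkl⟩
      obtain ⟨l, rfl | rfl⟩ := Nat.even_or_odd' k
      · simp [hσ] at hk
      · obtain ⟨_, h1⟩ := hε l (by omega)
        rw [h1, RefVertex.mid.injEq] at hk
        subst hk
        exact hnot l (by omega)
  · rintro ⟨-, -, -, hedge⟩
    refine hp.face.of_chain (σ := fun l => (σ l).1) hinc (fun l hl => ?_)
      (chain_edge_ne hP.1 hlen hε) ?_
    · obtain ⟨he, h1⟩ := hε l hl
      obtain ⟨d, hd, h2, h3⟩ := hinc l hl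
      have := hedge ⟨ε l, he⟩ ⟨_, h1, by omega⟩
      rw [← hF, ← hd]
      exact dualForest_adj_mem h h2 h3 (hd ▸ this)
    · simp only [hend]
      exact notMem_freeFaces i

end PlaneEmbedding

/-! ### The bijection between matchings and forests -/

namespace PlaneEmbedding

variable {V : Type*} [Finite V] {G : SimpleGraph V} {E : PlaneEmbedding G} {n : ℕ}
  {v v' : Fin (2 * n + 1) → V} {f f' : Fin n → E.BoundedFace}

theorem bijOn_forestOf (h : E.IsFrame v v' f f') :
    Set.BijOn (forestOf v v') (E.matchingSet v v' f') (E.forestSet v v' f f') :=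
  ⟨fun _ hμ => forestOf_mem h h.inCCWOrder_odd hμ, injOn_forestOf h,
    fun _ hF => exists_forestOf_eq h hF⟩

theorem forall_containsMatchingOf_iff (h : E.IsFrame v v' f f')
    {P : ∀ j : Fin (2 * n + 1), E.dualRefinement.Walk (E.terminal v f j) (E.terminal v' f' j)}
    (hodd : ∀ i : Fin (n + 1), E.IsFramePath (P (oddIdx i)))
    (heven : ∀ i : Fin n, E.IsDualFramePath (P (evenIdx i))) (I : Set (Fin (2 * n + 1)))
    {μ : E.dualRefinement.Subgraph} (hμ : μ ∈ E.matchingSet v v' f') :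
    (∀ j ∈ I, ContainsMatchingOf μ (P j)) ↔
      (∀ i : Fin (n + 1), oddIdx i ∈ I →
        E.ContainedInForest (P (oddIdx i)) (forestOf v v' μ)) ∧
      ∀ i : Fin n, evenIdx i ∈ I →
        E.ContainedInChannel (P (evenIdx i)) (forestOf v v' μ) := by
  have h1 := fun i => containsMatchingOf_iff_containedInForest h hμ i
    (fun e => by simp [terminal_oddIdx]) (terminal_oddIdx i) (hodd i)
  have h2 := fun i => containsMatchingOf_iff_containedInChannel h hμ i
    (terminal_evenIdx i) (terminal_evenIdx i) (heven i)
  constructor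
  · exact fun hI => ⟨fun i hi => (h1 i).1 (hI _ hi), fun i hi => (h2 i).1 (hI _ hi)⟩
  · rintro ⟨h3, h4⟩ j hj
    rcases exists_oddIdx_or_evenIdx j with ⟨i, rfl⟩ | ⟨i, rfl⟩
    · exact (h1 i).2 (h3 i hj)
    · exact (h2 i).2 (h4 i hj)

end PlaneEmbedding

theorem theorem5p4 {V R : Type*} [Finite V] [CommMonoid R] {G : SimpleGraph V}
    (E : PlaneEmbedding G) (n : ℕ) (v v' : Fin (2 * n + 1) → V) (f f' : Fin n → E.BoundedFace)
    -- the primed vertices form a path in `G`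
    (hpath : ∀ j : Fin (2 * n), G.Adj (v' j.castSucc) (v' j.succ))
    -- counterclockwise cyclic order on the boundary of the infinite face
    (hcyc : E.InCCWOrder ⊤ (List.ofFn v ++ (List.ofFn v').reverse))
    -- even-numbered vertices have degree two and belong to distinct bounded faces `f`, `f'`
    (hdeg : ∀ i : Fin n, (G.neighborSet (v (evenIdx i))).ncard = 2)
    (hdeg' : ∀ i : Fin n, (G.neighborSet (v' (evenIdx i))).ncard = 2)
    (hf : ∀ i : Fin n, E.VertexOnFace (v (evenIdx i)) (f i).1)
    (hf' : ∀ i : Fin n, E.VertexOnFace (v' (evenIdx i)) (f' i).1)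
    (hdistinct : Function.Injective (Sum.elim f f')) :
    ∃ Φ : E.dualRefinement.Subgraph → G.Subgraph,
      -- part (a)
      Set.BijOn Φ (E.matchingSet v v' f') (E.forestSet v v' f f') ∧
      -- the bijection preserves all weights
      (∀ w : Sym2 V → R, ∀ μ ∈ E.matchingSet v v' f',
        subgraphWeight w (Φ μ) = subgraphWeight (E.refWeight w) μ) ∧
      -- naturality: half-edges in the matching are the tails of the edges of the forest
      (∀ μ ∈ E.matchingSet v v' f', ∀ d : G.Dart,
        HasOrientedEdge (Φ μ) (fun i : Fin (n + 1) => v' (oddIdx i)) d.fst d.snd ↔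
          μ.Adj (.orig d.fst) (.mid ⟨d.edge, d.edge_mem⟩)) ∧
      -- part (b)
      ∀ P : ∀ j : Fin (2 * n + 1), E.dualRefinement.Walk (E.terminal v f j) (E.terminal v' f' j),
        (∀ i : Fin (n + 1), E.IsFramePath (P (oddIdx i))) →
        (∀ i : Fin n, E.IsDualFramePath (P (evenIdx i))) →
        (∀ j k, j ≠ k → List.Disjoint (P j).support (P k).support) →
        ∀ I : Set (Fin (2 * n + 1)),
          Set.BijOn Φ
            {μ ∈ E.matchingSet v v' f' | ∀ j ∈ I, ContainsMatchingOf μ (P j)}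
            {F ∈ E.forestSet v v' f f' |
              (∀ i : Fin (n + 1), oddIdx i ∈ I → E.ContainedInForest (P (oddIdx i)) F) ∧
              ∀ i : Fin n, evenIdx i ∈ I → E.ContainedInChannel (P (evenIdx i)) F} := by
  have h : E.IsFrame v v' f f' := ⟨hpath, hcyc, hdeg, hdeg', hf, hf', hdistinct⟩
  have hbij := PlaneEmbedding.bijOn_forestOf h
  refine ⟨PlaneEmbedding.forestOf v v', hbij,
    fun w μ hμ => PlaneEmbedding.subgraphWeight_forestOf h hμ w,
    fun μ hμ d => PlaneEmbedding.hasOrientedEdge_iff h hμ d, fun P hodd heven _ I => ?_⟩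
  have hiff := fun μ => PlaneEmbedding.forall_containsMatchingOf_iff h hodd heven I (μ := μ)
  refine ⟨fun μ hμ => ⟨hbij.mapsTo hμ.1, (hiff μ hμ.1).1 hμ.2⟩,
    hbij.injOn.mono fun μ hμ => hμ.1, ?_⟩
  rintro F ⟨hF, hF'⟩
  obtain ⟨μ, hμ, rfl⟩ := hbij.surjOn hF
  exact ⟨μ, ⟨hμ, (hiff μ hμ).2 hF'⟩, rfl⟩
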